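/- Let $N\ge 3$, let $a_1,a_2$ be a basis of $\mathbb{R}^2$, and let $\Omega=\mathbb{R}^2/(\mathbb{Z}a_1+\mathbb{Z}a_2)$ be the corresponding flat torus (a doubly periodic domain) with area $|\Omega|$. Let $K$ be the $N\times N$ Cartan matrix of $SU(N+1)$ (entries $2$ on the diagonal, $-1$ on the two adjacent diagonals, $0$ elsewhere), $(a_{jk})=K^{-1}$, $r_j=\sum_{k=1}^N a_{jk}$ for $1\le j\le N$, and $r_0=r_{N+1}=0$. Let $n_1,\dots,n_N\ge 0$ be integers, not all zero, let $p_{j1},\dots,p_{jn_j}\in\Omega$ ($1\le j\le N$) be points, repeated with multiplicity, and put $b_j=4\pi\sum_{k=1}^N a_{jk}n_k$. Let $u_j^0\in L^1(\Omega)$ be the distributional solution of $$\Delta u_j^0=4\pi\sum_{k=1}^{n_j}\delta_{p_{jk}}-\frac{4\pi n_j}{|\Omega|},\qquad \int_\Omega u_j^0\,dx=0 .$$ Let $\lambda>0$, let $\dot W^{1,2}(\Omega)$ be the space of functions in $W^{1,2}(\Omega)$ with zero mean, and let $$\mathcal{A}=\Big\{\mathbf{w}=(w_1,\dots,w_N)\in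 \dot W^{1,2}(\Omega)^N:\ \Big(\int_\Omega e^{u_j^0+w_j}dx\Big)^2\ \ge\ \frac{8b_j}{\lambda}\int_\Omega e^{2(u_j^0+w_j)}dx,\ \ j=1,\dots,N\Big\}.$$ For $\mathbf{w}\in\mathcal{A}$, $\varepsilon\in\{0,1\}^N$, $s\in[0,1]$ and $t\in\mathbb{R}^N$ let $$\tilde Q_j(s)=\int_\Omega e^{u_j^0+w_j}\big(1+s\,r_{j-1}t_{j-1}e^{u_{j-1}^0+w_{j-1}}+s\,r_{j+1}t_{j+1}e^{u_{j+1}^0+w_{j+1}}\big)dx$$ (the terms with index $0$ or $N+1$ being absent), and let $\Phi_{s,\varepsilon}(t)\in\mathbb{R}^N$ be the vector with components $$t_j-\frac{1}{4r_j\int_\Omega e^{2(u_j^0+w_j)}dx}\left[\tilde Q_j(s)-(-1)^{\varepsilon_j}\sqrt{\tilde Q_j(s)^2-\frac{8b_j}{\lambda}\int_\Omega e^{2(u_j^0+w_j)}dx}\,\right],\qquad j=1,\dots,N.$$ Then, for every $\varepsilon\in\{0,1\}^N$ and $s\in[0,1]$: 1. For every $\mathbf{w}\in\mathcal{A}$ the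 equation $\Phi_{s,\varepsilon}(t)=0$ has exactly one solution $t=t(\mathbf{w})\in\mathbb{R}^N$ (uniqueness holds even if the square root of a negative number is read as $0$). All components of $t(\mathbf{w})$ are positive. The solution is non-degenerate: $\Phi_{s,\varepsilon}$ is differentiable at $t(\mathbf{w})$ with invertible Jacobian matrix. 2. The map $\mathbf{w}\mapsto t(\mathbf{w})$ is continuous on $\mathcal{A}$. If $s>0$ it is $C^\infty$ on $\mathcal{A}$, in the sense that near each point of $\mathcal{A}$ it is the restriction to $\mathcal{A}$ of a $C^\infty$ map defined on an open subset of $\dot W^{1,2}(\Omega)^N$. If $s=0$ the same holds near each point of $\mathcal{A}$ at which all $N$ defining inequalities of $\mathcal{A}$ are strict. -/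

import Mathlib

noncomputable section

namespace ChernSimons

open MeasureTheory Set
open scoped ContDiff

/-- The Euclidean plane. -/
abbrev Plane : Type := EuclideanSpace ℝ (Fin 2)

/-- A doubly periodic domain is the flat torus `ℝ² / (ℤ a₁ + ℤ a₂)`, where `a₁, a₂` is the basis
`a` of the plane. Functions on it are `a`-periodic functions on the plane, and integrals are taken
over the half-open period parallelogram. -/
abbrev cell (a : Module.Basis (Fin 2) ℝ Plane) : Set Plane :=
  ZSpan.fundamentalDomain a

/-- The area `|Ω|`. -/
def area (a : Module.Basis (Fin 2) ℝ Plane) : ℝ := volume.real (cell a)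

/-- Double periodicity: invariance under translation by the two generators of the lattice. -/
def IsPeriodic (a : Module.Basis (Fin 2) ℝ Plane) (f : Plane → ℝ) : Prop :=
  ∀ (i : Fin 2) (x : Plane), f (x + a i) = f x

/-- Test functions on the torus: smooth doubly periodic functions. -/
def IsTest (a : Module.Basis (Fin 2) ℝ Plane) (φ : Plane → ℝ) : Prop :=
  ContDiff ℝ ∞ φ ∧ IsPeriodic a φ

/-- The partial derivative `∂ᵢ φ`. -/
def partialDeriv (i : Fin 2) (φ : Plane → ℝ) (x : Plane) : ℝ :=
  fderiv ℝ φ x (EuclideanSpace.single i 1)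

/-- The real space `L²(Ω)`. -/
abbrev L2 (a : Module.Basis (Fin 2) ℝ Plane) : Type :=
  Lp ℝ 2 ((volume : Measure Plane).restrict (cell a))

/-- `g` is the weak derivative `∂ᵢ f` on the torus. -/
def IsWeakPartial (a : Module.Basis (Fin 2) ℝ Plane) (i : Fin 2) (f g : L2 a) : Prop :=
  ∀ φ : Plane → ℝ, IsTest a φ →
    ∫ x in cell a, f x * partialDeriv i φ x = -∫ x in cell a, g x * φ x

theorem integrable_mul_of_continuous (a : Module.Basis (Fin 2) ℝ Plane) (f : L2 a)
    {φ : Plane → ℝ} (hφ : Continuous φ) :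
    Integrable (fun x => f x * φ x) ((volume : Measure Plane).restrict (cell a)) := by
  have hb : Bornology.IsBounded (cell a) := ZSpan.fundamentalDomain_isBounded a
  have hfin : IsFiniteMeasure ((volume : Measure Plane).restrict (cell a)) :=
    ⟨by simpa using hb.measure_lt_top⟩
  obtain ⟨C, hC⟩ := hb.isCompact_closure.exists_bound_of_continuousOn hφ.continuousOn
  have hf : Integrable f ((volume : Measure Plane).restrict (cell a)) :=
    (Lp.memLp f).integrable one_le_two
  refine hf.mul_bdd (c := C) hφ.aestronglyMeasurable ?_
  filter_upwards [ae_restrict_mem (ZSpan.fundamentalDomain_measurableSet a)] with x hx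
  exact hC x (subset_closure hx)

theorem continuous_partialDeriv {a : Module.Basis (Fin 2) ℝ Plane} {φ : Plane → ℝ}
    (hφ : IsTest a φ) (i : Fin 2) : Continuous (partialDeriv i φ) :=
  (hφ.1.continuous_fderiv (by simp)).clm_apply continuous_const

theorem integral_add_mul (a : Module.Basis (Fin 2) ℝ Plane) (f g : L2 a)
    {φ : Plane → ℝ} (hφ : Continuous φ) :
    ∫ x in cell a, (f + g : L2 a) x * φ x
      = (∫ x in cell a, f x * φ x) + ∫ x in cell a, g x * φ x := by
  rw [← integral_add (integrable_mul_of_continuous a f hφ) (integrable_mul_of_continuous a g hφ)]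
  refine integral_congr_ae ?_
  filter_upwards [Lp.coeFn_add f g] with x hx
  rw [hx, Pi.add_apply, add_mul]

theorem integral_smul_mul (a : Module.Basis (Fin 2) ℝ Plane) (c : ℝ) (f : L2 a)
    (φ : Plane → ℝ) :
    ∫ x in cell a, (c • f : L2 a) x * φ x = c * ∫ x in cell a, f x * φ x := by
  rw [← integral_const_mul]
  refine integral_congr_ae ?_
  filter_upwards [Lp.coeFn_smul c f] with x hx
  rw [hx, Pi.smul_apply, smul_eq_mul, mul_assoc]

/-- The space `Ẇ^{1,2}(Ω)` of `W^{1,2}` functions on the torus with zero mean. An element is a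
function `f ∈ L²(Ω)` together with its weak gradient (which `f` determines), so that the norm
inherited from the Hilbert sum of copies of `L²(Ω)` is the usual one,
`‖f‖² = ∫ (f² + |∇f|²)`. -/
def zeroMeanSobolev (a : Module.Basis (Fin 2) ℝ Plane) :
    Submodule ℝ (WithLp 2 (L2 a × PiLp 2 (fun _ : Fin 2 => L2 a))) where
  carrier := {v | (∀ i, IsWeakPartial a i v.fst (v.snd i)) ∧ ∫ x in cell a, v.fst x = 0}
  zero_mem' := by
    have h0 : ∀ φ : Plane → ℝ, ∫ x in cell a, (0 : L2 a) x * φ x = 0 := fun φ => by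
      simpa using integral_smul_mul a 0 0 φ
    refine ⟨fun i φ _ => ?_, ?_⟩
    · simp only [WithLp.zero_fst, WithLp.zero_snd, PiLp.zero_apply]
      rw [h0, h0, neg_zero]
    · simpa using h0 (fun _ => 1)
  add_mem' := by
    rintro v w ⟨hv, hv'⟩ ⟨hw, hw'⟩
    refine ⟨fun i φ hφ => ?_, ?_⟩
    · simp only [WithLp.add_fst, WithLp.add_snd, PiLp.add_apply]
      rw [integral_add_mul a _ _ (continuous_partialDeriv hφ i),
        integral_add_mul a _ _ hφ.1.continuous, hv i φ hφ, hw i φ hφ]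
      ring
    · have h := integral_add_mul a v.fst w.fst (φ := fun _ => 1) continuous_const
      simp only [mul_one] at h
      simp only [WithLp.add_fst]
      rw [h, hv', hw', add_zero]
  smul_mem' := by
    rintro c v ⟨hv, hv'⟩
    refine ⟨fun i φ hφ => ?_, ?_⟩
    · simp only [WithLp.smul_fst, WithLp.smul_snd, PiLp.smul_apply]
      rw [integral_smul_mul, integral_smul_mul, hv i φ hφ]
      ring
    · have h := integral_smul_mul a c v.fst (fun _ => 1)
      simp only [mul_one] at h
      simp only [WithLp.smul_fst]
      rw [h, hv', mul_zero]

/-- The function underlying an element of `Ẇ^{1,2}(Ω)`. -/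
def value {a : Module.Basis (Fin 2) ℝ Plane} (w : zeroMeanSobolev a) : Plane → ℝ :=
  (w : WithLp 2 (L2 a × PiLp 2 (fun _ : Fin 2 => L2 a))).fst

/-- `(Ẇ^{1,2}(Ω))^N`; the product norm is equivalent to the Hilbert one. -/
abbrev Space (a : Module.Basis (Fin 2) ℝ Plane) (N : ℕ) : Type :=
  Fin N → zeroMeanSobolev a

/-- `u` is the background function of the points `p₁, …, p_m` (repeated with multiplicity):
the integrable doubly periodic solution, in the sense of distributions on the torus, of
`Δu = 4π ∑ₛ δ_{pₛ} - 4π m / |Ω|` with `∫_Ω u = 0`. -/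
structure IsBackground (a : Module.Basis (Fin 2) ℝ Plane) {m : ℕ} (p : Fin m → Plane)
    (u : Plane → ℝ) : Prop where
  periodic : IsPeriodic a u
  integrable : IntegrableOn u (cell a)
  equation : ∀ φ : Plane → ℝ, IsTest a φ →
    ∫ x in cell a, u x * Laplacian.laplacian φ x
      = 4 * Real.pi * ∑ k, φ (p k) - 4 * Real.pi * m / area a * ∫ x in cell a, φ x
  zero_mean : ∫ x in cell a, u x = 0

/-- The Cartan matrix `K` of `SU(N+1)`, with real entries. -/
def cartanK (N : ℕ) : Matrix (Fin N) (Fin N) ℝ :=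
  (CartanMatrix.A N).map (fun z : ℤ => (z : ℝ))

/-- `r_j = ∑ₖ a_{jk}`, where `(a_{jk}) = K⁻¹`. -/
def r {N : ℕ} (j : Fin N) : ℝ := ∑ k, (cartanK N)⁻¹ j k

/-- `b_j = 4π ∑ₖ a_{jk} n_k`, where `(a_{jk}) = K⁻¹`. -/
def b {N : ℕ} (n : Fin N → ℕ) (j : Fin N) : ℝ :=
  4 * Real.pi * ∑ k, (cartanK N)⁻¹ j k * n k

section Constraints

variable {a : Module.Basis (Fin 2) ℝ Plane} {N : ℕ}

/-- `∫_Ω e^{u_j⁰ + w_j}`. -/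
def intExp (u₀ : Fin N → Plane → ℝ) (w : Space a N) (j : Fin N) : ℝ :=
  ∫ x in cell a, Real.exp (u₀ j x + value (w j) x)

/-- `∫_Ω e^{2(u_j⁰ + w_j)}`. -/
def intExpSq (u₀ : Fin N → Plane → ℝ) (w : Space a N) (j : Fin N) : ℝ :=
  ∫ x in cell a, Real.exp (2 * (u₀ j x + value (w j) x))

/-- The admissible set `𝒜`. -/
def admissible (n : Fin N → ℕ) (u₀ : Fin N → Plane → ℝ) (lam : ℝ) : Set (Space a N) :=
  {w | ∀ j, 8 * b n j * intExpSq u₀ w j / lam ≤ intExp u₀ w j ^ 2}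

/-- The points of `𝒜` at which all the defining inequalities are strict. -/
def strictlyAdmissible (n : Fin N → ℕ) (u₀ : Fin N → Plane → ℝ) (lam : ℝ) : Set (Space a N) :=
  {w | ∀ j, 8 * b n j * intExpSq u₀ w j / lam < intExp u₀ w j ^ 2}

/-- `Q̃_j(s) = ∫_Ω e^{u_j⁰+w_j} (1 + s r_{j-1} t_{j-1} e^{u_{j-1}⁰+w_{j-1}}
+ s r_{j+1} t_{j+1} e^{u_{j+1}⁰+w_{j+1}})`. The sum runs over the neighbours `k = j ± 1` of `j`
that lie in the index set (equivalently, `r_0 = r_{N+1} = 0`). -/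
def Qtilde (u₀ : Fin N → Plane → ℝ) (s : ℝ) (w : Space a N) (t : Fin N → ℝ) (j : Fin N) : ℝ :=
  ∫ x in cell a, Real.exp (u₀ j x + value (w j) x) *
    (1 + ∑ k : Fin N with k.val + 1 = j.val ∨ k.val = j.val + 1,
      s * r k * t k * Real.exp (u₀ k x + value (w k) x))

/-- The map `Φ_{s,ε}` at `w`, as a function of `t = (t₁, …, t_N)`. -/
def Phi (n : Fin N → ℕ) (u₀ : Fin N → Plane → ℝ) (lam s : ℝ) (ε : Fin N → Fin 2)
    (w : Space a N) (t : Fin N → ℝ) : Fin N → ℝ := fun j =>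
  t j - 1 / (4 * r j * intExpSq u₀ w j) *
    (Qtilde u₀ s w t j - (-1) ^ (ε j : ℕ) *
      Real.sqrt (Qtilde u₀ s w t j ^ 2 - 8 * b n j / lam * intExpSq u₀ w j))

end Constraints

/-- A point `t` is non-degenerate for `F : ℝ^N → ℝ^N` if `F` is differentiable there with
invertible Jacobian matrix. -/
def IsNondegenerate {N : ℕ} (F : (Fin N → ℝ) → (Fin N → ℝ)) (t : Fin N → ℝ) : Prop :=
  ∃ L : (Fin N → ℝ) →L[ℝ] (Fin N → ℝ), HasFDerivAt F L t ∧ L.det ≠ 0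

/-- `T` is smooth (`C^∞`) on the not necessarily open set `S` near its point `w`: on some
neighbourhood of `w` it agrees on `S` with a `C^∞` map defined on the whole neighbourhood. -/
def IsSmoothNear {E G : Type*} [NormedAddCommGroup E] [NormedSpace ℝ E] [NormedAddCommGroup G]
    [NormedSpace ℝ G] (T : E → G) (S : Set E) (w : E) : Prop :=
  ∃ U : Set E, IsOpen U ∧ w ∈ U ∧ ∃ T' : E → G, ContDiffOn ℝ ∞ T' U ∧ EqOn T' T (U ∩ S)

end ChernSimons

end

/-! For fixed `w` all integrals are constants, and `Φ = 0` becomes a finite system `t_j = c_j (q_j -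
σ_j √(q_j² - γ_j))` with `q_j = e_j + ∑ₖ M_{jk} t_k` and `M ≥ 0`. Membership of `w` in `𝒜` says
exactly that `γ_j ≤ e_j²`. Two facts about this system carry the finite-dimensional part.

Smallness of the coupling. Put `z_j = 1 / ‖e^{u_j⁰+w_j}‖` (the `L²` norm). Cauchy-Schwarz and `K r =
1`, that is `r_{j-1} + r_{j+1} = 2 r_j - 1`, give `2 c_j ∑ₖ M_{jk} z_k ≤ (1 - 1/(2 r_j)) z_j`
(`isSolvable_of_mem_admissible`). Since the right-hand side of the system always lies between `0`
and `2 c_j q_j`, comparison with `z` makes every real solution positive (`pos_of_eq`) and gives an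
invariant box.

Contraction. The function `b(q) = q - σ √(q² - γ)` satisfies `b' = -σ b / √(q² - γ)`, while `q - e <
√(q² - γ)` for `q > e`. Hence the system map strictly decreases `max_j |x_j - y_j| / (x_j + y_j)` on
positive vectors (`abs_systemMap_sub_le`). Uniqueness is immediate. Existence follows by minimising
the discrepancy between `t` and its image over a compact set (`exists_eq`). The infinitesimal
version, in the norm `max_j |v_j| / t_j`, gives the invertible Jacobian.

Smoothness in `w` is the implicit function theorem in the coefficients. It needs positive
discriminants: for `s > 0` every index has a neighbour, which forces `q_j > e_j ≥ √γ_j`; for `s = 0`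
this is strictness of the inequalities. Continuity at `s = 0` is read off the explicit formula.

It remains that the coefficients are smooth in `w`. This follows from an upper bound for `u_j⁰`
(`IsBackground.exists_ae_le`) and analyticity of `w ↦ ∫ ρ e^w` for bounded `ρ`
(`contDiff_expFunctional`). Both rest on a truncation of `log |z|²` whose Laplacian is a difference
of two mollifiers. As a test function in the equation of `u_j⁰` it gives the upper bound. In the
weak derivative identity it bounds `|w|` by a Riesz potential of `|w| + |∇w|`, and the moments of
that potential give a Trudinger inequality. -/

noncomputable section

namespace ChernSimons

open MeasureTheory Set
open scoped ContDiff

/-! ### A coupled system of quadratic equations -/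

section System

/-- A root of `x² - 2qx + γ`, the sign `σ = ± 1` selecting which one. -/
def branch (σ γ q : ℝ) : ℝ := q - σ * √(q ^ 2 - γ)

theorem sqrt_sq_sub_le_abs {γ : ℝ} (hγ : 0 ≤ γ) (q : ℝ) : √(q ^ 2 - γ) ≤ |q| := by
  rw [← Real.sqrt_sq_eq_abs]
  exact Real.sqrt_le_sqrt (by linarith)

/-- Since `√(q² - γ) ≤ |q|`, the root lies between `0` and `2q` whatever the sign of `q`. The case
`q² < γ`, where the square root reads as `0`, is included. This is what allows solutions with no
sign assumption to be compared with `z`. -/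
theorem exists_branch_eq_mul {σ γ : ℝ} (hσ : |σ| = 1) (hγ : 0 ≤ γ) (q : ℝ) :
    ∃ θ : ℝ, 0 ≤ θ ∧ θ ≤ 2 ∧ branch σ γ q = θ * q := by
  rcases eq_or_ne q 0 with rfl | hq
  · refine ⟨0, le_rfl, by norm_num, ?_⟩
    have : √((0 : ℝ) ^ 2 - γ) = 0 := Real.sqrt_eq_zero_of_nonpos (by linarith [sq (0 : ℝ)])
    rw [branch, this]; simp
  · have h : |σ * √(q ^ 2 - γ) / q| ≤ 1 := by
      rw [abs_div, abs_mul, hσ, one_mul, abs_of_nonneg (Real.sqrt_nonneg _)]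
      exact div_le_one_of_le₀ (sqrt_sq_sub_le_abs hγ q) (abs_nonneg q)
    obtain ⟨h1, h2⟩ := abs_le.1 h
    refine ⟨1 - σ * √(q ^ 2 - γ) / q, by linarith, by linarith, ?_⟩
    rw [branch]; field_simp

theorem branch_pos {σ γ q : ℝ} (hσ : |σ| = 1) (hγ : 0 < γ) (hq : 0 < q) : 0 < branch σ γ q := by
  have h : |σ * √(q ^ 2 - γ)| < q := by
    rw [abs_mul, hσ, one_mul, abs_of_nonneg (Real.sqrt_nonneg _), Real.sqrt_lt' hq]
    linarith
  have := (abs_lt.1 h).2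
  rw [branch]; linarith

theorem branch_le {σ γ q : ℝ} (hσ : |σ| = 1) (hγ : 0 ≤ γ) (hq : 0 ≤ q) :
    branch σ γ q ≤ 2 * q := by
  obtain ⟨θ, -, h2, h⟩ := exists_branch_eq_mul hσ hγ q
  rw [h]; gcongr

/-- The finite-difference form of `b' = -σ b / √(q² - γ)`: the difference of the squared roots is
`q² - p²`, and `σ² = 1`. Clearing denominators keeps it meaningful when the roots vanish. -/
theorem branch_sub_branch_mul {σ γ q p : ℝ} (hσ : |σ| = 1) (hq : γ ≤ q ^ 2) (hp : γ ≤ p ^ 2) :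
    (branch σ γ q - branch σ γ p) * (√(q ^ 2 - γ) + √(p ^ 2 - γ))
      = -σ * (q - p) * (branch σ γ q + branch σ γ p) := by
  have h1 := Real.sq_sqrt (sub_nonneg.2 hq)
  have h2 := Real.sq_sqrt (sub_nonneg.2 hp)
  have h3 : σ ^ 2 = 1 := by rw [← sq_abs, hσ, one_pow]
  unfold branch
  linear_combination (-σ) * h1 + σ * h2 + (√(q ^ 2 - γ) + √(p ^ 2 - γ)) * (p - q) * h3

/-- Indeed `(q - e)² = q² - e² - 2e(q - e) < q² - γ`. The gap between `q - e` and the root is the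
whole source of strict contraction and of non-degeneracy. -/
theorem sub_lt_sqrt_sq_sub {γ e q : ℝ} (he : 0 < e) (hγ : γ ≤ e ^ 2) (hq : e < q) :
    q - e < √(q ^ 2 - γ) :=
  Real.lt_sqrt_of_sq_lt (by nlinarith)

theorem sub_le_sqrt_sq_sub {γ e q : ℝ} (he : 0 < e) (hγ : γ ≤ e ^ 2) (hq : e ≤ q) :
    q - e ≤ √(q ^ 2 - γ) :=
  Real.le_sqrt_of_sq_le (by nlinarith)

variable {ι : Type*} [Fintype ι]

/-- The affine functions `q_j = e_j + ∑ₖ M_{jk} t_k`. -/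
def affineForm (e : ι → ℝ) (M : ι → ι → ℝ) (t : ι → ℝ) (j : ι) : ℝ := e j + ∑ k, M j k * t k

/-- The right-hand side of the system `t_j = c_j (q_j - σ_j √(q_j² - γ_j))`. -/
def systemMap (c e γ σ : ι → ℝ) (M : ι → ι → ℝ) (t : ι → ℝ) (j : ι) : ℝ :=
  c j * branch (σ j) (γ j) (affineForm e M t j)

/-- The conditions on the coefficients under which the system is uniquely solvable; the positive
vector `z` is a strict supersolution of the linearised system. -/
structure IsSolvable (c e γ σ : ι → ℝ) (M : ι → ι → ℝ) (z : ι → ℝ) : Prop where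
  c_pos : ∀ j, 0 < c j
  e_pos : ∀ j, 0 < e j
  γ_pos : ∀ j, 0 < γ j
  γ_le : ∀ j, γ j ≤ e j ^ 2
  σ_abs : ∀ j, |σ j| = 1
  M_nonneg : ∀ j k, 0 ≤ M j k
  z_pos : ∀ j, 0 < z j
  super : ∀ j, 2 * c j * ∑ k, M j k * z k < z j

namespace IsSolvable

variable {c e γ σ z : ι → ℝ} {M : ι → ι → ℝ}

theorem le_affineForm (h : IsSolvable c e γ σ M z) {t : ι → ℝ} (ht : ∀ j, 0 ≤ t j) (j : ι) :
    e j ≤ affineForm e M t j := by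
  have : 0 ≤ ∑ k, M j k * t k := Finset.sum_nonneg fun k _ => mul_nonneg (h.M_nonneg j k) (ht k)
  rw [affineForm]; linarith

theorem γ_le_affineForm_sq (h : IsSolvable c e γ σ M z) {t : ι → ℝ} (ht : ∀ j, 0 ≤ t j) (j : ι) :
    γ j ≤ affineForm e M t j ^ 2 :=
  (h.γ_le j).trans (pow_le_pow_left₀ (h.e_pos j).le (h.le_affineForm ht j) 2)

theorem systemMap_pos (h : IsSolvable c e γ σ M z) {t : ι → ℝ} (ht : ∀ j, 0 ≤ t j) (j : ι) :
    0 < systemMap c e γ σ M t j :=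
  mul_pos (h.c_pos j)
    (branch_pos (h.σ_abs j) (h.γ_pos j) ((h.e_pos j).trans_le (h.le_affineForm ht j)))

/-- Every solution is positive. -/
theorem pos_of_eq (h : IsSolvable c e γ σ M z) {t : ι → ℝ} (ht : systemMap c e γ σ M t = t)
    (j : ι) : 0 < t j := by
  have hnonneg : ∀ j, 0 ≤ t j := by
    by_contra! hneg
    obtain ⟨j₀, hj₀⟩ := hneg
    have : Nonempty ι := ⟨j₀⟩
    -- At the index minimising `t_j / z_j`, with minimum `m < 0`, the equation and `θ ≤ 2` give `t_i
    -- ≥ 2 c_i m S > m z_i`, contradicting `t_i = m z_i`.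
    obtain ⟨i, -, hi⟩ := Finset.exists_min_image Finset.univ (fun j => t j / z j)
      Finset.univ_nonempty
    set m := t i / z i with hm
    have hmneg : m < 0 :=
      (hi j₀ (Finset.mem_univ _)).trans_lt (div_neg_of_neg_of_pos hj₀ (h.z_pos j₀))
    have hti : t i = m * z i := by rw [hm, div_mul_cancel₀ _ (h.z_pos i).ne']
    have hmt : ∀ k, m * z k ≤ t k := fun k => (le_div_iff₀ (h.z_pos k)).1 (hi k (Finset.mem_univ _))
    obtain ⟨θ, h0, h2, hθ⟩ := exists_branch_eq_mul (h.σ_abs i) (h.γ_pos i).le (affineForm e M t i)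
    have heq : t i = c i * (θ * affineForm e M t i) := by
      conv_lhs => rw [← ht]
      rw [systemMap, hθ]
    have hsum : m * ∑ k, M i k * z k ≤ ∑ k, M i k * t k := by
      rw [Finset.mul_sum]
      refine Finset.sum_le_sum fun k _ => ?_
      have := mul_le_mul_of_nonneg_left (hmt k) (h.M_nonneg i k)
      linarith
    have hS : 0 ≤ ∑ k, M i k * z k :=
      Finset.sum_nonneg fun k _ => mul_nonneg (h.M_nonneg i k) (h.z_pos k).le
    have hs := h.super i
    set S := ∑ k, M i k * z k
    have h3 : c i * (θ * (m * S)) ≤ t i := by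
      rw [heq, affineForm]
      have := h.e_pos i
      have := h.c_pos i
      gcongr
      linarith
    have h4 : 2 * c i * (m * S) ≤ c i * (θ * (m * S)) := by
      have : 0 ≤ c i * ((2 - θ) * (-m * S)) :=
        mul_nonneg (h.c_pos i).le (mul_nonneg (by linarith) (mul_nonneg (by linarith) hS))
      linarith
    have h5 : m * z i < m * (2 * c i * S) := mul_lt_mul_of_neg_left hs hmneg
    linarith
  rw [← ht]
  exact h.systemMap_pos hnonneg j

/-- The system map is a strict contraction for the functional `max_j |x_j - y_j| / (x_j + y_j)`. -/
theorem abs_systemMap_sub_le (h : IsSolvable c e γ σ M z) {t t' : ι → ℝ} (ht : ∀ j, 0 < t j)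
    (ht' : ∀ j, 0 < t' j) {κ : ℝ} (hκ : 0 < κ) (hk : ∀ j, |t j - t' j| ≤ κ * (t j + t' j)) (j : ι) :
    |systemMap c e γ σ M t j - systemMap c e γ σ M t' j|
      < κ * (systemMap c e γ σ M t j + systemMap c e γ σ M t' j) := by
  have hp := h.systemMap_pos (fun j => (ht j).le) j
  have hp' := h.systemMap_pos (fun j => (ht' j).le) j
  have hdiff : affineForm e M t j - affineForm e M t' j = ∑ k, M j k * (t k - t' k) := by
    simp only [affineForm, mul_sub, Finset.sum_sub_distrib]; ring
  -- Only the variable parts `q - e` and `p - e` enter, because the constant `e` cancels in the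
  -- difference; this gain is what makes the estimate strict.
  have hle : |affineForm e M t j - affineForm e M t' j|
      ≤ κ * ((affineForm e M t j - e j) + (affineForm e M t' j - e j)) := by
    rw [hdiff]
    refine (Finset.abs_sum_le_sum_abs _ _).trans ?_
    simp only [affineForm, add_sub_cancel_left]
    rw [← Finset.sum_add_distrib, Finset.mul_sum]
    refine Finset.sum_le_sum fun k _ => ?_
    rw [abs_mul, abs_of_nonneg (h.M_nonneg j k)]
    have := mul_le_mul_of_nonneg_left (hk k) (h.M_nonneg j k)
    linarith
  have hid := branch_sub_branch_mul (h.σ_abs j) (h.γ_le_affineForm_sq (fun j => (ht j).le) j)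
    (h.γ_le_affineForm_sq (fun j => (ht' j).le) j)
  have hq := h.le_affineForm (fun j => (ht j).le) j
  have hq' := h.le_affineForm (fun j => (ht' j).le) j
  have hcj := h.c_pos j
  have hdist : ∀ {x y : ℝ}, c j * x - c j * y = c j * (x - y) := by intros; ring
  have hsumd : ∀ {x y : ℝ}, κ * (c j * x + c j * y) = c j * (κ * (x + y)) := by intros; ring
  unfold systemMap at hp hp' ⊢
  have hb := pos_of_mul_pos_right hp hcj.le
  have hb' := pos_of_mul_pos_right hp' hcj.le
  rw [hdist, hsumd, abs_mul, abs_of_pos hcj]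
  refine mul_lt_mul_of_pos_left ?_ hcj
  set q := affineForm e M t j
  set p := affineForm e M t' j
  set b₁ := branch (σ j) (γ j) q
  set b₂ := branch (σ j) (γ j) p
  rcases eq_or_ne q p with hqp | hqp
  · have : b₁ = b₂ := by simp only [b₁, b₂, hqp]
    rw [this, sub_self, abs_zero]
    positivity
  · have habs : |b₁ - b₂| * (√(q ^ 2 - γ j) + √(p ^ 2 - γ j)) = |q - p| * (b₁ + b₂) := by
      have := congrArg abs hid
      rwa [abs_mul, abs_mul, abs_mul, abs_neg, h.σ_abs j, one_mul, abs_of_pos (add_pos hb hb'),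
        abs_of_nonneg (add_nonneg (Real.sqrt_nonneg _) (Real.sqrt_nonneg _))] at this
    -- As `q ≠ p`, at least one of them exceeds `e`, and its inequality is strict.
    have hlt : (q - e j) + (p - e j) < √(q ^ 2 - γ j) + √(p ^ 2 - γ j) := by
      have h1 := sub_le_sqrt_sq_sub (h.e_pos j) (h.γ_le j) hq
      have h2 := sub_le_sqrt_sq_sub (h.e_pos j) (h.γ_le j) hq'
      rcases hq.lt_or_eq with hlt | heq
      · linarith [sub_lt_sqrt_sq_sub (h.e_pos j) (h.γ_le j) hlt]
      · have hlt' : e j < p := lt_of_le_of_ne hq' fun h' => hqp (heq.symm.trans h')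
        linarith [sub_lt_sqrt_sq_sub (h.e_pos j) (h.γ_le j) hlt']
    have hD : 0 < √(q ^ 2 - γ j) + √(p ^ 2 - γ j) := by linarith
    have h6 : |q - p| < κ * (√(q ^ 2 - γ j) + √(p ^ 2 - γ j)) :=
      hle.trans_lt (mul_lt_mul_of_pos_left hlt hκ)
    have h7 := mul_lt_mul_of_pos_right h6 (add_pos hb hb')
    rw [← habs] at h7
    refine lt_of_mul_lt_mul_right (lt_of_lt_of_eq h7 ?_) hD.le
    ring

/-- If `κ > 0` is the maximum of `|t_j - t'_j| / (t_j + t'_j)`, the contraction estimate at the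
maximising index says that `κ` is less than itself. -/
theorem eq_of_systemMap_eq (h : IsSolvable c e γ σ M z) {t t' : ι → ℝ}
    (ht : systemMap c e γ σ M t = t) (ht' : systemMap c e γ σ M t' = t') : t = t' := by
  by_contra hne
  obtain ⟨j₀, hj₀⟩ := Function.ne_iff.1 hne
  have : Nonempty ι := ⟨j₀⟩
  have hp := h.pos_of_eq ht
  have hp' := h.pos_of_eq ht'
  have hs : ∀ j, 0 < t j + t' j := fun j => add_pos (hp j) (hp' j)
  obtain ⟨i, -, hi⟩ := Finset.exists_max_image Finset.univ (fun j => |t j - t' j| / (t j + t' j))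
    Finset.univ_nonempty
  have hκ : 0 < |t i - t' i| / (t i + t' i) :=
    (div_pos (abs_pos.2 (sub_ne_zero.2 hj₀)) (hs j₀)).trans_le (hi j₀ (Finset.mem_univ _))
  have hlt := h.abs_systemMap_sub_le hp hp' hκ
    (fun j => (div_le_iff₀ (hs j)).1 (hi j (Finset.mem_univ _))) i
  rw [ht, ht', div_mul_cancel₀ _ (hs i).ne'] at hlt
  exact lt_irrefl _ hlt

theorem continuous_affineForm (e : ι → ℝ) (M : ι → ι → ℝ) (j : ι) :
    Continuous fun t : ι → ℝ => affineForm e M t j := by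
  unfold affineForm; fun_prop

theorem continuous_systemMap (c e γ σ : ι → ℝ) (M : ι → ι → ℝ) :
    Continuous fun t : ι → ℝ => systemMap c e γ σ M t := by
  refine continuous_pi fun j => ?_
  have := continuous_affineForm e M j
  unfold systemMap branch
  fun_prop

/-- The contraction is strict but not uniform, so compactness replaces iteration: a minimiser of the
discrepancy between `t` and `F t` must be a fixed point, since otherwise `F t` would have a smaller
discrepancy. -/
theorem exists_eq (h : IsSolvable c e γ σ M z) : ∃ t : ι → ℝ, systemMap c e γ σ M t = t := by
  rcases isEmpty_or_nonempty ι with hι | hι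
  · exact ⟨0, Subsingleton.elim _ _⟩
  -- a radius `Λ` such that the box `0 ≤ t ≤ Λ z` is invariant
  obtain ⟨Λ, hΛ0, hΛ⟩ : ∃ Λ : ℝ, 0 < Λ ∧
      ∀ j, 2 * c j * e j / (z j - 2 * c j * ∑ k, M j k * z k) ≤ Λ := by
    obtain ⟨i, -, hi⟩ := Finset.exists_max_image Finset.univ
      (fun j => 2 * c j * e j / (z j - 2 * c j * ∑ k, M j k * z k)) Finset.univ_nonempty
    refine ⟨_, ?_, fun j => hi j (Finset.mem_univ _)⟩
    have := h.c_pos i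
    have := h.e_pos i
    have := sub_pos.2 (h.super i)
    positivity
  set F : (ι → ℝ) → (ι → ℝ) := systemMap c e γ σ M with hF
  have hFc : Continuous F := continuous_systemMap c e γ σ M
  set K : Set (ι → ℝ) := Icc 0 (Λ • z) with hK
  have hKc : IsCompact K := isCompact_Icc
  have hinv : ∀ t ∈ K, F t ∈ K := by
    intro t ht
    have ht0 : ∀ j, 0 ≤ t j := fun j => ht.1 j
    refine ⟨fun j => (h.systemMap_pos ht0 j).le, fun j => ?_⟩
    have hz : ∑ k, M j k * t k ≤ Λ * ∑ k, M j k * z k := by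
      rw [Finset.mul_sum]
      refine Finset.sum_le_sum fun k _ => ?_
      have := mul_le_mul_of_nonneg_left (ht.2 k) (h.M_nonneg j k)
      simp only [Pi.smul_apply, smul_eq_mul] at this
      linarith
    have h1 : F t j ≤ c j * (2 * affineForm e M t j) :=
      mul_le_mul_of_nonneg_left (branch_le (h.σ_abs j) (h.γ_pos j).le
        ((h.e_pos j).le.trans (h.le_affineForm ht0 j))) (h.c_pos j).le
    have h2 := (div_le_iff₀ (sub_pos.2 (h.super j))).1 (hΛ j)
    have h3 := mul_le_mul_of_nonneg_left hz (h.c_pos j).le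
    simp only [Pi.smul_apply, smul_eq_mul]
    unfold affineForm at h1
    nlinarith
  -- The box has points with vanishing coordinates; on its image all coordinates are positive, as
  -- the contraction estimate requires.
  set K' : Set (ι → ℝ) := F '' K
  have hK'c : IsCompact K' := hKc.image hFc
  have hK'K : K' ⊆ K := by rintro _ ⟨t, ht, rfl⟩; exact hinv t ht
  have hpos : ∀ t ∈ K', ∀ j, 0 < t j := by
    rintro _ ⟨t, ht, rfl⟩ j
    exact h.systemMap_pos (fun j => ht.1 j) j
  have hinv' : ∀ t ∈ K', F t ∈ K' := fun t ht => mem_image_of_mem F (hK'K ht)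
  have hne : K'.Nonempty :=
    ⟨F 0, mem_image_of_mem F ⟨le_rfl, fun j => by
      have := h.z_pos j
      simp only [Pi.zero_apply, Pi.smul_apply, smul_eq_mul]; positivity⟩⟩
  set G : (ι → ℝ) → ℝ := fun t =>
    Finset.univ.sup' Finset.univ_nonempty fun j => |t j - F t j| / (t j + F t j) with hG
  have hGc : ContinuousOn G K' := by
    refine ContinuousOn.finset_sup'_apply _ fun j _ => ?_
    refine ContinuousOn.div ?_ ?_ fun t ht => (add_pos (hpos t ht j) (hpos _ (hinv' t ht) j)).ne'
    · exact (by fun_prop : Continuous fun t : ι → ℝ => |t j - F t j|).continuousOn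
    · exact (by fun_prop : Continuous fun t : ι → ℝ => t j + F t j).continuousOn
  obtain ⟨t, htK, htmin⟩ := hK'c.exists_isMinOn hne hGc
  have hle : ∀ s : ι → ℝ, ∀ j, |s j - F s j| / (s j + F s j) ≤ G s := fun s j =>
    Finset.le_sup' (fun j => |s j - F s j| / (s j + F s j)) (Finset.mem_univ j)
  have ht := hpos t htK
  have htF := hpos _ (hinv' t htK)
  have htFF := hpos _ (hinv' _ (hinv' t htK))
  refine ⟨t, ?_⟩
  by_contra hne
  have hGpos : 0 < G t := by
    obtain ⟨j, hj⟩ := Function.ne_iff.1 hne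
    exact (div_pos (abs_pos.2 (sub_ne_zero.2 (Ne.symm hj))) (add_pos (ht j) (htF j))).trans_le
      (hle t j)
  have hcontr := h.abs_systemMap_sub_le ht htF hGpos
    fun j => (div_le_iff₀ (add_pos (ht j) (htF j))).1 (hle t j)
  have hlt : G (F t) < G t := by
    rw [hG]
    refine (Finset.sup'_lt_iff _).2 fun j _ => ?_
    exact (div_lt_iff₀ (add_pos (htF j) (htFF j))).2 (hcontr j)
  exact absurd (htmin (hinv' t htK)) (not_le.2 hlt)

/-- The discriminants are positive at the solution, except where the system decouples. -/
theorem discr_pos (h : IsSolvable c e γ σ M z) {t : ι → ℝ} (ht : ∀ j, 0 < t j) {j : ι}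
    (hj : (∃ k, 0 < M j k) ∨ γ j < e j ^ 2) : 0 < affineForm e M t j ^ 2 - γ j := by
  have hq := h.le_affineForm (fun j => (ht j).le) j
  have he := h.e_pos j
  rcases hj with ⟨k, hk⟩ | hj
  · have hlt : e j < affineForm e M t j := by
      have : 0 < ∑ k, M j k * t k :=
        Finset.sum_pos' (fun k _ => mul_nonneg (h.M_nonneg j k) (ht k).le)
          ⟨k, Finset.mem_univ _, mul_pos hk (ht k)⟩
      rw [affineForm]; linarith
    nlinarith [h.γ_le j]
  · nlinarith

end IsSolvable

end System

/-! ### Non-degeneracy of the solution and its dependence on the coefficients. -/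

section SystemDerivative

variable {ι : Type*} [Fintype ι]

/-- The linear part of `affineForm`. -/
def rowForm (M : ι → ι → ℝ) (j : ι) : (ι → ℝ) →L[ℝ] ℝ :=
  ∑ k, M j k • ContinuousLinearMap.proj k

theorem rowForm_apply (M : ι → ι → ℝ) (j : ι) (v : ι → ℝ) :
    rowForm M j v = ∑ k, M j k * v k := by
  simp [rowForm]

theorem hasFDerivAt_affineForm (e : ι → ℝ) (M : ι → ι → ℝ) (j : ι) (t : ι → ℝ) :
    HasFDerivAt (fun t => affineForm e M t j) (rowForm M j) t := by
  have : (fun t => affineForm e M t j) = fun t => e j + rowForm M j t := by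
    ext t; rw [rowForm_apply, affineForm]
  rw [this]
  exact (rowForm M j).hasFDerivAt.const_add _

namespace IsSolvable

variable {c e γ σ z : ι → ℝ} {M : ι → ι → ℝ}

/-- At a solution `α = -σ_j t_j / √(q_j² - γ_j)`, and `q_j - e_j < √(q_j² - γ_j)` bounds it. The
bound is needed only for nonzero rows, for which `q_j > e_j`. -/
theorem exists_hasFDerivAt_systemMap (h : IsSolvable c e γ σ M z) {t : ι → ℝ}
    (ht : systemMap c e γ σ M t = t) (j : ι) :
    ∃ α : ℝ, HasFDerivAt (fun t => systemMap c e γ σ M t j) (α • rowForm M j) t ∧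
      (rowForm M j ≠ 0 → |α| * (affineForm e M t j - e j) < t j) := by
  have hpos := h.pos_of_eq ht
  by_cases hrow : ∃ k, 0 < M j k
  · have hd := h.discr_pos hpos (Or.inl hrow)
    set q := affineForm e M t j with hqdef
    set D := √(q ^ 2 - γ j) with hDdef
    have hD : 0 < D := Real.sqrt_pos.2 hd
    have hlt : e j < q := by
      obtain ⟨k, hk⟩ := hrow
      have : 0 < ∑ k, M j k * t k :=
        Finset.sum_pos' (fun k _ => mul_nonneg (h.M_nonneg j k) (hpos k).le)
          ⟨k, Finset.mem_univ _, mul_pos hk (hpos k)⟩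
      rw [hqdef, affineForm]; linarith
    have hder : HasDerivAt (branch (σ j) (γ j)) (1 - σ j * (2 * q / (2 * D))) q := by
      have h1 : HasDerivAt (fun x : ℝ => x ^ 2 - γ j) (2 * q) q := by
        simpa using (hasDerivAt_pow 2 q).sub_const (γ j)
      exact (hasDerivAt_id q).sub ((h1.sqrt hd.ne').const_mul (σ j))
    have hcomp : HasFDerivAt (fun t => systemMap c e γ σ M t j)
        (c j • (1 - σ j * (2 * q / (2 * D))) • rowForm M j) t :=
      (HasDerivAt.comp_hasFDerivAt (h₂ := branch (σ j) (γ j)) t hder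
        (hasFDerivAt_affineForm e M j t)).const_mul (c j)
    have htj : t j = c j * (q - σ j * D) := by
      conv_lhs => rw [← ht]
      rfl
    have hσ2 : σ j ^ 2 = 1 := by rw [← sq_abs, h.σ_abs, one_pow]
    have hα : c j * (1 - σ j * (2 * q / (2 * D))) = -σ j * t j / D := by
      rw [htj]; field_simp
      linear_combination (-(c j * D)) * hσ2
    have hlt' : |c j * (1 - σ j * (2 * q / (2 * D)))| * (q - e j) < t j := by
      rw [hα, abs_div, abs_mul, abs_neg, h.σ_abs, one_mul, abs_of_pos (hpos j), abs_of_pos hD,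
        div_mul_eq_mul_div, div_lt_iff₀ hD]
      exact mul_lt_mul_of_pos_left (sub_lt_sqrt_sq_sub (h.e_pos j) (h.γ_le j) hlt) (hpos j)
    exact ⟨_, by rwa [smul_smul] at hcomp, fun _ => hlt'⟩
  -- A zero row makes the component constant, hence differentiable even if its discriminant
  -- vanishes.
  · have hM : ∀ k, M j k = 0 := fun k =>
      le_antisymm (not_lt.1 fun hk => hrow ⟨k, hk⟩) (h.M_nonneg j k)
    have hconst : (fun t => systemMap c e γ σ M t j)
        = fun _ => c j * branch (σ j) (γ j) (e j) := by
      ext t; simp [systemMap, affineForm, hM]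
    refine ⟨0, ?_, fun hne => absurd ?_ hne⟩
    · rw [hconst, zero_smul]; exact hasFDerivAt_const _ _
    · ext v; simp [rowForm_apply, hM]

/-- The solution of the system is non-degenerate. -/
theorem exists_hasFDerivAt_sub (h : IsSolvable c e γ σ M z) {t : ι → ℝ}
    (ht : systemMap c e γ σ M t = t) :
    ∃ L : (ι → ℝ) →L[ℝ] (ι → ℝ),
      HasFDerivAt (fun t => t - systemMap c e γ σ M t) L t ∧ L.det ≠ 0 := by
  have hpos := h.pos_of_eq ht
  choose α hα hlt using h.exists_hasFDerivAt_systemMap ht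
  refine ⟨ContinuousLinearMap.id ℝ _ - ContinuousLinearMap.pi fun j => α j • rowForm M j,
    (hasFDerivAt_id t).sub (hasFDerivAt_pi.2 hα), fun hdet => ?_⟩
  obtain ⟨v, hv, hv0⟩ := (Submodule.ne_bot_iff _).1 (LinearMap.bot_lt_ker_of_det_eq_zero hdet).ne'
  have hveq : ∀ j, v j = α j * rowForm M j v := by
    intro j
    have := congrFun (LinearMap.mem_ker.1 hv) j
    simpa [sub_eq_zero] using this
  obtain ⟨j₀, hj₀⟩ := Function.ne_iff.1 hv0
  have : Nonempty ι := ⟨j₀⟩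
  -- For a kernel vector `v`, the maximal ratio `κ = |v_i| / t_i` satisfies `κ t_i = |v_i| ≤ κ |α_i|
  -- (q_i - e_i) < κ t_i`, which is absurd.
  obtain ⟨i, -, hi⟩ := Finset.exists_max_image Finset.univ (fun j => |v j| / t j)
    Finset.univ_nonempty
  set κ := |v i| / t i with hκdef
  have hκ : 0 < κ :=
    (div_pos (abs_pos.2 hj₀) (hpos j₀)).trans_le (hi j₀ (Finset.mem_univ _))
  have hvi : |v i| = κ * t i := by rw [hκdef, div_mul_cancel₀ _ (hpos i).ne']
  have hb : |rowForm M i v| ≤ κ * (affineForm e M t i - e i) := by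
    rw [rowForm_apply]
    refine (Finset.abs_sum_le_sum_abs _ _).trans ?_
    rw [affineForm, add_sub_cancel_left, Finset.mul_sum]
    refine Finset.sum_le_sum fun k _ => ?_
    rw [abs_mul, abs_of_nonneg (h.M_nonneg i k)]
    have := mul_le_mul_of_nonneg_left
      ((div_le_iff₀ (hpos k)).1 (hi k (Finset.mem_univ _))) (h.M_nonneg i k)
    linarith
  have hrow : rowForm M i ≠ 0 := by
    intro h0
    have := hveq i
    rw [h0] at this
    simp only [zero_apply, mul_zero] at this
    rw [this, abs_zero] at hvi
    exact (mul_pos hκ (hpos i)).ne hvi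
  have h1 : |v i| ≤ |α i| * (κ * (affineForm e M t i - e i)) := by
    rw [hveq i, abs_mul]; gcongr
  have h2 := mul_lt_mul_of_pos_left (hlt i hrow) hκ
  rw [hvi] at h1
  linarith

/-- Near a point where all discriminants are positive, the solution depends analytically on the
coefficients. -/
theorem exists_contDiffAt_solution (h : IsSolvable c e γ σ M z) {t : ι → ℝ}
    (ht : systemMap c e γ σ M t = t) (hd : ∀ j, 0 < affineForm e M t j ^ 2 - γ j) :
    ∃ τ : (ι → ℝ) × (ι → ℝ) × (ι → ℝ) × (ι → ι → ℝ) → (ι → ℝ),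
      ContDiffAt ℝ ω τ (c, e, γ, M) ∧
      ∀ᶠ θ in nhds (c, e, γ, M), systemMap θ.1 θ.2.1 θ.2.2.1 σ θ.2.2.2 (τ θ) = τ θ := by
  set f : ((ι → ℝ) × (ι → ℝ) × (ι → ℝ) × (ι → ι → ℝ)) × (ι → ℝ) → (ι → ℝ) :=
    fun x => x.2 - systemMap x.1.1 x.1.2.1 x.1.2.2.1 σ x.1.2.2.2 x.2 with hf
  have hfc : ContDiffAt ℝ ω f ((c, e, γ, M), t) := by
    refine contDiffAt_pi.2 fun j => ?_
    have haff : ContDiff ℝ ω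
        fun x : ((ι → ℝ) × (ι → ℝ) × (ι → ℝ) × (ι → ι → ℝ)) × (ι → ℝ) =>
          affineForm x.1.2.1 x.1.2.2.2 x.2 j := by
      unfold affineForm; fun_prop
    have hsq : ContDiffAt ℝ ω
        (fun x : ((ι → ℝ) × (ι → ℝ) × (ι → ℝ) × (ι → ι → ℝ)) × (ι → ℝ) =>
          √(affineForm x.1.2.1 x.1.2.2.2 x.2 j ^ 2 - x.1.2.2.1 j)) ((c, e, γ, M), t) := by
      refine ContDiffAt.sqrt ?_ (hd j).ne'
      exact ContDiff.contDiffAt (by fun_prop)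
    simp only [hf, Pi.sub_apply, systemMap, branch]
    have hc : ContDiffAt ℝ ω
        (fun x : ((ι → ℝ) × (ι → ℝ) × (ι → ℝ) × (ι → ι → ℝ)) × (ι → ℝ) => x.1.1 j)
        ((c, e, γ, M), t) := ContDiff.contDiffAt (by fun_prop)
    have ht : ContDiffAt ℝ ω
        (fun x : ((ι → ℝ) × (ι → ℝ) × (ι → ℝ) × (ι → ι → ℝ)) × (ι → ℝ) => x.2 j)
        ((c, e, γ, M), t) := ContDiff.contDiffAt (by fun_prop)
    exact ht.sub (hc.mul (haff.contDiffAt.sub (contDiffAt_const.mul hsq)))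
  -- The derivative in the `t` variables alone is the Jacobian already shown to be invertible.
  have hinv : (fderiv ℝ f ((c, e, γ, M), t) ∘L .inr ℝ _ (ι → ℝ)).IsInvertible := by
    obtain ⟨L, hL, hdet⟩ := h.exists_hasFDerivAt_sub ht
    have hL' : fderiv ℝ f ((c, e, γ, M), t) ∘L .inr ℝ _ (ι → ℝ) = L := by
      have h1 := (hfc.differentiableAt (by simp)).hasFDerivAt
      have h2 : HasFDerivAt (fun t : ι → ℝ => ((c, e, γ, M), t)) (.inr ℝ _ (ι → ℝ)) t :=
        hasFDerivAt_prodMk_right _ _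
      exact (h1.comp t h2).unique hL
    rw [hL']
    exact ⟨L.toContinuousLinearEquivOfDetNeZero hdet, by ext1 x; simp⟩
  refine ⟨hfc.implicitFunction (by simp) hinv, hfc.contDiffAt_implicitFunction (by simp) hinv, ?_⟩
  filter_upwards [hfc.eventually_apply_implicitFunction (by simp) hinv] with θ hθ
  simp only [hf, ht, sub_self] at hθ
  exact (sub_eq_zero.1 hθ).symm

end IsSolvable

end SystemDerivative

/-! ### Positivity of the inverse Cartan matrix -/

section Cartan

variable {N : ℕ}

/-- The neighbours `j ± 1` of `j` in the Dynkin diagram. -/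
def nbrs (j : Fin N) : Finset (Fin N) := {k : Fin N | k.val + 1 = j.val ∨ k.val = j.val + 1}

theorem mem_nbrs {j k : Fin N} : k ∈ nbrs j ↔ k.val + 1 = j.val ∨ k.val = j.val + 1 := by
  simp [nbrs]

theorem nbrs_nonempty (hN : 2 ≤ N) (j : Fin N) : (nbrs j).Nonempty := by
  rcases Nat.eq_zero_or_pos j.val with h | h
  · exact ⟨⟨j.val + 1, by omega⟩, mem_nbrs.2 (Or.inr rfl)⟩
  · exact ⟨⟨j.val - 1, by omega⟩, mem_nbrs.2 (Or.inl (by simp; omega))⟩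

theorem cartanK_mulVec (v : Fin N → ℝ) (j : Fin N) :
    (cartanK N).mulVec v j = 2 * v j - ∑ k ∈ nbrs j, v k := by
  have hentry : ∀ k, cartanK N j k * v k
      = (if k = j then 2 * v j else 0) - if k ∈ nbrs j then v k else 0 := by
    intro k
    simp only [cartanK, CartanMatrix.A, Matrix.map_apply, Matrix.of_apply, mem_nbrs]
    by_cases hk : j = k
    · subst hk; simp
    · have hv : j.val ≠ k.val := fun h => hk (Fin.ext h)
      by_cases hkj : j.val + 1 = k.val ∨ k.val + 1 = j.val
      · have : k.val + 1 = j.val ∨ k.val = j.val + 1 := by omega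
        simp [hk, Ne.symm hk, hkj, this]
      · have : ¬ (k.val + 1 = j.val ∨ k.val = j.val + 1) := by omega
        simp [hk, Ne.symm hk, hkj, this]
  simp only [Matrix.mulVec, dotProduct, hentry, Finset.sum_sub_distrib]
  simp

/-- A concave positive function on the Dynkin diagram. -/
def cartanWeight (j : Fin N) : ℝ := (j.val + 1) * (N - j.val)

theorem cartanWeight_pos (j : Fin N) : 0 < cartanWeight j := by
  have : (j.val : ℝ) < N := by exact_mod_cast j.2
  exact mul_pos (by positivity) (by linarith)

/-- With `x = j + 1` the weight is `x (N + 1 - x)`: its second difference is `-2`, and it vanishes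
at `0` and `N + 1`, so the end vertices obey the same formula. -/
theorem sum_nbrs_cartanWeight (j : Fin N) :
    ∑ k ∈ nbrs j, cartanWeight k = 2 * cartanWeight j - 2 := by
  have hsplit : nbrs j = (Finset.univ.filter fun k : Fin N => k.val + 1 = j.val) ∪
      Finset.univ.filter fun k : Fin N => k.val = j.val + 1 := by
    ext k; simp [mem_nbrs]
  have hdisj : Disjoint (Finset.univ.filter fun k : Fin N => k.val + 1 = j.val)
      (Finset.univ.filter fun k : Fin N => k.val = j.val + 1) := by
    rw [Finset.disjoint_filter]; intro k _ h1 h2; omega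
  rw [hsplit, Finset.sum_union hdisj]
  have h1 : ∑ k : Fin N with k.val + 1 = j.val, cartanWeight k = (j.val : ℝ) * (N - j.val + 1) := by
    rcases Nat.eq_zero_or_pos j.val with h | h
    · rw [Finset.filter_false_of_mem fun k _ => by omega]
      simp [h]
    · have : (Finset.univ.filter fun k : Fin N => k.val + 1 = j.val)
          = {(⟨j.val - 1, by omega⟩ : Fin N)} := by
        ext k; simp [Fin.ext_iff]; omega
      rw [this, Finset.sum_singleton, cartanWeight]
      push_cast [Nat.cast_sub h]
      ring
  have h2 : ∑ k : Fin N with k.val = j.val + 1, cartanWeight k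
      = ((j.val : ℝ) + 2) * (N - j.val - 1) := by
    by_cases h : j.val + 1 < N
    · have : (Finset.univ.filter fun k : Fin N => k.val = j.val + 1)
          = {(⟨j.val + 1, h⟩ : Fin N)} := by
        ext k; simp [Fin.ext_iff]
      rw [this, Finset.sum_singleton, cartanWeight]
      push_cast
      ring
    · rw [Finset.filter_false_of_mem fun k _ => by omega]
      have : (N : ℝ) = j.val + 1 := by
        have := j.2
        exact_mod_cast (by omega : N = j.val + 1)
      simp [this]
  rw [h1, h2, cartanWeight]; ring

/-- The discrete minimum principle. -/
theorem nonneg_of_cartanK_mulVec_nonneg {v : Fin N → ℝ}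
    (hv : ∀ j, 0 ≤ (cartanK N).mulVec v j) (j : Fin N) : 0 ≤ v j := by
  by_contra! hneg
  have : Nonempty (Fin N) := ⟨j⟩
  obtain ⟨i, -, hi⟩ := Finset.exists_min_image Finset.univ (fun j => v j / cartanWeight j)
    Finset.univ_nonempty
  set m := v i / cartanWeight i with hm
  have hmneg : m < 0 :=
    (hi j (Finset.mem_univ _)).trans_lt (div_neg_of_neg_of_pos hneg (cartanWeight_pos j))
  have hvi : v i = m * cartanWeight i := by rw [hm, div_mul_cancel₀ _ (cartanWeight_pos i).ne']
  -- Where `v / cartanWeight` attains a negative minimum `m`, this gives `(K v)_i ≤ 2m < 0`.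
  have hsum : m * (2 * cartanWeight i - 2) ≤ ∑ k ∈ nbrs i, v k := by
    rw [← sum_nbrs_cartanWeight, Finset.mul_sum]
    exact Finset.sum_le_sum fun k _ =>
      (le_div_iff₀ (cartanWeight_pos k)).1 (hi k (Finset.mem_univ _))
  have := hv i
  rw [cartanK_mulVec, hvi] at this
  linarith

/-- The minimum principle applied to `v - w` and `w - v` makes `K` injective, so `⁻¹` is a true
inverse and not the default value of a singular matrix. -/
theorem cartanK_mulVec_inv (v : Fin N → ℝ) :
    (cartanK N).mulVec ((cartanK N)⁻¹.mulVec v) = v := by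
  have hinj : Function.Injective (cartanK N).mulVec := by
    intro v w hvw
    have hd : (cartanK N).mulVec (v - w) = 0 := by rw [Matrix.mulVec_sub, hvw, sub_self]
    have hd' : (cartanK N).mulVec (w - v) = 0 := by rw [Matrix.mulVec_sub, hvw, sub_self]
    ext j
    have h1 := nonneg_of_cartanK_mulVec_nonneg (v := v - w) (fun j => by rw [hd]; rfl) j
    have h2 := nonneg_of_cartanK_mulVec_nonneg (v := w - v) (fun j => by rw [hd']; rfl) j
    simp only [Pi.sub_apply] at h1 h2
    linarith
  have hunit : IsUnit (cartanK N) := Matrix.mulVec_injective_iff_isUnit.1 hinj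
  rw [Matrix.mulVec_mulVec, Matrix.mul_nonsing_inv _ ((Matrix.isUnit_iff_isUnit_det _).1 hunit),
    Matrix.one_mulVec]

/-- The strong minimum principle: a zero of a nonnegative `v` with `K v ≥ 0` spreads to its
neighbours, and thus along the whole connected diagram. -/
theorem pos_of_cartanK_mulVec_nonneg {v : Fin N → ℝ} (hv : ∀ j, 0 ≤ (cartanK N).mulVec v j)
    (hv' : (cartanK N).mulVec v ≠ 0) (j : Fin N) : 0 < v j := by
  have hnn := nonneg_of_cartanK_mulVec_nonneg hv
  have hstep : ∀ i, v i = 0 → ∀ k ∈ nbrs i, v k = 0 := by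
    intro i hi
    have h1 := hv i
    rw [cartanK_mulVec, hi] at h1
    have h2 : ∑ k ∈ nbrs i, v k = 0 :=
      le_antisymm (by linarith) (Finset.sum_nonneg fun k _ => hnn k)
    exact (Finset.sum_eq_zero_iff_of_nonneg fun k _ => hnn k).1 h2
  refine lt_of_le_of_ne (hnn j) fun hj => hv' ?_
  have hup : ∀ d : ℕ, ∀ h : j.val + d < N, v ⟨j.val + d, h⟩ = 0 := by
    intro d
    induction d with
    | zero => intro h; exact hj.symm
    | succ d ih =>
      intro h
      exact hstep _ (ih (by omega)) _ (mem_nbrs.2 (Or.inr rfl))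
  have hdown : ∀ d : ℕ, ∀ h : d ≤ j.val, v ⟨j.val - d, by omega⟩ = 0 := by
    intro d
    induction d with
    | zero => intro h; exact hj.symm
    | succ d ih =>
      intro h
      exact hstep _ (ih (by omega)) _ (mem_nbrs.2 (Or.inl (by simp; omega)))
  have hzero : v = 0 := by
    ext k
    rcases le_total j.val k.val with h | h
    · have := hup (k.val - j.val) (by omega)
      simpa [show j.val + (k.val - j.val) = k.val by omega] using this
    · have := hdown (j.val - k.val) (by omega)
      simpa [show j.val - (j.val - k.val) = k.val by omega] using this
  rw [hzero, Matrix.mulVec_zero]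

theorem r_eq_mulVec : (r : Fin N → ℝ) = (cartanK N)⁻¹.mulVec fun _ => 1 := by
  ext j; simp [r, Matrix.mulVec, dotProduct]

theorem r_pos (j : Fin N) : 0 < r j := by
  rw [r_eq_mulVec]
  refine pos_of_cartanK_mulVec_nonneg (fun j => ?_) (fun h => ?_) j
  · rw [cartanK_mulVec_inv]; exact zero_le_one
  · rw [cartanK_mulVec_inv] at h
    exact one_ne_zero (congrFun h j)

theorem sum_nbrs_r (j : Fin N) : ∑ k ∈ nbrs j, r k = 2 * r j - 1 := by
  have h := congrFun (cartanK_mulVec_inv (N := N) fun _ => 1) j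
  rw [← r_eq_mulVec, cartanK_mulVec] at h
  linarith

theorem b_pos {n : Fin N → ℕ} (hn : ∃ k, 0 < n k) (j : Fin N) : 0 < b n j := by
  have h : 0 < (cartanK N)⁻¹.mulVec (fun k => (n k : ℝ)) j := by
    refine pos_of_cartanK_mulVec_nonneg (fun j => ?_) (fun h => ?_) j
    · rw [cartanK_mulVec_inv]; exact Nat.cast_nonneg _
    · rw [cartanK_mulVec_inv] at h
      obtain ⟨k, hk⟩ := hn
      have := congrFun h k
      simp only [Pi.zero_apply, Nat.cast_eq_zero] at this
      omega
  exact mul_pos (by positivity) h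

end Cartan

/-! ### A smooth truncation of the logarithmic potential -/

section Kernel

/-- A smooth monotone function equal to `0` on `(-∞, 1/2]` and to `1` on `[1, ∞)`. -/
def step (x : ℝ) : ℝ := Real.smoothTransition (2 * x - 1)

theorem contDiff_step : ContDiff ℝ ∞ step :=
  Real.smoothTransition.contDiff.comp (by fun_prop)

theorem monotone_step : Monotone step := fun x y hxy =>
  Real.smoothTransition.monotone (by linarith)

theorem step_of_le {x : ℝ} (hx : x ≤ 1 / 2) : step x = 0 :=
  Real.smoothTransition.zero_of_nonpos (by linarith)

theorem step_of_ge {x : ℝ} (hx : 1 ≤ x) : step x = 1 :=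
  Real.smoothTransition.one_of_one_le (by linarith)

theorem step_nonneg (x : ℝ) : 0 ≤ step x := Real.smoothTransition.nonneg _

theorem step_le_one (x : ℝ) : step x ≤ 1 := Real.smoothTransition.le_one _

theorem hasDerivAt_step (x : ℝ) : HasDerivAt step (deriv step x) x :=
  (contDiff_step.differentiable (by simp) x).hasDerivAt

theorem continuous_deriv_step : Continuous (deriv step) :=
  contDiff_step.continuous_deriv (by simp)

theorem deriv_step_nonneg (x : ℝ) : 0 ≤ deriv step x := monotone_step.deriv_nonneg

theorem deriv_step_of_gt {x : ℝ} (hx : 1 < x) : deriv step x = 0 := by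
  have : step =ᶠ[nhds x] fun _ => 1 := by
    filter_upwards [lt_mem_nhds hx] with y hy using step_of_ge hy.le
  rw [this.deriv_eq, deriv_const]

theorem deriv_step_of_lt {x : ℝ} (hx : x < 1 / 2) : deriv step x = 0 := by
  have : step =ᶠ[nhds x] fun _ => 0 := by
    filter_upwards [gt_mem_nhds hx] with y hy using step_of_le hy.le
  rw [this.deriv_eq, deriv_const]

theorem exists_deriv_step_le : ∃ C : ℝ, 0 < C ∧ ∀ x, deriv step x ≤ C := by
  obtain ⟨C, hC⟩ := (isCompact_Icc (a := (0 : ℝ)) (b := 1)).exists_bound_of_continuousOn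
    continuous_deriv_step.continuousOn
  refine ⟨max C 1, by positivity, fun x => ?_⟩
  by_cases hx : x ∈ Icc (0 : ℝ) 1
  · exact (le_abs_self _).trans ((hC x hx).trans (le_max_left _ _))
  · rcases not_and_or.1 hx with h | h
    · rw [deriv_step_of_lt (by linarith)]; positivity
    · rw [deriv_step_of_gt (by linarith)]; positivity

theorem exists_deriv_step_pos : ∃ x, 0 < x ∧ 0 < deriv step x := by
  obtain ⟨x, hx, hd⟩ := exists_deriv_eq_slope step (zero_lt_one (α := ℝ))
    contDiff_step.continuous.continuousOn
    (contDiff_step.differentiable (by simp)).differentiableOn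
  refine ⟨x, hx.1, ?_⟩
  rw [hd, step_of_ge le_rfl, step_of_le (by norm_num)]; norm_num

/-- The derivative of the radial profile of `truncLog`, as a function of the squared radius. -/
def profileDeriv (δ s : ℝ) : ℝ := (step (s / δ ^ 2) - step s) / s

variable {δ : ℝ}

theorem mul_profileDeriv (δ s : ℝ) : s * profileDeriv δ s = step (s / δ ^ 2) - step s := by
  rcases eq_or_ne s 0 with rfl | hs
  · simp
  · rw [profileDeriv, mul_div_cancel₀ _ hs]

theorem profileDeriv_of_small (hδ : 0 < δ) (hδ1 : δ ≤ 1) {s : ℝ} (hs : s ≤ δ ^ 2 / 2) :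
    profileDeriv δ s = 0 := by
  have h1 : δ ^ 2 ≤ 1 := pow_le_one₀ hδ.le hδ1
  rw [profileDeriv, step_of_le, step_of_le, sub_self, zero_div]
  · linarith
  · rw [div_le_iff₀ (by positivity)]; linarith

theorem profileDeriv_of_ge (hδ : 0 < δ) (hδ1 : δ ≤ 1) {s : ℝ} (hs : 1 ≤ s) :
    profileDeriv δ s = 0 := by
  have h1 : δ ^ 2 ≤ 1 := pow_le_one₀ hδ.le hδ1
  rw [profileDeriv, step_of_ge, step_of_ge hs, sub_self, zero_div]
  rw [le_div_iff₀ (by positivity)]; linarith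

theorem profileDeriv_nonneg (hδ : 0 < δ) (hδ1 : δ ≤ 1) {s : ℝ} (hs : 0 ≤ s) :
    0 ≤ profileDeriv δ s := by
  refine div_nonneg (sub_nonneg.2 (monotone_step ?_)) hs
  exact le_div_self hs (by positivity) (pow_le_one₀ hδ.le hδ1)

theorem profileDeriv_le {s : ℝ} (hs : 0 ≤ s) : profileDeriv δ s ≤ 1 / s := by
  refine div_le_div_of_nonneg_right ?_ hs
  linarith [step_le_one (s / δ ^ 2), step_nonneg s]

theorem contDiff_profileDeriv (hδ : 0 < δ) (hδ1 : δ ≤ 1) : ContDiff ℝ ∞ (profileDeriv δ) := by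
  refine contDiff_iff_contDiffAt.2 fun s => ?_
  rcases lt_or_ge s (δ ^ 2 / 2) with hs | hs
  · have : profileDeriv δ =ᶠ[nhds s] fun _ => 0 := by
      filter_upwards [gt_mem_nhds hs] with y hy using profileDeriv_of_small hδ hδ1 hy.le
    exact contDiffAt_const.congr_of_eventuallyEq this
  · have hs0 : s ≠ 0 := (lt_of_lt_of_le (by positivity) hs).ne'
    have h1 : ContDiff ℝ ∞ fun s => step (s / δ ^ 2) - step s :=
      (contDiff_step.comp (by fun_prop)).sub contDiff_step
    exact h1.contDiffAt.div contDiffAt_id hs0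

/-- The radial profile of `truncLog`, as a function of the squared radius. -/
def profile (δ s : ℝ) : ℝ := ∫ τ in (1 : ℝ)..s, profileDeriv δ τ

theorem hasDerivAt_profile (hδ : 0 < δ) (hδ1 : δ ≤ 1) (s : ℝ) :
    HasDerivAt (profile δ) (profileDeriv δ s) s :=
  (contDiff_profileDeriv hδ hδ1).continuous.integral_hasStrictDerivAt 1 s |>.hasDerivAt

theorem contDiff_profile (hδ : 0 < δ) (hδ1 : δ ≤ 1) : ContDiff ℝ ∞ (profile δ) := by
  refine contDiff_infty_iff_deriv.2
    ⟨fun s => (hasDerivAt_profile hδ hδ1 s).differentiableAt, ?_⟩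
  rw [show deriv (profile δ) = profileDeriv δ from
    funext fun s => (hasDerivAt_profile hδ hδ1 s).deriv]
  exact contDiff_profileDeriv hδ hδ1

theorem profile_of_ge (hδ : 0 < δ) (hδ1 : δ ≤ 1) {s : ℝ} (hs : 1 ≤ s) : profile δ s = 0 := by
  rw [profile, intervalIntegral.integral_congr (g := fun _ => 0) fun τ hτ => ?_]
  · simp
  · rw [uIcc_of_le hs] at hτ
    exact profileDeriv_of_ge hδ hδ1 hτ.1

theorem profile_nonpos (hδ : 0 < δ) (hδ1 : δ ≤ 1) {s : ℝ} (hs : 0 ≤ s) : profile δ s ≤ 0 := by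
  rcases le_total 1 s with h | h
  · exact (profile_of_ge hδ hδ1 h).le
  · rw [profile, intervalIntegral.integral_symm, neg_nonpos]
    exact intervalIntegral.integral_nonneg h fun τ hτ =>
      profileDeriv_nonneg hδ hδ1 (hs.trans hτ.1)

theorem log_le_profile (hδ : 0 < δ) (hδ1 : δ ≤ 1) {s : ℝ} (hs : 0 < s) (hs1 : s ≤ 1) :
    Real.log s ≤ profile δ s := by
  have h0 : (0 : ℝ) ∉ uIcc s 1 := by
    rw [uIcc_of_le hs1]; exact fun h => absurd h.1 (not_le.2 hs)
  have h1 : ∫ τ in s..1, profileDeriv δ τ ≤ ∫ τ in s..1, 1 / τ := by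
    refine intervalIntegral.integral_mono_on hs1
      ((contDiff_profileDeriv hδ hδ1).continuous.intervalIntegrable _ _)
      (intervalIntegral.intervalIntegrable_one_div (fun x hx h => h0 (h ▸ hx)) continuousOn_id) ?_
    exact fun τ hτ => profileDeriv_le (hs.le.trans hτ.1)
  rw [integral_one_div h0, one_div, Real.log_inv] at h1
  rw [profile, intervalIntegral.integral_symm]
  linarith

/-- A smooth function on the plane, supported in the unit ball, which is a truncation of
`log |z|²` near infinity and near the origin. -/
def truncLog (δ : ℝ) (z : Plane) : ℝ := profile δ (‖z‖ ^ 2)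

theorem contDiff_truncLog (hδ : 0 < δ) (hδ1 : δ ≤ 1) : ContDiff ℝ ∞ (truncLog δ) :=
  (contDiff_profile hδ hδ1).comp (contDiff_norm_sq ℝ)

theorem truncLog_nonpos (hδ : 0 < δ) (hδ1 : δ ≤ 1) (z : Plane) : truncLog δ z ≤ 0 :=
  profile_nonpos hδ hδ1 (by positivity)

theorem truncLog_of_ge (hδ : 0 < δ) (hδ1 : δ ≤ 1) {z : Plane} (hz : 1 ≤ ‖z‖) :
    truncLog δ z = 0 :=
  profile_of_ge hδ hδ1 (one_le_pow₀ hz)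

/-- The singular kernel `|z|⁻¹`, cut off outside the unit ball. -/
def rieszKernel (z : Plane) : ℝ := (Metric.ball (0 : Plane) 1).indicator (fun z => ‖z‖⁻¹) z

theorem rieszKernel_nonneg (z : Plane) : 0 ≤ rieszKernel z :=
  indicator_nonneg (fun _ _ => inv_nonneg.2 (norm_nonneg _)) z

/-- Uniform in `δ`, from `-log |z|² ≤ 2 (|z|⁻¹ - 1)`. The origin is excluded because the convention
`0⁻¹ = 0` makes the kernel vanish there. -/
theorem abs_truncLog_le (hδ : 0 < δ) (hδ1 : δ ≤ 1) {z : Plane} (hz0 : z ≠ 0) :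
    |truncLog δ z| ≤ 2 * rieszKernel z := by
  by_cases hz : ‖z‖ < 1
  · have hn : 0 < ‖z‖ := norm_pos_iff.2 hz0
    rw [abs_of_nonpos (truncLog_nonpos hδ hδ1 z), rieszKernel,
      indicator_of_mem (mem_ball_zero_iff.2 hz)]
    have h1 := log_le_profile hδ hδ1 (s := ‖z‖ ^ 2) (by positivity) (pow_le_one₀ hn.le hz.le)
    have h2 := Real.log_le_sub_one_of_pos (inv_pos.2 hn)
    rw [Real.log_inv] at h2
    rw [Real.log_pow] at h1
    push_cast at h1
    unfold truncLog
    linarith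
  · rw [truncLog_of_ge hδ hδ1 (not_lt.1 hz), abs_zero]
    exact mul_nonneg zero_le_two (rieszKernel_nonneg z)

theorem hasFDerivAt_norm_sq (z : Plane) :
    HasFDerivAt (fun z : Plane => ‖z‖ ^ 2) (2 • innerSL ℝ z) z :=
  (hasStrictFDerivAt_norm_sq z).hasFDerivAt

theorem inner_single (z : Plane) (i : Fin 2) : inner ℝ z (EuclideanSpace.single i 1) = z i := by
  simp [EuclideanSpace.inner_single_right]

theorem partialDeriv_truncLog (hδ : 0 < δ) (hδ1 : δ ≤ 1) (i : Fin 2) :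
    partialDeriv i (truncLog δ) = fun z => 2 * profileDeriv δ (‖z‖ ^ 2) * z i := by
  ext z
  have h : HasFDerivAt (truncLog δ) (profileDeriv δ (‖z‖ ^ 2) • (2 • innerSL ℝ z)) z :=
    HasDerivAt.comp_hasFDerivAt (h₂ := profile δ) z (hasDerivAt_profile hδ hδ1 _)
      (hasFDerivAt_norm_sq z)
  rw [partialDeriv, h.fderiv]
  simp [inner_single]
  ring

theorem abs_partialDeriv_truncLog_le (hδ : 0 < δ) (hδ1 : δ ≤ 1) (i : Fin 2) (z : Plane) :
    |partialDeriv i (truncLog δ) z| ≤ 2 * rieszKernel z := by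
  rw [partialDeriv_truncLog hδ hδ1]
  by_cases hz : ‖z‖ < 1
  · rw [rieszKernel, indicator_of_mem (mem_ball_zero_iff.2 hz)]
    rcases eq_or_ne z 0 with rfl | hz0
    · simp
    have hn : 0 < ‖z‖ := norm_pos_iff.2 hz0
    rw [abs_mul, abs_mul, abs_two, abs_of_nonneg (profileDeriv_nonneg hδ hδ1 (by positivity)),
      mul_assoc]
    gcongr
    calc profileDeriv δ (‖z‖ ^ 2) * |z i| ≤ 1 / ‖z‖ ^ 2 * ‖z‖ := by
          refine mul_le_mul (profileDeriv_le (by positivity)) ?_ (abs_nonneg _) (by positivity)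
          exact PiLp.norm_apply_le z i
      _ = ‖z‖⁻¹ := by field_simp
  · simp only
    rw [profileDeriv_of_ge hδ hδ1 (one_le_pow₀ (not_lt.1 hz)), mul_zero, zero_mul, abs_zero]
    exact mul_nonneg zero_le_two (rieszKernel_nonneg z)

theorem laplacian_eq_sum_partialDeriv {φ : Plane → ℝ} (hφ : ContDiff ℝ ∞ φ) (z : Plane) :
    Laplacian.laplacian φ z = ∑ i, partialDeriv i (partialDeriv i φ) z := by
  rw [InnerProductSpace.laplacian_eq_iteratedFDeriv_orthonormalBasis φ
    (EuclideanSpace.basisFun (Fin 2) ℝ)]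
  refine Finset.sum_congr rfl fun i _ => ?_
  have hd : DifferentiableAt ℝ (fderiv ℝ φ) z :=
    (hφ.fderiv_right (m := ∞) (by simp)).differentiable (by simp) z
  rw [iteratedFDeriv_two_apply]
  unfold partialDeriv
  rw [fderiv_clm_apply hd (by fun_prop)]
  simp

/-- The mollifier `4 δ⁻² β'(|z|² / δ²)`, where `β` is `step`. -/
def mollifier (δ : ℝ) (z : Plane) : ℝ := 4 / δ ^ 2 * deriv step (‖z‖ ^ 2 / δ ^ 2)

/-- A radial function `f(s)` with `s = |z|²` on the plane has Laplacian `4 (s f')'`, and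
`profileDeriv` is chosen so that `s f' = step (s / δ²) - step s`. -/
theorem laplacian_truncLog (hδ : 0 < δ) (hδ1 : δ ≤ 1) (z : Plane) :
    Laplacian.laplacian (truncLog δ) z = mollifier δ z - mollifier 1 z := by
  rw [laplacian_eq_sum_partialDeriv (contDiff_truncLog hδ hδ1)]
  set s := ‖z‖ ^ 2 with hs
  set d := deriv (profileDeriv δ) s
  have hd : HasDerivAt (profileDeriv δ) d s :=
    ((contDiff_profileDeriv hδ hδ1).differentiable (by simp) s).hasDerivAt
  have hpart : ∀ i : Fin 2, partialDeriv i (partialDeriv i (truncLog δ)) z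
      = 2 * profileDeriv δ s + 4 * d * (z i) ^ 2 := by
    intro i
    rw [partialDeriv_truncLog hδ hδ1]
    have h1 : HasFDerivAt (fun z : Plane => profileDeriv δ (‖z‖ ^ 2)) (d • (2 • innerSL ℝ z)) z :=
      HasDerivAt.comp_hasFDerivAt (h₂ := profileDeriv δ) z hd (hasFDerivAt_norm_sq z)
    have h2 : HasFDerivAt (fun z : Plane => z i) (EuclideanSpace.proj (𝕜 := ℝ) i) z :=
      (EuclideanSpace.proj (𝕜 := ℝ) i).hasFDerivAt
    have h3 := (h1.const_mul 2).mul h2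
    rw [partialDeriv, HasFDerivAt.fderiv
      (f := fun z : Plane => 2 * profileDeriv δ (‖z‖ ^ 2) * z i) h3]
    simp [inner_single]
    ring
  have hprod : HasDerivAt (fun s => s * profileDeriv δ s) (1 * profileDeriv δ s + s * d) s :=
    (hasDerivAt_id s).mul hd
  have hprod' : HasDerivAt (fun s => s * profileDeriv δ s)
      (deriv step (s / δ ^ 2) * (1 / δ ^ 2) - deriv step s) s := by
    simp only [mul_profileDeriv]
    exact (HasDerivAt.comp s (hasDerivAt_step (s / δ ^ 2)) ((hasDerivAt_id s).div_const _)).sub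
      (hasDerivAt_step s)
  have heq := hprod.unique hprod'
  have hnorm : s = z 0 ^ 2 + z 1 ^ 2 := by
    rw [hs, EuclideanSpace.norm_sq_eq, Fin.sum_univ_two]
    simp
  simp only [hpart, Fin.sum_univ_two, mollifier, ← hs]
  rw [one_pow, div_one, div_one]
  linear_combination 4 * heq - 4 * d * hnorm

theorem continuous_mollifier (δ : ℝ) : Continuous (mollifier δ) := by
  have := continuous_deriv_step
  unfold mollifier
  fun_prop

theorem mollifier_nonneg (δ : ℝ) (z : Plane) : 0 ≤ mollifier δ z :=
  mul_nonneg (by positivity) (deriv_step_nonneg _)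

theorem mollifier_of_gt (hδ : 0 < δ) {z : Plane} (hz : δ < ‖z‖) : mollifier δ z = 0 := by
  rw [mollifier, deriv_step_of_gt, mul_zero]
  rw [one_lt_div (by positivity)]
  gcongr

theorem support_mollifier (hδ : 0 < δ) :
    Function.support (mollifier δ) ⊆ Metric.closedBall 0 δ := by
  intro z hz
  rw [mem_closedBall_zero_iff]
  by_contra! h
  exact hz (mollifier_of_gt hδ h)

theorem exists_mollifier_le : ∃ C : ℝ, 0 < C ∧ ∀ (δ : ℝ) (z : Plane), mollifier δ z ≤ C / δ ^ 2 := by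
  obtain ⟨C, hC, h⟩ := exists_deriv_step_le
  refine ⟨4 * C, by positivity, fun δ z => ?_⟩
  rw [mollifier, mul_div_right_comm]
  gcongr
  exact h _

theorem hasCompactSupport_mollifier (hδ : 0 < δ) : HasCompactSupport (mollifier δ) :=
  HasCompactSupport.intro (isCompact_closedBall (0 : Plane) δ) fun z hz =>
    mollifier_of_gt hδ (by simpa using hz)

/-- The mass is independent of `δ` by scaling. It is never computed; its positivity suffices for
normalisation. -/
theorem integral_mollifier (hδ : 0 < δ) : ∫ z, mollifier δ z = ∫ z, mollifier 1 z := by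
  have h := Measure.integral_comp_inv_smul_of_nonneg (volume : Measure Plane) (mollifier 1) hδ.le
  have h2 : ∀ z, mollifier 1 (δ⁻¹ • z) = δ ^ 2 * mollifier δ z := by
    intro z
    rw [mollifier, mollifier, norm_smul, norm_inv, Real.norm_of_nonneg hδ.le]
    field_simp
  simp only [h2, integral_const_mul, finrank_euclideanSpace, Fintype.card_fin, smul_eq_mul] at h
  exact mul_left_cancel₀ (pow_pos hδ 2).ne' h

theorem integral_mollifier_pos : 0 < ∫ z, mollifier 1 z := by
  obtain ⟨x, hx, hd⟩ := exists_deriv_step_pos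
  refine (continuous_mollifier 1).integral_pos_of_hasCompactSupport_nonneg_nonzero
    (hasCompactSupport_mollifier one_pos) (mollifier_nonneg 1)
    (x := EuclideanSpace.single 0 √x) ?_
  rw [mollifier, PiLp.norm_single, Real.norm_of_nonneg (Real.sqrt_nonneg _),
    Real.sq_sqrt hx.le]
  simpa using hd.ne'

/-- Mollification converges almost everywhere. -/
theorem ae_tendsto_integral_mollifier {f : Plane → ℝ} (hf : LocallyIntegrable f) :
    ∀ᵐ x, Filter.Tendsto (fun k : ℕ => ∫ y, f y * mollifier (1 / (k + 1 : ℝ)) (y - x))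
      Filter.atTop (nhds ((∫ z, mollifier 1 z) * f x)) := by
  have hc := integral_mollifier_pos
  set c₀ := ∫ z, mollifier 1 z with hc₀
  obtain ⟨C, hC, hbound⟩ := exists_mollifier_le
  filter_upwards [(Besicovitch.vitaliFamily (volume : Measure Plane)).ae_tendsto_average_norm_sub
    hf] with x hx
  have hδ : ∀ k : ℕ, 0 < 1 / (k + 1 : ℝ) := fun k => by positivity
  have hlim : Filter.Tendsto (fun k : ℕ => 1 / (k + 1 : ℝ)) Filter.atTop (nhdsWithin 0 (Ioi 0)) :=
    tendsto_nhdsWithin_iff.2 ⟨tendsto_one_div_add_atTop_nhds_zero_nat,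
      Filter.Eventually.of_forall hδ⟩
  have hav := (hx.comp (Besicovitch.tendsto_filterAt volume x)).comp hlim
  -- At a Lebesgue point, kernels of mass one supported in shrinking balls and bounded by a multiple
  -- of the inverse volume recover the value.
  have key := tendsto_integral_smul_of_tendsto_average_norm_sub
    (g := fun (k : ℕ) y => c₀⁻¹ * mollifier (1 / (k + 1 : ℝ)) (y - x))
    (c₀⁻¹ * C * volume.real (Metric.closedBall (0 : Plane) 1)) hav ?_ ?_ ?_ ?_
  · have h2 := key.const_mul c₀
    refine h2.congr fun k => ?_
    rw [← integral_const_mul]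
    refine integral_congr_ae (Filter.Eventually.of_forall fun y => ?_)
    simp only [smul_eq_mul]
    field_simp
  · exact Filter.Eventually.of_forall fun k =>
      hf.integrableOn_isCompact (isCompact_closedBall _ _)
  · refine tendsto_const_nhds.congr fun k => ?_
    rw [integral_const_mul, integral_sub_right_eq_self (mollifier (1 / (k + 1 : ℝ))),
      integral_mollifier (hδ k), inv_mul_cancel₀ hc.ne']
  · refine Filter.Eventually.of_forall fun k y hy => ?_
    have : mollifier (1 / (k + 1 : ℝ)) (y - x) ≠ 0 := right_ne_zero_of_mul hy
    have h2 := support_mollifier (hδ k) this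
    rwa [mem_closedBall_zero_iff, ← dist_eq_norm] at h2
  · refine Filter.Eventually.of_forall fun k y => ?_
    rw [abs_of_nonneg (mul_nonneg (inv_nonneg.2 hc.le) (mollifier_nonneg _ _))]
    have hvol : volume.real (Metric.closedBall x (1 / (k + 1 : ℝ)))
        = (1 / (k + 1 : ℝ)) ^ 2 * volume.real (Metric.closedBall (0 : Plane) 1) := by
      rw [Measure.addHaar_real_closedBall' (volume : Measure Plane) x (hδ k).le,
        finrank_euclideanSpace, Fintype.card_fin]
    have hv : 0 < volume.real (Metric.closedBall (0 : Plane) 1) :=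
      ENNReal.toReal_pos (Metric.measure_closedBall_pos _ _ one_pos).ne'
        (isCompact_closedBall _ _).measure_lt_top.ne
    rw [hvol, mul_div_mul_right _ _ hv.ne', mul_div_assoc]
    exact mul_le_mul_of_nonneg_left (hbound _ _) (inv_nonneg.2 hc.le)

end Kernel

/-! ### Periodization and periodic extension -/

section Periodic

variable (a : Module.Basis (Fin 2) ℝ Plane)

/-- The lattice `ℤ a₁ + ℤ a₂`. -/
abbrev lattice : Submodule ℤ Plane := Submodule.span ℤ (Set.range a)

instance vaddInvariantMeasure_lattice :
    VAddInvariantMeasure (lattice a) Plane (volume : Measure Plane) :=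
  ⟨fun l s _ => measure_preimage_add volume (l : Plane) s⟩

/-- The generators of the lattice. -/
def latticeGen (i : Fin 2) : lattice a := ⟨a i, Submodule.subset_span (mem_range_self i)⟩

open scoped Pointwise in
/-- Only finitely many lattice translates of a bounded set meet another one. -/
theorem exists_finset_add_notMem {B K : Set Plane} (hB : Bornology.IsBounded B)
    (hK : Bornology.IsBounded K) :
    ∃ S : Finset (lattice a), ∀ x ∈ B, ∀ l ∉ S, (l : Plane) + x ∉ K := by
  have hfin : ((K - B) ∩ (lattice a : Set Plane)).Finite :=
    ZSpan.setFinite_inter a (hK.sub hB)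
  have hfin' : {l : lattice a | (l : Plane) ∈ K - B}.Finite := by
    refine Set.Finite.of_finite_image (f := Subtype.val) (hfin.subset ?_)
      Subtype.val_injective.injOn
    rintro _ ⟨l, hl, rfl⟩
    exact ⟨hl, l.2⟩
  refine ⟨hfin'.toFinset, fun x hx l hl hlx => hl ?_⟩
  rw [Set.Finite.mem_toFinset]
  exact ⟨_, hlx, x, hx, by simp⟩

/-- The sum of the lattice translates of a function. -/
def periodize (ψ : Plane → ℝ) (x : Plane) : ℝ := ∑' l : lattice a, ψ (l + x)

variable {a}

/-- One finite set of translates serves all points of a bounded set, so the periodization can be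
differentiated and integrated termwise. -/
theorem exists_finset_periodize_eq {ψ : Plane → ℝ} (hψ : HasCompactSupport ψ) {B : Set Plane}
    (hB : Bornology.IsBounded B) :
    ∃ S : Finset (lattice a), (∀ x ∈ B, ∀ l ∉ S, ψ ((l : Plane) + x) = 0) ∧
      ∀ x ∈ B, periodize a ψ x = ∑ l ∈ S, ψ (l + x) := by
  obtain ⟨S, hS⟩ := exists_finset_add_notMem a hB hψ.isCompact.isBounded
  have h0 : ∀ x ∈ B, ∀ l ∉ S, ψ ((l : Plane) + x) = 0 := fun x hx l hl =>
    image_eq_zero_of_notMem_tsupport (hS x hx l hl)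
  exact ⟨S, h0, fun x hx => tsum_eq_sum fun l hl => h0 x hx l hl⟩

theorem periodize_eventuallyEq {ψ : Plane → ℝ} (hψ : HasCompactSupport ψ) (x : Plane) :
    ∃ S : Finset (lattice a), periodize a ψ =ᶠ[nhds x] fun x => ∑ l ∈ S, ψ (l + x) := by
  obtain ⟨S, -, hS⟩ := exists_finset_periodize_eq (a := a) hψ (Metric.isBounded_ball (x := x) (r := 1))
  exact ⟨S, Filter.mem_of_superset (Metric.ball_mem_nhds x one_pos) hS⟩

theorem contDiff_periodize {ψ : Plane → ℝ} (hψ : HasCompactSupport ψ) (hs : ContDiff ℝ ∞ ψ) :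
    ContDiff ℝ ∞ (periodize a ψ) := by
  refine contDiff_iff_contDiffAt.2 fun x => ?_
  obtain ⟨S, hS⟩ := periodize_eventuallyEq (a := a) hψ x
  refine ContDiffAt.congr_of_eventuallyEq (ContDiff.contDiffAt ?_) hS
  exact ContDiff.sum fun l _ => hs.comp (by fun_prop)

theorem isTest_periodize {ψ : Plane → ℝ} (hψ : HasCompactSupport ψ) (hs : ContDiff ℝ ∞ ψ) :
    IsTest a (periodize a ψ) := by
  refine ⟨contDiff_periodize hψ hs, fun i x => ?_⟩
  unfold periodize
  rw [← (Equiv.addRight (latticeGen a i)).tsum_eq fun l : lattice a => ψ (l + x)]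
  refine tsum_congr fun l => ?_
  simp only [Equiv.coe_addRight, Submodule.coe_add, latticeGen]
  congr 1
  abel

theorem hasCompactSupport_partialDeriv {ψ : Plane → ℝ} (hψ : HasCompactSupport ψ) (i : Fin 2) :
    HasCompactSupport (partialDeriv i ψ) :=
  hψ.fderiv_apply (𝕜 := ℝ) (EuclideanSpace.single i (1 : ℝ))

theorem contDiff_partialDeriv {ψ : Plane → ℝ} (hs : ContDiff ℝ ∞ ψ) (i : Fin 2) :
    ContDiff ℝ ∞ (partialDeriv i ψ) :=
  (hs.fderiv_right (m := ∞) (by simp)).clm_apply contDiff_const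

theorem partialDeriv_periodize {ψ : Plane → ℝ} (hψ : HasCompactSupport ψ) (hs : ContDiff ℝ ∞ ψ)
    (i : Fin 2) : partialDeriv i (periodize a ψ) = periodize a (partialDeriv i ψ) := by
  ext x
  obtain ⟨S, h0, hS⟩ := exists_finset_periodize_eq (a := a) hψ
    (Metric.isBounded_ball (x := x) (r := 1))
  have hS' : periodize a ψ =ᶠ[nhds x] fun x => ∑ l ∈ S, ψ (l + x) :=
    Filter.mem_of_superset (Metric.ball_mem_nhds x one_pos) hS
  have hd : ∀ l : lattice a, fderiv ℝ (fun x => ψ ((l : Plane) + x)) x = fderiv ℝ ψ (l + x) :=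
    fun l => fderiv_comp_add_left _
  have hdiff : ∀ l : lattice a, DifferentiableAt ℝ (fun x => ψ ((l : Plane) + x)) x := fun l =>
    (hs.differentiable (by simp) _).comp x (by fun_prop)
  rw [partialDeriv, hS'.fderiv_eq, fderiv_fun_sum fun l _ => hdiff l]
  simp only [hd, sum_apply]
  refine (tsum_eq_sum fun l hl => ?_).symm
  have : (fun x => ψ ((l : Plane) + x)) =ᶠ[nhds x] fun _ => 0 :=
    Filter.mem_of_superset (Metric.ball_mem_nhds x one_pos) fun y hy => h0 y hy l hl
  change fderiv ℝ ψ ((l : Plane) + x) _ = 0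
  rw [← hd, this.fderiv_eq]
  simp

theorem laplacian_periodize {ψ : Plane → ℝ} (hψ : HasCompactSupport ψ) (hs : ContDiff ℝ ∞ ψ) :
    Laplacian.laplacian (periodize a ψ) = periodize a (Laplacian.laplacian ψ) := by
  ext x
  rw [laplacian_eq_sum_partialDeriv (contDiff_periodize hψ hs)]
  have h : ∀ i, partialDeriv i (partialDeriv i (periodize a ψ)) x
      = periodize a (partialDeriv i (partialDeriv i ψ)) x := fun i => by
    rw [partialDeriv_periodize hψ hs, partialDeriv_periodize (hasCompactSupport_partialDeriv hψ i)
      (contDiff_partialDeriv hs i)]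
  have hsum : ∀ i, Summable fun l : lattice a => partialDeriv i (partialDeriv i ψ) (l + x) := by
    intro i
    obtain ⟨S, h0, -⟩ := exists_finset_periodize_eq (a := a)
      (hasCompactSupport_partialDeriv (hasCompactSupport_partialDeriv hψ i) i)
      (Bornology.isBounded_singleton (x := x))
    exact summable_of_ne_finset_zero fun l hl => h0 x rfl l hl
  simp only [h]
  unfold periodize
  rw [← Summable.tsum_finsetSum fun i _ => hsum i]
  exact tsum_congr fun l => (laplacian_eq_sum_partialDeriv hs _).symm

theorem periodize_nonpos {ψ : Plane → ℝ} (h : ∀ z, ψ z ≤ 0) (x : Plane) : periodize a ψ x ≤ 0 :=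
  tsum_nonpos fun _ => h _

/-- Invariance under the whole lattice. -/
def IsInvariant {α : Type*} (a : Module.Basis (Fin 2) ℝ Plane) (F : Plane → α) : Prop :=
  ∀ (l : lattice a) (x : Plane), F (l + x) = F x

theorem isBounded_cell : Bornology.IsBounded (cell a) := ZSpan.fundamentalDomain_isBounded a

theorem measurableSet_cell : MeasurableSet (cell a) := ZSpan.fundamentalDomain_measurableSet a

instance isFiniteMeasure_restrict_cell :
    IsFiniteMeasure ((volume : Measure Plane).restrict (cell a)) :=
  ⟨by simpa using (isBounded_cell (a := a)).measure_lt_top⟩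

/-- Unfolding of the integral of a periodization. -/
theorem integral_cell_mul_periodize {F ψ : Plane → ℝ} (hF : IsInvariant a F)
    (hFi : LocallyIntegrable F) (hψ : HasCompactSupport ψ) (hc : Continuous ψ) :
    ∫ x in cell a, F x * periodize a ψ x = ∫ x, F x * ψ x := by
  have hint : Integrable fun x => F x * ψ x := by
    have := hFi.integrable_smul_right_of_hasCompactSupport hc hψ
    simpa only [smul_eq_mul] using this
  rw [(ZSpan.isAddFundamentalDomain a (volume : Measure Plane)).integral_eq_tsum'' _ hint]
  obtain ⟨S, h0, hS⟩ := exists_finset_periodize_eq (a := a) hψ isBounded_cell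
  rw [setIntegral_congr_fun measurableSet_cell
    (g := fun x => ∑ l ∈ S, F x * ψ ((l : Plane) + x))
    fun x hx => by simp only; rw [hS x hx, Finset.mul_sum]]
  have hFc : IntegrableOn F (cell a) :=
    (hFi.integrableOn_isCompact isBounded_cell.isCompact_closure).mono_set subset_closure
  obtain ⟨C, hC⟩ := hc.bounded_above_of_compact_support hψ
  rw [integral_finsetSum]
  · symm
    refine (tsum_eq_sum fun l hl => ?_).trans (Finset.sum_congr rfl fun l _ => ?_)
    · refine (setIntegral_congr_fun measurableSet_cell fun x hx => ?_).trans (integral_zero' _ _)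
      change F ((l : Plane) + x) * ψ ((l : Plane) + x) = 0
      rw [h0 x hx l hl, mul_zero]
    · refine integral_congr_ae (Filter.Eventually.of_forall fun x => ?_)
      change F ((l : Plane) + x) * ψ ((l : Plane) + x) = _
      rw [hF]
  · intro l _
    exact hFc.mul_bdd (c := C) (by fun_prop) (Filter.Eventually.of_forall fun x => hC _)

/-- The constant counts the translates of the cell that meet `B`, so it does not depend on `F`. -/
theorem exists_lintegral_le_mul {B : Set Plane} (hB : Bornology.IsBounded B)
    (hBm : MeasurableSet B) :
    ∃ n : ℕ, ∀ F : Plane → ENNReal, IsInvariant a F →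
      ∫⁻ x in B, F x ≤ n * ∫⁻ x in cell a, F x := by
  obtain ⟨S, hS⟩ := exists_finset_add_notMem a isBounded_cell hB
  refine ⟨S.card, fun F hF => ?_⟩
  rw [← lintegral_indicator hBm,
    (ZSpan.isAddFundamentalDomain a (volume : Measure Plane)).lintegral_eq_tsum'']
  rw [tsum_eq_sum (s := S) fun l hl => ?_]
  · calc _ ≤ ∑ _l ∈ S, ∫⁻ x in cell a, F x := by
          refine Finset.sum_le_sum fun l _ => lintegral_mono fun x => ?_
          change B.indicator F ((l : Plane) + x) ≤ _
          exact (indicator_le_self _ _ _).trans (hF l x).le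
      _ = _ := by rw [Finset.sum_const, nsmul_eq_mul]
  · refine (setLIntegral_congr_fun measurableSet_cell (g := 0) fun x hx => ?_).trans (by simp)
    exact indicator_of_notMem (hS x hx l hl) F

/-- The periodic extension of the restriction of a function to the period cell. -/
def perExt {α : Type*} (a : Module.Basis (Fin 2) ℝ Plane) (f : Plane → α) (x : Plane) : α :=
  f (ZSpan.fract a x)

theorem isInvariant_perExt {α : Type*} (f : Plane → α) : IsInvariant a (perExt a f) :=
  fun l x => congrArg f (ZSpan.fract_zSpan_add a x l.2)

theorem perExt_eq {α : Type*} (f : Plane → α) {x : Plane} (hx : x ∈ cell a) : perExt a f x = f x :=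
  congrArg f (ZSpan.fract_eq_self.2 hx)

theorem measurable_fract : Measurable (ZSpan.fract a) := by
  have h : ZSpan.fract a = fun x => ∑ i, Int.fract (a.repr x i) • a i := by
    ext1 x
    conv_lhs => rw [← a.sum_repr (ZSpan.fract a x)]
    simp only [ZSpan.repr_fract_apply]
  rw [h]
  refine Finset.measurable_fun_sum _ fun i _ => Measurable.smul_const (Measurable.fract ?_) _
  exact (LinearMap.continuous_of_finiteDimensional (a.coord i)).measurable

theorem measurable_perExt {f : Plane → ℝ} (hf : Measurable f) : Measurable (perExt a f) :=
  hf.comp measurable_fract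

theorem locallyIntegrable_perExt {f : Plane → ℝ} (hf : Measurable f)
    (hfi : IntegrableOn f (cell a)) : LocallyIntegrable (perExt a f) := by
  refine locallyIntegrable_iff.2 fun K hK =>
    ⟨(measurable_perExt hf).aestronglyMeasurable, ?_⟩
  obtain ⟨n, hn⟩ := exists_lintegral_le_mul (a := a) hK.isBounded hK.measurableSet
  have h := hn (fun x => ‖perExt a f x‖ₑ) fun l x => by simp only [isInvariant_perExt f l x]
  refine h.trans_lt (ENNReal.mul_lt_top (ENNReal.natCast_lt_top n) ?_)
  rw [setLIntegral_congr_fun measurableSet_cell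
    (g := fun x => ‖f x‖ₑ) fun x hx => by simp only [perExt_eq f hx]]
  exact hfi.2

end Periodic

/-! ### Pointwise estimates by the logarithmic potential -/

section Pointwise

/-- Polar coordinates. The exact factor `1 / α` matters: taken at `α = 1 / k`, it determines the
growth of the moments in `k`. -/
theorem lintegral_ball_enorm_rpow {α : ℝ} (hα : 0 < α) :
    ∫⁻ z in Metric.ball (0 : Plane) 1, ‖z‖ₑ ^ (α - 2)
      = ENNReal.ofReal (2 * volume.real (Metric.ball (0 : Plane) 1) / α) := by
  set g : ℝ → ℝ := (Iio 1).indicator fun y => y ^ (α - 2) with hg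
  have hpt : ∀ y ∈ Ioi (0 : ℝ), y ^ (Module.finrank ℝ Plane - 1) • g y
      = (Ioo (0 : ℝ) 1).indicator (fun y => y ^ (α - 1)) y := by
    intro y hy
    have hy : 0 < y := hy
    simp only [finrank_euclideanSpace, Fintype.card_fin, Nat.add_one_sub_one, pow_one, smul_eq_mul,
      hg]
    by_cases h1 : y < 1
    · rw [indicator_of_mem (show y ∈ Iio (1 : ℝ) from h1),
        indicator_of_mem (show y ∈ Ioo (0 : ℝ) 1 from ⟨hy, h1⟩),
        show α - 1 = 1 + (α - 2) by ring, Real.rpow_add hy, Real.rpow_one]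
    · rw [indicator_of_notMem (show y ∉ Iio (1 : ℝ) from h1),
        indicator_of_notMem (show y ∉ Ioo (0 : ℝ) 1 from fun h => h1 h.2), mul_zero]
  have hint1 : IntegrableOn (fun y : ℝ => y ^ (α - 1)) (Ioo 0 1) := by
    rw [intervalIntegral.integrableOn_Ioo_rpow_iff one_pos]; linarith
  have hint : Integrable (fun z : Plane => g ‖z‖) := by
    rw [integrable_fun_norm_addHaar, integrableOn_congr_fun hpt measurableSet_Ioi,
      integrableOn_indicator_iff measurableSet_Ioo,
      inter_eq_left.2 (fun y hy => hy.1)]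
    exact hint1
  have hval : ∫ z : Plane, g ‖z‖ = 2 * volume.real (Metric.ball (0 : Plane) 1) / α := by
    rw [integral_fun_norm_addHaar, setIntegral_congr_fun measurableSet_Ioi hpt,
      setIntegral_indicator measurableSet_Ioo, inter_eq_right.2 (fun y hy => hy.1),
      ← integral_Ioc_eq_integral_Ioo, ← intervalIntegral.integral_of_le zero_le_one,
      integral_rpow (Or.inl (by linarith))]
    simp only [finrank_euclideanSpace, Fintype.card_fin, sub_add_cancel, Real.one_rpow,
      Real.zero_rpow hα.ne', smul_eq_mul, nsmul_eq_mul, sub_zero]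
    push_cast; ring
  have hnn : 0 ≤ fun z : Plane => g ‖z‖ := fun z =>
    indicator_apply_nonneg fun _ => Real.rpow_nonneg (norm_nonneg z) _
  rw [← hval, ofReal_integral_eq_lintegral_ofReal hint (Filter.Eventually.of_forall hnn),
    ← lintegral_indicator Metric.isOpen_ball.measurableSet]
  refine lintegral_congr_ae ?_
  filter_upwards [compl_mem_ae_iff.2 (measure_singleton (0 : Plane))] with z hz
  have hz : 0 < ‖z‖ := norm_pos_iff.2 hz
  by_cases h1 : ‖z‖ < 1
  · rw [indicator_of_mem (mem_ball_zero_iff.2 h1), hg,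
      indicator_of_mem (show ‖z‖ ∈ Iio (1 : ℝ) from h1), ← ofReal_norm,
      ENNReal.ofReal_rpow_of_pos hz]
  · rw [indicator_of_notMem (by rwa [mem_ball_zero_iff]), hg,
      indicator_of_notMem (show ‖z‖ ∉ Iio (1 : ℝ) from h1), ENNReal.ofReal_zero]

/-- The truncated Riesz potential `∫_{|z| < 1} |z|⁻¹ G(x + z) dz`. -/
def rieszPotential (G : Plane → ENNReal) (x : Plane) : ENNReal :=
  ∫⁻ z in Metric.ball (0 : Plane) 1, ‖z‖ₑ⁻¹ * G (x + z)

theorem lintegral_enorm_inv :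
    ∫⁻ z in Metric.ball (0 : Plane) 1, ‖z‖ₑ⁻¹
      = ENNReal.ofReal (2 * volume.real (Metric.ball (0 : Plane) 1)) := by
  have := lintegral_ball_enorm_rpow one_pos
  rwa [show (1 : ℝ) - 2 = -1 by norm_num, div_one, funext fun z : Plane => ENNReal.rpow_neg_one ‖z‖ₑ]
    at this

/-- Only an inequality is claimed, since at `z = 0` the real kernel is `0` while `‖z‖ₑ⁻¹` is
infinite. -/
theorem lintegral_mul_rieszKernel_le (G : Plane → ENNReal) (x : Plane) :
    ∫⁻ y, G y * ENNReal.ofReal (rieszKernel (y - x)) ≤ rieszPotential G x := by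
  rw [← lintegral_add_left_eq_self _ x, rieszPotential,
    ← lintegral_indicator Metric.isOpen_ball.measurableSet]
  refine lintegral_mono fun z => ?_
  rw [add_sub_cancel_left, rieszKernel]
  by_cases h1 : z ∈ Metric.ball (0 : Plane) 1
  · rw [indicator_of_mem h1, indicator_of_mem h1, mul_comm]
    gcongr
    rcases eq_or_ne z 0 with rfl | hz
    · simp
    · rw [ENNReal.ofReal_inv_of_pos (norm_pos_iff.2 hz), ofReal_norm]
  · rw [indicator_of_notMem h1, indicator_of_notMem h1, ENNReal.ofReal_zero, mul_zero]

theorem exists_lintegral_mul_mollifier_le : ∃ C : ℝ, 0 < C ∧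
    ∀ (G : Plane → ENNReal) (x : Plane),
      ∫⁻ y, G y * ENNReal.ofReal (mollifier 1 (y - x)) ≤ ENNReal.ofReal C * rieszPotential G x := by
  obtain ⟨C, hC, hb⟩ := exists_mollifier_le
  refine ⟨C, hC, fun G x => ?_⟩
  rw [← lintegral_add_left_eq_self _ x, rieszPotential,
    ← lintegral_const_mul' _ _ ENNReal.ofReal_ne_top,
    -- The mollifier lives on the closed ball and the potential on the open one; the unit sphere is
    -- a null set.
    setLIntegral_congr (ae_eq_of_subset_of_measure_ge Metric.ball_subset_closedBall
      (Measure.addHaar_closedBall_eq_addHaar_ball volume (0 : Plane) 1).le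
      Metric.isOpen_ball.nullMeasurableSet (isCompact_closedBall _ _).measure_ne_top),
    ← lintegral_indicator Metric.isClosed_closedBall.measurableSet]
  refine lintegral_mono fun z => ?_
  rw [add_sub_cancel_left]
  by_cases h1 : z ∈ Metric.closedBall (0 : Plane) 1
  · rw [indicator_of_mem h1, mul_comm, ← mul_assoc]
    gcongr
    have h2 : (1 : ENNReal) ≤ ‖z‖ₑ⁻¹ := by
      rw [ENNReal.one_le_inv, ← ofReal_norm, ENNReal.ofReal_le_one]
      exact mem_closedBall_zero_iff.1 h1
    calc ENNReal.ofReal (mollifier 1 z) ≤ ENNReal.ofReal C * 1 := by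
          rw [mul_one]
          exact ENNReal.ofReal_le_ofReal (by simpa using hb 1 z)
      _ ≤ _ := by gcongr
  · rw [indicator_of_notMem h1, mollifier_of_gt one_pos (by simpa using h1), ENNReal.ofReal_zero,
      mul_zero]

variable {a : Module.Basis (Fin 2) ℝ Plane} {δ : ℝ}

theorem hasCompactSupport_truncLog (hδ : 0 < δ) (hδ1 : δ ≤ 1) : HasCompactSupport (truncLog δ) :=
  HasCompactSupport.intro (isCompact_closedBall (0 : Plane) 1) fun z hz =>
    truncLog_of_ge hδ hδ1 (by
      have : 1 < ‖z‖ := by simpa using hz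
      exact this.le)

/-- The test function `truncLog` centred at `x`. -/
def shiftedLog (δ : ℝ) (x y : Plane) : ℝ := truncLog δ (y - x)

theorem contDiff_shiftedLog (hδ : 0 < δ) (hδ1 : δ ≤ 1) (x : Plane) :
    ContDiff ℝ ∞ (shiftedLog δ x) :=
  (contDiff_truncLog hδ hδ1).comp (by fun_prop)

theorem hasCompactSupport_shiftedLog (hδ : 0 < δ) (hδ1 : δ ≤ 1) (x : Plane) :
    HasCompactSupport (shiftedLog δ x) :=
  (hasCompactSupport_truncLog hδ hδ1).comp_homeomorph (Homeomorph.subRight x)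

theorem partialDeriv_comp_sub (φ : Plane → ℝ) (i : Fin 2) (x : Plane) :
    partialDeriv i (fun y => φ (y - x)) = fun y => partialDeriv i φ (y - x) := by
  ext y
  simp only [partialDeriv]
  rw [fderiv_comp_sub]

theorem laplacian_shiftedLog (hδ : 0 < δ) (hδ1 : δ ≤ 1) (x : Plane) :
    Laplacian.laplacian (shiftedLog δ x) = fun y => mollifier δ (y - x) - mollifier 1 (y - x) := by
  ext y
  rw [← laplacian_truncLog hδ hδ1, laplacian_eq_sum_partialDeriv (contDiff_shiftedLog hδ hδ1 x),
    laplacian_eq_sum_partialDeriv (contDiff_truncLog hδ hδ1)]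
  unfold shiftedLog
  simp only [partialDeriv_comp_sub]

theorem hasCompactSupport_mollifier_sub (hδ : 0 < δ) (x : Plane) :
    HasCompactSupport fun y => mollifier δ (y - x) :=
  (hasCompactSupport_mollifier hδ).comp_homeomorph (Homeomorph.subRight x)

theorem continuous_mollifier_sub (δ : ℝ) (x : Plane) :
    Continuous fun y => mollifier δ (y - x) :=
  (continuous_mollifier δ).comp (by fun_prop)

theorem integrable_mul_of_compactSupport {F ψ : Plane → ℝ} (hF : LocallyIntegrable F)
    (hc : Continuous ψ) (hψ : HasCompactSupport ψ) : Integrable fun y => F y * ψ y := by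
  have := hF.integrable_smul_right_of_hasCompactSupport hc hψ
  simpa only [smul_eq_mul] using this

/-- Testing with the periodized kernel thus compares the mollification at scale `δ` with the one at
scale `1`. -/
theorem integral_cell_mul_laplacian {F : Plane → ℝ} (hF : IsInvariant a F)
    (hFi : LocallyIntegrable F) (hδ : 0 < δ) (hδ1 : δ ≤ 1) (x : Plane) :
    ∫ y in cell a, F y * Laplacian.laplacian (periodize a (shiftedLog δ x)) y
      = (∫ y, F y * mollifier δ (y - x)) - ∫ y, F y * mollifier 1 (y - x) := by
  rw [laplacian_periodize (hasCompactSupport_shiftedLog hδ hδ1 x) (contDiff_shiftedLog hδ hδ1 x),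
    laplacian_shiftedLog hδ hδ1,
    integral_cell_mul_periodize hF hFi
      (ψ := fun y => mollifier δ (y - x) - mollifier 1 (y - x))
      ((hasCompactSupport_mollifier_sub hδ x).sub (hasCompactSupport_mollifier_sub one_pos x))
      ((continuous_mollifier_sub δ x).sub (continuous_mollifier_sub 1 x)),
    ← integral_sub
      (integrable_mul_of_compactSupport hFi (continuous_mollifier_sub δ x)
        (hasCompactSupport_mollifier_sub hδ x))
      (integrable_mul_of_compactSupport hFi (continuous_mollifier_sub 1 x)
        (hasCompactSupport_mollifier_sub one_pos x))]
  simp only [mul_sub]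

theorem integrable_rieszKernel : Integrable rieszKernel := by
  refine ⟨((measurable_norm.inv).indicator Metric.isOpen_ball.measurableSet).aestronglyMeasurable,
    ?_⟩
  have h := lintegral_mul_rieszKernel_le (fun _ => 1) 0
  rw [rieszPotential] at h
  simp only [mul_one, one_mul, sub_zero, lintegral_enorm_inv] at h
  rw [hasFiniteIntegral_iff_ofReal (Filter.Eventually.of_forall rieszKernel_nonneg)]
  exact h.trans_lt ENNReal.ofReal_lt_top

theorem neg_integral_truncLog_le (hδ : 0 < δ) (hδ1 : δ ≤ 1) :
    -∫ z, truncLog δ z ≤ 2 * ∫ z, rieszKernel z := by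
  rw [← integral_const_mul, ← integral_neg]
  refine integral_mono_ae
    ((contDiff_truncLog hδ hδ1).continuous.integrable_of_hasCompactSupport
      (hasCompactSupport_truncLog hδ hδ1)).neg (integrable_rieszKernel.const_mul 2) ?_
  filter_upwards [compl_mem_ae_iff.2 (measure_singleton (0 : Plane))] with z hz
  exact (neg_le_abs _).trans (abs_truncLog_le hδ hδ1 hz)

theorem area_pos : 0 < area a :=
  ENNReal.toReal_pos (ZSpan.measure_fundamentalDomain_ne_zero a) isBounded_cell.measure_lt_top.ne

/-- The background function is bounded above. -/
theorem IsBackground.exists_ae_le {m : ℕ} {p : Fin m → Plane} {u : Plane → ℝ}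
    (hu : IsBackground a p u) :
    ∃ C : ℝ, ∀ᵐ x ∂(volume : Measure Plane).restrict (cell a), u x ≤ C := by
  set u' : Plane → ℝ := hu.integrable.1.mk u with hu'
  have hu'm : Measurable u' := hu.integrable.1.stronglyMeasurable_mk.measurable
  have hae : u =ᵐ[(volume : Measure Plane).restrict (cell a)] u' := hu.integrable.1.ae_eq_mk
  have hu'i : IntegrableOn u' (cell a) := hu.integrable.congr hae
  set F := perExt a u' with hF
  have hFi : LocallyIntegrable F := locallyIntegrable_perExt hu'm hu'i
  have hFae : ∀ᵐ x ∂(volume : Measure Plane).restrict (cell a), u x = F x := by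
    filter_upwards [hae, ae_restrict_mem measurableSet_cell] with x hx hxc
    rw [hx, hF, perExt_eq _ hxc]
  -- the bound for the mollified function
  have hmain : ∀ (x : Plane) (δ : ℝ), 0 < δ → δ ≤ 1 → ∫ y, F y * mollifier δ (y - x)
      ≤ (∫ y, F y * mollifier 1 (y - x))
        + 4 * Real.pi * m / area a * (2 * ∫ z, rieszKernel z) := by
    intro x δ hδ hδ1
    have heq := hu.equation _ (isTest_periodize (hasCompactSupport_shiftedLog hδ hδ1 x)
      (contDiff_shiftedLog hδ hδ1 x))
    rw [integral_congr_ae (g := fun y => F y * Laplacian.laplacian (periodize a (shiftedLog δ x)) y)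
      (by filter_upwards [hFae] with y hy; rw [hy]),
      integral_cell_mul_laplacian (isInvariant_perExt _) hFi hδ hδ1] at heq
    have h1 : ∫ y in cell a, periodize a (shiftedLog δ x) y = ∫ z, truncLog δ z := by
      have := integral_cell_mul_periodize (a := a) (F := fun _ => 1) (fun _ _ => rfl)
        (locallyIntegrable_const _) (hasCompactSupport_shiftedLog hδ hδ1 x)
        (contDiff_shiftedLog hδ hδ1 x).continuous
      simp only [one_mul] at this
      rw [this]
      exact integral_sub_right_eq_self (truncLog δ) x
    -- The kernel is nonpositive, so the point masses only lower the mollified function; the uniform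
    -- background density contributes a bounded term.
    have h2 : ∑ k, periodize a (shiftedLog δ x) (p k) ≤ 0 :=
      Finset.sum_nonpos fun k _ => periodize_nonpos (fun z => truncLog_nonpos hδ hδ1 _) _
    have h3 : 0 ≤ 4 * Real.pi * m / area a :=
      div_nonneg (by positivity) area_pos.le
    have h4 := mul_le_mul_of_nonneg_left (neg_integral_truncLog_le hδ hδ1) h3
    have h5 : 4 * Real.pi * ∑ k, periodize a (shiftedLog δ x) (p k) ≤ 0 :=
      mul_nonpos_of_nonneg_of_nonpos (by positivity) h2
    rw [h1] at heq
    linarith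
  -- a uniform bound for the mollification at scale one
  obtain ⟨R, hR⟩ := (isBounded_cell (a := a)).subset_closedBall 0
  obtain ⟨C, hC, hCb⟩ := exists_mollifier_le
  have hFB : IntegrableOn F (Metric.closedBall 0 (R + 1)) :=
    hFi.integrableOn_isCompact (isCompact_closedBall _ _)
  have hone : ∀ x ∈ cell a, ∫ y, F y * mollifier 1 (y - x)
      ≤ C * ∫ y in Metric.closedBall 0 (R + 1), |F y| := by
    intro x hx
    rw [← integral_const_mul, ← integral_indicator Metric.isClosed_closedBall.measurableSet]
    refine integral_mono (integrable_mul_of_compactSupport hFi (continuous_mollifier_sub 1 x)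
        (hasCompactSupport_mollifier_sub one_pos x))
      (IntegrableOn.integrable_indicator (hFB.abs.const_mul C)
        Metric.isClosed_closedBall.measurableSet)
      fun y => ?_
    simp only
    by_cases hy : y ∈ Metric.closedBall (0 : Plane) (R + 1)
    · rw [indicator_of_mem hy, mul_comm C]
      have h1 := hCb 1 (y - x)
      rw [one_pow, div_one] at h1
      exact (mul_le_mul_of_nonneg_right (le_abs_self _) (mollifier_nonneg _ _)).trans
        (mul_le_mul_of_nonneg_left h1 (abs_nonneg _))
    · rw [indicator_of_notMem hy, mollifier_of_gt one_pos, mul_zero]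
      have h1 : ‖x‖ ≤ R := by simpa using hR hx
      have h2 : R + 1 < ‖y‖ := by simpa using hy
      linarith [norm_sub_norm_le y x]
  have hc := integral_mollifier_pos
  refine ⟨(∫ z, mollifier 1 z)⁻¹ * (C * (∫ y in Metric.closedBall 0 (R + 1), |F y|)
        + 4 * Real.pi * m / area a * (2 * ∫ z, rieszKernel z)), ?_⟩
  filter_upwards [hFae, ae_restrict_mem measurableSet_cell,
    ae_restrict_of_ae (ae_tendsto_integral_mollifier hFi)] with x hx hxc hlim
  rw [hx, le_inv_mul_iff₀ hc]
  refine le_of_tendsto hlim (Filter.Eventually.of_forall fun k => ?_)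
  have h1 : (1 : ℝ) / (k + 1) ≤ 1 := by
    rw [div_le_one (by positivity)]; linarith [(Nat.cast_nonneg k : (0 : ℝ) ≤ k)]
  linarith [hmain x _ (by positivity) h1, hone x hxc]

end Pointwise

/-! ### Exponential integrability of Sobolev functions -/

section Riesz

theorem rieszPotential_mono {G G' : Plane → ENNReal} (h : ∀ y, G y ≤ G' y) (x : Plane) :
    rieszPotential G x ≤ rieszPotential G' x :=
  lintegral_mono fun z => by gcongr; exact h _

/-- With `α = 1 / k`, write `|z|⁻¹ G = |z|^{(α-2)/2} (|z|^{-α} G²)^{1/2}` and apply Cauchy-Schwarz.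
Then split `|z|^{-α} G² = (|z|⁻¹ G²)^α (G²)^{1-α}` and apply Hölder. The first factor integrates to
a multiple of `1 / α = k`. -/
theorem rieszPotential_pow_le {G : Plane → ENNReal} (hG : Measurable G) {k : ℕ} (hk : 1 ≤ k)
    (x : Plane) :
    rieszPotential G x ^ (2 * k)
      ≤ ENNReal.ofReal (2 * volume.real (Metric.ball (0 : Plane) 1) * k) ^ k
        * (∫⁻ z in Metric.ball (0 : Plane) 1, G (x + z) ^ 2) ^ (k - 1)
        * rieszPotential (fun y => G y ^ 2) x := by
  have hk0 : (0 : ℝ) < k := by exact_mod_cast hk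
  set α : ℝ := 1 / k with hα
  have hα0 : 0 < α := by positivity
  have hα1 : α ≤ 1 := by rw [hα, div_le_one hk0]; exact_mod_cast hk
  have hαk : α * k = 1 := by rw [hα]; field_simp
  set μ := (volume : Measure Plane).restrict (Metric.ball 0 1) with hμ
  have hGx : Measurable fun z => G (x + z) := hG.comp (measurable_const_add x)
  have hne : ∀ᵐ z ∂μ, z ≠ 0 :=
    ae_restrict_of_ae (compl_mem_ae_iff.2 (measure_singleton (0 : Plane)))
  have hmul : ∀ {p q : ℝ} {z : Plane}, z ≠ 0 → ‖z‖ₑ ^ p * ‖z‖ₑ ^ q = ‖z‖ₑ ^ (p + q) :=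
    fun hz => (ENNReal.rpow_add _ _ (enorm_ne_zero.2 hz) enorm_ne_top).symm
  -- Cauchy-Schwarz
  have h1 : rieszPotential G x ≤ (∫⁻ z, ‖z‖ₑ ^ (α - 2) ∂μ) ^ (1 / 2 : ℝ)
      * (∫⁻ z, ‖z‖ₑ ^ (-α) * G (x + z) ^ 2 ∂μ) ^ (1 / 2 : ℝ) := by
    refine le_trans (le_of_eq (lintegral_congr_ae ?_))
      (ENNReal.lintegral_mul_norm_pow_le (p := 1 / 2) (q := 1 / 2) (by fun_prop) (by fun_prop)
        (by norm_num) (by norm_num) (by norm_num))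
    filter_upwards [hne] with z hz
    rw [ENNReal.mul_rpow_of_nonneg _ _ (by norm_num : (0 : ℝ) ≤ 1 / 2), ← ENNReal.rpow_mul,
      ← ENNReal.rpow_mul, ← mul_assoc, hmul hz, ← ENNReal.rpow_natCast, ← ENNReal.rpow_mul,
      ← ENNReal.rpow_neg_one]
    congr 1
    · congr 1; ring
    · norm_num
  -- Jensen
  have h2 : ∫⁻ z, ‖z‖ₑ ^ (-α) * G (x + z) ^ 2 ∂μ
      ≤ rieszPotential (fun y => G y ^ 2) x ^ α * (∫⁻ z, G (x + z) ^ 2 ∂μ) ^ (1 - α) := by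
    refine le_trans (le_of_eq (lintegral_congr_ae ?_))
      (ENNReal.lintegral_mul_norm_pow_le (p := α) (q := 1 - α) (by fun_prop) (by fun_prop)
        hα0.le (by linarith) (by ring))
    refine Filter.Eventually.of_forall fun z => ?_
    simp only
    rw [ENNReal.mul_rpow_of_nonneg _ _ hα0.le, mul_assoc,
      ← ENNReal.rpow_add_of_nonneg _ _ hα0.le (by linarith), add_sub_cancel, ENNReal.rpow_one,
      ← ENNReal.rpow_neg_one, ← ENNReal.rpow_mul, neg_one_mul]
  have h3 : (∫⁻ z, ‖z‖ₑ ^ (-α) * G (x + z) ^ 2 ∂μ) ^ k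
      ≤ rieszPotential (fun y => G y ^ 2) x * (∫⁻ z, G (x + z) ^ 2 ∂μ) ^ (k - 1) := by
    refine (pow_le_pow_left' h2 k).trans (le_of_eq ?_)
    rw [mul_pow, ← ENNReal.rpow_natCast, ← ENNReal.rpow_natCast, ← ENNReal.rpow_mul,
      ← ENNReal.rpow_mul, hαk, ENNReal.rpow_one, ← ENNReal.rpow_natCast _ (k - 1)]
    congr 2
    rw [sub_mul, hαk, one_mul, Nat.cast_sub hk, Nat.cast_one]
  have h4 : ∫⁻ z, ‖z‖ₑ ^ (α - 2) ∂μ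
      = ENNReal.ofReal (2 * volume.real (Metric.ball (0 : Plane) 1) * k) := by
    rw [hμ, lintegral_ball_enorm_rpow hα0, hα]
    congr 1
    field_simp
  have h5 : rieszPotential G x ^ (2 * k) ≤ (∫⁻ z, ‖z‖ₑ ^ (α - 2) ∂μ) ^ k
      * (∫⁻ z, ‖z‖ₑ ^ (-α) * G (x + z) ^ 2 ∂μ) ^ k := by
    rw [pow_mul, ← mul_pow]
    refine pow_le_pow_left' ((pow_le_pow_left' h1 2).trans (le_of_eq ?_)) k
    rw [mul_pow, ← ENNReal.rpow_natCast, ← ENNReal.rpow_natCast, ← ENNReal.rpow_mul,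
      ← ENNReal.rpow_mul]
    norm_num
  rw [h4] at h5
  refine h5.trans ((mul_le_mul_right h3 _).trans (le_of_eq ?_))
  ring

variable {a : Module.Basis (Fin 2) ℝ Plane}

theorem measurable_rieszPotential {G : Plane → ENNReal} (hG : Measurable G) :
    Measurable (rieszPotential G) := by
  unfold rieszPotential
  refine Measurable.lintegral_prod_right' (f := fun p : Plane × Plane => ‖p.2‖ₑ⁻¹ * G (p.1 + p.2)) ?_
  fun_prop

/-- Moments of the Riesz potential of a periodic function. -/
theorem exists_lintegral_rieszPotential_pow_le : ∃ n : ℕ, ∀ G : Plane → ENNReal, Measurable G →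
    IsInvariant a G → ∀ k : ℕ, 1 ≤ k →
      ∫⁻ x in cell a, rieszPotential G x ^ (2 * k)
        ≤ (ENNReal.ofReal (2 * volume.real (Metric.ball (0 : Plane) 1) * k)
            * (n * ∫⁻ x in cell a, G x ^ 2)) ^ k
          * ENNReal.ofReal (2 * volume.real (Metric.ball (0 : Plane) 1)) := by
  obtain ⟨R, hR⟩ := (isBounded_cell (a := a)).subset_closedBall 0
  obtain ⟨n, hn⟩ := exists_lintegral_le_mul (a := a)
    (Metric.isBounded_closedBall (x := (0 : Plane)) (r := R + 1))
    Metric.isClosed_closedBall.measurableSet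
  refine ⟨n, fun G hG hinv k hk => ?_⟩
  have hinv2 : IsInvariant a fun x => G x ^ 2 := fun l x => by simp only [hinv l x]
  have hG2 : Measurable fun x => G x ^ 2 := hG.pow_const 2
  set m := n * ∫⁻ x in cell a, G x ^ 2 with hm
  have hB : ∫⁻ y in Metric.closedBall (0 : Plane) (R + 1), G y ^ 2 ≤ m := hn _ hinv2
  have hmem : ∀ x ∈ cell a, ∀ z ∈ Metric.ball (0 : Plane) 1,
      x + z ∈ Metric.closedBall (0 : Plane) (R + 1) := by
    intro x hx z hz
    have h1 : ‖x‖ ≤ R := by simpa using hR hx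
    have h2 : ‖z‖ < 1 := by simpa using hz
    rw [mem_closedBall_zero_iff]
    linarith [norm_add_le x z]
  have hball : ∀ x ∈ cell a, ∫⁻ z in Metric.ball (0 : Plane) 1, G (x + z) ^ 2 ≤ m := by
    intro x hx
    refine le_trans ?_ hB
    rw [← lintegral_indicator Metric.isOpen_ball.measurableSet,
      ← lintegral_indicator Metric.isClosed_closedBall.measurableSet,
      ← lintegral_add_left_eq_self (fun y => (Metric.closedBall (0 : Plane) (R + 1)).indicator _ y) x]
    refine lintegral_mono fun z => ?_
    by_cases hz : z ∈ Metric.ball (0 : Plane) 1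
    · rw [indicator_of_mem hz, indicator_of_mem (hmem x hx z hz)]
    · rw [indicator_of_notMem hz]; exact zero_le
  have hcell : ∀ z ∈ Metric.ball (0 : Plane) 1, ∫⁻ x in cell a, G (x + z) ^ 2 ≤ m := by
    intro z hz
    refine le_trans ?_ hB
    rw [← lintegral_indicator measurableSet_cell,
      ← lintegral_indicator Metric.isClosed_closedBall.measurableSet,
      ← lintegral_add_right_eq_self
        (fun y => (Metric.closedBall (0 : Plane) (R + 1)).indicator _ y) z]
    refine lintegral_mono fun x => ?_
    by_cases hx : x ∈ cell a
    · rw [indicator_of_mem hx, indicator_of_mem (hmem x hx z hz)]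
    · rw [indicator_of_notMem hx]; exact zero_le
  -- By Tonelli the kernel is integrated last, against translates of the cell that all stay in one
  -- bounded set.
  have hP : ∫⁻ x in cell a, rieszPotential (fun y => G y ^ 2) x
      ≤ m * ENNReal.ofReal (2 * volume.real (Metric.ball (0 : Plane) 1)) := by
    unfold rieszPotential
    rw [lintegral_lintegral_swap (by fun_prop), ← lintegral_enorm_inv,
      ← lintegral_const_mul _ (by fun_prop)]
    refine setLIntegral_mono (by fun_prop) fun z hz => ?_
    rw [lintegral_const_mul _ (by fun_prop), mul_comm]
    gcongr
    exact hcell z hz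
  calc ∫⁻ x in cell a, rieszPotential G x ^ (2 * k)
      ≤ ∫⁻ x in cell a, ENNReal.ofReal (2 * volume.real (Metric.ball (0 : Plane) 1) * k) ^ k
          * m ^ (k - 1) * rieszPotential (fun y => G y ^ 2) x := by
        refine setLIntegral_mono ((measurable_rieszPotential hG2).const_mul _) fun x hx => ?_
        refine (rieszPotential_pow_le hG hk x).trans ?_
        gcongr
        exact hball x hx
    _ ≤ ENNReal.ofReal (2 * volume.real (Metric.ball (0 : Plane) 1) * k) ^ k * m ^ (k - 1)
          * (m * ENNReal.ofReal (2 * volume.real (Metric.ball (0 : Plane) 1))) := by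
        rw [lintegral_const_mul _ (measurable_rieszPotential hG2)]
        gcongr
    _ = _ := by
        obtain ⟨j, rfl⟩ := Nat.exists_eq_add_of_le' hk
        clear_value m
        rw [mul_pow, Nat.add_sub_cancel, pow_succ m j]
        ring

end Riesz

/-! ### Pointwise control of a Sobolev function by the Riesz potential of itself and its gradient.
-/

section Sobolev

variable {a : Module.Basis (Fin 2) ℝ Plane}

/-- The weak partial derivatives of an element of `Ẇ^{1,2}(Ω)`. -/
def weakDeriv (w : zeroMeanSobolev a) (i : Fin 2) : L2 a :=
  (w : WithLp 2 (L2 a × PiLp 2 (fun _ : Fin 2 => L2 a))).snd i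

theorem measurable_coe_L2 (f : L2 a) : Measurable f := (Lp.stronglyMeasurable f).measurable

theorem integrableOn_coe_L2 (f : L2 a) : IntegrableOn f (cell a) :=
  (Lp.memLp f).integrable one_le_two

theorem measurable_value (w : zeroMeanSobolev a) : Measurable (value w) := measurable_coe_L2 _

/-- The periodic extension of `|w| + |∂₁w| + |∂₂w|`. -/
def sobolevDensity (w : zeroMeanSobolev a) (x : Plane) : ENNReal :=
  ‖perExt a (value w) x‖ₑ + ∑ i, ‖perExt a (weakDeriv w i) x‖ₑ

theorem measurable_sobolevDensity (w : zeroMeanSobolev a) : Measurable (sobolevDensity w) := by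
  have h1 := measurable_perExt (a := a) (measurable_value w)
  have h2 := fun i => measurable_perExt (a := a) (measurable_coe_L2 (weakDeriv w i))
  unfold sobolevDensity
  fun_prop

theorem isInvariant_sobolevDensity (w : zeroMeanSobolev a) : IsInvariant a (sobolevDensity w) :=
  fun l x => by simp only [sobolevDensity, isInvariant_perExt _ l x]

/-- Green's representation formula in mollified form: the weak derivative identity is tested with
each `∂ᵢ` of the periodized kernel, and the sum of the left-hand sides is the integral against the
Laplacian. -/
theorem integral_mul_mollifier_eq (w : zeroMeanSobolev a) {δ : ℝ} (hδ : 0 < δ) (hδ1 : δ ≤ 1)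
    (x : Plane) :
    ∫ y, perExt a (value w) y * mollifier δ (y - x)
      = (∫ y, perExt a (value w) y * mollifier 1 (y - x))
        - ∑ i, ∫ y, perExt a (weakDeriv w i) y * partialDeriv i (truncLog δ) (y - x) := by
  set ψ := shiftedLog δ x with hψ
  have hψc : HasCompactSupport ψ := hasCompactSupport_shiftedLog hδ hδ1 x
  have hψs : ContDiff ℝ ∞ ψ := contDiff_shiftedLog hδ hδ1 x
  have htest := fun i => isTest_periodize (a := a) (hasCompactSupport_partialDeriv hψc i)
    (contDiff_partialDeriv hψs i)
  have hweak : ∀ i, ∫ y in cell a, value w y * partialDeriv i (partialDeriv i (periodize a ψ)) y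
      = -∫ y, perExt a (weakDeriv w i) y * partialDeriv i (truncLog δ) (y - x) := by
    intro i
    have h1 := w.2.1 i _ (htest i)
    rw [partialDeriv_periodize hψc hψs]
    refine h1.trans (congrArg Neg.neg ?_)
    have h2 := integral_cell_mul_periodize (a := a) (isInvariant_perExt (weakDeriv w i))
      (locallyIntegrable_perExt (measurable_coe_L2 _) (integrableOn_coe_L2 _))
      (hasCompactSupport_partialDeriv hψc i) (contDiff_partialDeriv hψs i).continuous
    rw [show partialDeriv i ψ = fun y => partialDeriv i (truncLog δ) (y - x) from
      partialDeriv_comp_sub _ i x] at h2 ⊢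
    rw [← h2]
    exact setIntegral_congr_fun measurableSet_cell fun y hy => by
      simp only [perExt_eq _ hy]; rfl
  have hlap := integral_cell_mul_laplacian (a := a) (isInvariant_perExt (value w))
    (locallyIntegrable_perExt (measurable_value w) (integrableOn_coe_L2 _)) hδ hδ1 x
  have hsum : ∫ y in cell a, perExt a (value w) y * Laplacian.laplacian (periodize a ψ) y
      = ∑ i, ∫ y in cell a, value w y * partialDeriv i (partialDeriv i (periodize a ψ)) y := by
    rw [← integral_finsetSum]
    · refine setIntegral_congr_fun measurableSet_cell fun y hy => ?_
      rw [laplacian_eq_sum_partialDeriv (contDiff_periodize hψc hψs), perExt_eq _ hy,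
        Finset.mul_sum]
    · intro i _
      refine integrable_mul_of_continuous a _ ?_
      rw [partialDeriv_periodize hψc hψs]
      exact continuous_partialDeriv (htest i) i
  rw [hsum] at hlap
  simp only [hweak, Finset.sum_neg_distrib] at hlap
  linarith

/-- The gradient of the truncated logarithm is bounded by `2 * rieszKernel` uniformly in `δ`, so the
representation formula survives the limit `δ → 0` at almost every point. -/
theorem exists_ae_enorm_le_rieszPotential : ∃ A : ENNReal, A ≠ ⊤ ∧ ∀ w : zeroMeanSobolev a,
    ∀ᵐ x, ‖perExt a (value w) x‖ₑ ≤ A * rieszPotential (sobolevDensity w) x := by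
  obtain ⟨C, hC, hCb⟩ := exists_lintegral_mul_mollifier_le
  have hc := integral_mollifier_pos
  set c₀ := ∫ z, mollifier 1 z with hc₀
  -- Here `C` bounds the mollifier at scale one, `4` comes from two partial derivatives bounded by
  -- `2` each, and `c₀` is the mass of the mollifier.
  refine ⟨(ENNReal.ofReal c₀)⁻¹ * (ENNReal.ofReal C + 4), ?_, fun w => ?_⟩
  · exact ENNReal.mul_ne_top (ENNReal.inv_ne_top.2 (ENNReal.ofReal_pos.2 hc).ne')
      (ENNReal.add_ne_top.2 ⟨ENNReal.ofReal_ne_top, by norm_num⟩)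
  have hloc : LocallyIntegrable (perExt a (value w)) :=
    locallyIntegrable_perExt (measurable_value w) (integrableOn_coe_L2 _)
  have hbound : ∀ (x : Plane) (δ : ℝ), 0 < δ → δ ≤ 1 →
      ‖∫ y, perExt a (value w) y * mollifier δ (y - x)‖ₑ
        ≤ (ENNReal.ofReal C + 4) * rieszPotential (sobolevDensity w) x := by
    intro x δ hδ hδ1
    rw [integral_mul_mollifier_eq w hδ hδ1]
    refine (enorm_sub_le).trans ?_
    rw [add_mul]
    refine add_le_add ?_ ?_
    · refine (enorm_integral_le_lintegral_enorm _).trans ?_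
      refine le_trans ?_ ((hCb (fun y => ‖perExt a (value w) y‖ₑ) x).trans ?_)
      · refine lintegral_mono fun y => ?_
        rw [enorm_mul, Real.enorm_of_nonneg (mollifier_nonneg _ _)]
      · gcongr
        exact rieszPotential_mono (fun y => le_self_add) x
    · refine (enorm_sum_le _ _).trans ?_
      have hi : ∀ i : Fin 2,
          ‖∫ y, perExt a (weakDeriv w i) y * partialDeriv i (truncLog δ) (y - x)‖ₑ
            ≤ 2 * rieszPotential (sobolevDensity w) x := by
        intro i
        refine (enorm_integral_le_lintegral_enorm _).trans ?_
        have h1 : rieszPotential (fun y => ‖perExt a (weakDeriv w i) y‖ₑ) x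
            ≤ rieszPotential (sobolevDensity w) x :=
          rieszPotential_mono (fun y => (Finset.single_le_sum
            (f := fun i => ‖perExt a (weakDeriv w i) y‖ₑ) (fun _ _ => zero_le)
            (Finset.mem_univ i)).trans le_add_self) x
        refine le_trans ?_ (mul_le_mul_right ((lintegral_mul_rieszKernel_le _ x).trans h1) 2)
        rw [← lintegral_const_mul' _ _ (by norm_num)]
        refine lintegral_mono fun y => ?_
        rw [enorm_mul, mul_left_comm]
        gcongr
        rw [Real.enorm_eq_ofReal_abs]
        refine (ENNReal.ofReal_le_ofReal (abs_partialDeriv_truncLog_le hδ hδ1 i _)).trans ?_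
        rw [ENNReal.ofReal_mul zero_le_two, ENNReal.ofReal_ofNat]
      refine (Finset.sum_le_sum fun i _ => hi i).trans (le_of_eq ?_)
      rw [Fin.sum_univ_two, ← add_mul]
      norm_num
  filter_upwards [ae_tendsto_integral_mollifier hloc] with x hlim
  have hlim' := (continuous_enorm.tendsto _).comp hlim
  have hle : ‖c₀ * perExt a (value w) x‖ₑ
      ≤ (ENNReal.ofReal C + 4) * rieszPotential (sobolevDensity w) x := by
    refine le_of_tendsto hlim' (Filter.Eventually.of_forall fun k => ?_)
    refine hbound x _ (by positivity) ?_
    rw [div_le_one (by positivity)]; linarith [(Nat.cast_nonneg k : (0 : ℝ) ≤ k)]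
  rw [enorm_mul, Real.enorm_of_nonneg hc.le] at hle
  calc ‖perExt a (value w) x‖ₑ
      = (ENNReal.ofReal c₀)⁻¹ * (ENNReal.ofReal c₀ * ‖perExt a (value w) x‖ₑ) := by
        rw [← mul_assoc, ENNReal.inv_mul_cancel (ENNReal.ofReal_pos.2 hc).ne'
          ENNReal.ofReal_ne_top, one_mul]
    _ ≤ (ENNReal.ofReal c₀)⁻¹ * ((ENNReal.ofReal C + 4) * rieszPotential (sobolevDensity w) x) := by
        gcongr
    _ = _ := by rw [mul_assoc]

end Sobolev

/-! ### Moment bounds and the Trudinger inequality. -/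

section Trudinger

variable {a : Module.Basis (Fin 2) ℝ Plane}

theorem lintegral_enorm_sq_L2 (f : L2 a) :
    ∫⁻ x in cell a, ‖f x‖ₑ ^ 2 = ENNReal.ofReal (‖f‖ ^ 2) := by
  have h := Lp.norm_def f
  rw [eLpNorm_eq_lintegral_rpow_enorm_toReal (by norm_num) (by norm_num)] at h
  have hfin : (∫⁻ x in cell a, ‖f x‖ₑ ^ (2 : ℝ)) ≠ ⊤ := by
    have := lintegral_rpow_enorm_lt_top_of_eLpNorm_lt_top (by norm_num) (by norm_num)
      (Lp.memLp f).2
    simpa using this.ne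
  simp only [ENNReal.toReal_ofNat] at h
  have h2 : ∀ x, ‖f x‖ₑ ^ (2 : ℝ) = ‖f x‖ₑ ^ 2 := fun x => by
    rw [← ENNReal.rpow_natCast]; norm_num
  simp only [h2] at h hfin
  rw [h, ← ENNReal.toReal_pow, ENNReal.ofReal_toReal (by
    exact ENNReal.pow_ne_top (ENNReal.rpow_ne_top_of_nonneg (by norm_num) hfin)),
    ← ENNReal.rpow_natCast, ← ENNReal.rpow_mul]
  norm_num

theorem norm_fst_le (w : zeroMeanSobolev a) :
    ‖(w : WithLp 2 (L2 a × PiLp 2 (fun _ : Fin 2 => L2 a))).fst‖ ≤ ‖w‖ := by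
  have h := WithLp.prod_norm_sq_eq_of_L2
    (w : WithLp 2 (L2 a × PiLp 2 (fun _ : Fin 2 => L2 a)))
  refine abs_le_of_sq_le_sq' ?_ (norm_nonneg w) |>.2
  rw [Submodule.norm_coe] at h
  rw [h]
  exact le_add_of_nonneg_right (by positivity)

theorem norm_weakDeriv_le (w : zeroMeanSobolev a) (i : Fin 2) : ‖weakDeriv w i‖ ≤ ‖w‖ := by
  have h := WithLp.prod_norm_sq_eq_of_L2
    (w : WithLp 2 (L2 a × PiLp 2 (fun _ : Fin 2 => L2 a)))
  refine (PiLp.norm_apply_le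
    (w : WithLp 2 (L2 a × PiLp 2 (fun _ : Fin 2 => L2 a))).snd i).trans ?_
  refine abs_le_of_sq_le_sq' ?_ (norm_nonneg w) |>.2
  rw [Submodule.norm_coe] at h
  rw [h]
  exact le_add_of_nonneg_left (by positivity)

theorem add_three_sq_le (p q s : ENNReal) :
    (p + (q + s)) ^ 2 ≤ 9 * (p ^ 2 + (q ^ 2 + s ^ 2)) := by
  have h1 : p + (q + s) ≤ 3 * max p (max q s) := by
    calc p + (q + s) ≤ max p (max q s) + (max p (max q s) + max p (max q s)) := by
          gcongr
          · exact le_max_left _ _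
          · exact (le_max_left _ _).trans (le_max_right _ _)
          · exact (le_max_right _ _).trans (le_max_right _ _)
      _ = 3 * max p (max q s) := by ring
  have h2 : max p (max q s) ^ 2 ≤ p ^ 2 + (q ^ 2 + s ^ 2) := by
    rcases max_choice p (max q s) with h | h
    · rw [h]; exact le_self_add
    · rw [h]
      rcases max_choice q s with h' | h'
      · rw [h']; exact le_self_add.trans le_add_self
      · rw [h']; exact le_add_self.trans le_add_self
  calc (p + (q + s)) ^ 2 ≤ (3 * max p (max q s)) ^ 2 := by gcongr
    _ = 9 * max p (max q s) ^ 2 := by ring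
    _ ≤ _ := by gcongr

theorem lintegral_sobolevDensity_sq_le (w : zeroMeanSobolev a) :
    ∫⁻ x in cell a, sobolevDensity w x ^ 2 ≤ ENNReal.ofReal (27 * ‖w‖ ^ 2) := by
  have hle : ∀ f : L2 a, ‖f‖ ≤ ‖w‖ → ∫⁻ x in cell a, ‖f x‖ₑ ^ 2 ≤ ENNReal.ofReal (‖w‖ ^ 2) := by
    intro f hf
    rw [lintegral_enorm_sq_L2]
    gcongr
  have hm : ∀ f : L2 a, Measurable fun x => ‖f x‖ₑ ^ 2 := fun f =>
    (measurable_coe_L2 f).enorm.pow_const 2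
  calc ∫⁻ x in cell a, sobolevDensity w x ^ 2
      ≤ ∫⁻ x in cell a, 9 * (‖value w x‖ₑ ^ 2
          + (‖weakDeriv w 0 x‖ₑ ^ 2 + ‖weakDeriv w 1 x‖ₑ ^ 2)) := by
        refine lintegral_mono_ae ?_
        filter_upwards [ae_restrict_mem measurableSet_cell] with x hx
        rw [sobolevDensity, Fin.sum_univ_two, perExt_eq _ hx, perExt_eq _ hx, perExt_eq _ hx]
        exact add_three_sq_le _ _ _
    _ = 9 * ((∫⁻ x in cell a, ‖value w x‖ₑ ^ 2)
          + ((∫⁻ x in cell a, ‖weakDeriv w 0 x‖ₑ ^ 2)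
            + ∫⁻ x in cell a, ‖weakDeriv w 1 x‖ₑ ^ 2)) := by
        rw [lintegral_const_mul' _ _ (by norm_num),
          lintegral_add_left ((measurable_value w).enorm.pow_const 2),
          lintegral_add_left (hm _)]
    _ ≤ 9 * (ENNReal.ofReal (‖w‖ ^ 2) + (ENNReal.ofReal (‖w‖ ^ 2) + ENNReal.ofReal (‖w‖ ^ 2))) := by
        gcongr
        · exact hle _ (norm_fst_le w)
        · exact hle _ (norm_weakDeriv_le w 0)
        · exact hle _ (norm_weakDeriv_le w 1)
    _ = ENNReal.ofReal (27 * ‖w‖ ^ 2) := by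
        rw [ENNReal.ofReal_mul (by norm_num), ENNReal.ofReal_ofNat]
        ring

/-- The moments of a Sobolev function grow at most like `√q`. -/
theorem exists_lintegral_value_pow_le : ∃ C D : ℝ, 0 ≤ C ∧ 0 ≤ D ∧
    ∀ (w : zeroMeanSobolev a) (k : ℕ),
      ∫⁻ x in cell a, ‖value w x‖ₑ ^ (2 * k) ≤ ENNReal.ofReal (C * (D * k * ‖w‖ ^ 2) ^ k) := by
  obtain ⟨A, hA, hAb⟩ := exists_ae_enorm_le_rieszPotential (a := a)
  obtain ⟨n, hn⟩ := exists_lintegral_rieszPotential_pow_le (a := a)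
  set V : ℝ := 2 * volume.real (Metric.ball (0 : Plane) 1) with hV
  have hV0 : 0 ≤ V := by positivity
  have ha : 0 ≤ area a := area_pos.le
  -- The summand `area a` serves `k = 0`, and `V` serves `k ≥ 1`.
  refine ⟨area a + V, A.toReal ^ 2 * (V * (n * 27)), by positivity, by positivity, fun w k => ?_⟩
  rcases Nat.eq_zero_or_pos k with rfl | hk
  · simp only [mul_zero, pow_zero, lintegral_const, one_mul, Measure.restrict_apply_univ, mul_one]
    rw [← ENNReal.ofReal_toReal (isBounded_cell (a := a)).measure_lt_top.ne]
    exact ENNReal.ofReal_le_ofReal (le_add_of_nonneg_right hV0)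
  · calc ∫⁻ x in cell a, ‖value w x‖ₑ ^ (2 * k)
        ≤ ∫⁻ x in cell a, A ^ (2 * k) * rieszPotential (sobolevDensity w) x ^ (2 * k) := by
          refine lintegral_mono_ae ?_
          filter_upwards [ae_restrict_mem measurableSet_cell, ae_restrict_of_ae (hAb w)] with x hx h
          rw [perExt_eq _ hx] at h
          rw [← mul_pow]
          gcongr
      _ ≤ A ^ (2 * k) * ((ENNReal.ofReal (V * k) * (n * ENNReal.ofReal (27 * ‖w‖ ^ 2))) ^ k
            * ENNReal.ofReal V) := by
          rw [lintegral_const_mul' _ _ (ENNReal.pow_ne_top hA)]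
          gcongr
          refine (hn _ (measurable_sobolevDensity w) (isInvariant_sobolevDensity w) k hk).trans ?_
          gcongr
          exact lintegral_sobolevDensity_sq_le w
      _ = ENNReal.ofReal (V * (A.toReal ^ 2 * (V * (n * 27)) * k * ‖w‖ ^ 2) ^ k) := by
          rw [← ENNReal.ofReal_toReal hA, ← ENNReal.ofReal_natCast n,
            ← ENNReal.ofReal_mul (by positivity), ← ENNReal.ofReal_mul (by positivity),
            ← ENNReal.ofReal_pow (by positivity), ← ENNReal.ofReal_pow (by positivity),
            ← ENNReal.ofReal_mul (by positivity), ← ENNReal.ofReal_mul (by positivity),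
            ENNReal.toReal_ofReal (by positivity)]
          congr 1
          rw [pow_mul]
          simp only [mul_pow]
          ring
      _ ≤ _ := by
          gcongr
          linarith

/-- From `k! (k + 1)^k ≤ (2k)!`. It turns the moment bounds, which grow like `k^k`, into an
exponential series. -/
theorem pow_self_div_factorial_le (k : ℕ) :
    (k : ℝ) ^ k / (2 * k).factorial ≤ 1 / k.factorial := by
  rw [div_le_div_iff₀ (by positivity) (by positivity), one_mul]
  have h := Nat.factorial_mul_pow_le_factorial (m := k) (n := k)
  rw [← two_mul] at h
  have h2 : k ^ k * k.factorial ≤ (2 * k).factorial :=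
    le_trans (by rw [mul_comm]; gcongr; exact Nat.le_succ k) h
  exact_mod_cast h2

/-- A Trudinger inequality. -/
theorem exists_lintegral_exp_abs_le : ∃ C D : ℝ, 0 ≤ C ∧ 0 ≤ D ∧ ∀ w : zeroMeanSobolev a,
    ∫⁻ x in cell a, ENNReal.ofReal (Real.exp |value w x|)
      ≤ ENNReal.ofReal (C * Real.exp (D * ‖w‖ ^ 2)) := by
  obtain ⟨C, D, hC, hD, h⟩ := exists_lintegral_value_pow_le (a := a)
  refine ⟨2 * C, D, by positivity, hD, fun w => ?_⟩
  -- Bounding `e^{|t|}` by `2 cosh t` leaves only even powers, for which moment bounds are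
  -- available.
  have hcosh : ∀ t : ℝ, ENNReal.ofReal (Real.exp |t|)
      ≤ ∑' k : ℕ, ENNReal.ofReal (2 / (2 * k).factorial) * ‖t‖ₑ ^ (2 * k) := by
    intro t
    have hs := (Real.hasSum_cosh t).mul_left 2
    have hnn : ∀ k : ℕ, 0 ≤ 2 * (t ^ (2 * k) / ((2 * k).factorial : ℝ)) := fun k =>
      mul_nonneg zero_le_two (div_nonneg (by rw [pow_mul]; positivity) (by positivity))
    have hterm : ∀ k : ℕ, ENNReal.ofReal (2 / (2 * k).factorial) * ‖t‖ₑ ^ (2 * k)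
        = ENNReal.ofReal (2 * (t ^ (2 * k) / ((2 * k).factorial : ℝ))) := by
      intro k
      rw [Real.enorm_eq_ofReal_abs, ← ENNReal.ofReal_pow (abs_nonneg t),
        ← ENNReal.ofReal_mul (by positivity)]
      congr 1
      rw [(even_two_mul k).pow_abs]
      ring
    simp only [hterm]
    rw [← ENNReal.ofReal_tsum_of_nonneg hnn hs.summable, hs.tsum_eq]
    refine ENNReal.ofReal_le_ofReal ?_
    rw [← Real.cosh_abs, Real.cosh_eq]
    linarith [Real.exp_pos (-|t|)]
  calc ∫⁻ x in cell a, ENNReal.ofReal (Real.exp |value w x|)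
      ≤ ∫⁻ x in cell a, ∑' k : ℕ, ENNReal.ofReal (2 / (2 * k).factorial)
          * ‖value w x‖ₑ ^ (2 * k) := lintegral_mono fun x => hcosh _
    _ = ∑' k : ℕ, ENNReal.ofReal (2 / (2 * k).factorial)
          * ∫⁻ x in cell a, ‖value w x‖ₑ ^ (2 * k) := by
        have hm : ∀ k : ℕ, Measurable fun x => ‖value w x‖ₑ ^ (2 * k) := fun k =>
          (measurable_value w).enorm.pow_const _
        rw [lintegral_tsum fun k => ((hm k).const_mul _).aemeasurable]
        exact tsum_congr fun k => lintegral_const_mul _ (hm k)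
    _ ≤ ∑' k : ℕ, ENNReal.ofReal (2 * C * ((D * ‖w‖ ^ 2) ^ k / k.factorial)) := by
        refine ENNReal.tsum_le_tsum fun k => ?_
        refine (mul_le_mul_right (h w k) _).trans ?_
        rw [← ENNReal.ofReal_mul (by positivity)]
        refine ENNReal.ofReal_le_ofReal ?_
        have h1 := mul_le_mul_of_nonneg_left (pow_self_div_factorial_le k)
          (by positivity : 0 ≤ 2 * C * (D * ‖w‖ ^ 2) ^ k)
        calc 2 / ((2 * k).factorial : ℝ) * (C * (D * k * ‖w‖ ^ 2) ^ k)
            = 2 * C * (D * ‖w‖ ^ 2) ^ k * ((k : ℝ) ^ k / (2 * k).factorial) := by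
              simp only [mul_pow]; ring
          _ ≤ _ := h1
          _ = _ := by ring
    _ = ENNReal.ofReal (2 * C * Real.exp (D * ‖w‖ ^ 2)) := by
        have hs : HasSum (fun k : ℕ => (D * ‖w‖ ^ 2) ^ k / (k.factorial : ℝ))
            (Real.exp (D * ‖w‖ ^ 2)) := by
          rw [Real.exp_eq_exp_ℝ]
          exact NormedSpace.expSeries_div_hasSum_exp (D * ‖w‖ ^ 2)
        have hs' := hs.mul_left (2 * C)
        rw [← ENNReal.ofReal_tsum_of_nonneg (fun k => by positivity) hs'.summable, hs'.tsum_eq]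

end Trudinger

/-! ### Smoothness of the exponential functionals -/

section Analytic

variable {a : Module.Basis (Fin 2) ℝ Plane}

theorem value_add (v w : zeroMeanSobolev a) :
    ∀ᵐ x ∂(volume : Measure Plane).restrict (cell a), value (v + w) x = value v x + value w x :=
  Lp.coeFn_add _ _

theorem value_smul (c : ℝ) (w : zeroMeanSobolev a) :
    ∀ᵐ x ∂(volume : Measure Plane).restrict (cell a), value (c • w) x = c * value w x :=
  Lp.coeFn_smul _ _

/-- Combine `x^k / k! ≤ e^x` with the Trudinger inequality for `w` rescaled to norm `M`. Keeping `M`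
free is what later gives an infinite radius of convergence. -/
theorem exists_lintegral_value_pow_le_factorial : ∃ C D : ℝ, 0 ≤ C ∧ 0 ≤ D ∧
    ∀ (w : zeroMeanSobolev a) (k : ℕ) (M : ℝ), 0 < M →
      ∫⁻ x in cell a, ‖value w x‖ₑ ^ k
        ≤ ENNReal.ofReal (k.factorial * (C * Real.exp (D * M ^ 2)) / M ^ k * ‖w‖ ^ k) := by
  obtain ⟨C, D, hC, hD, h⟩ := exists_lintegral_exp_abs_le (a := a)
  refine ⟨C, D, hC, hD, fun w k M hM => ?_⟩
  have hexp : ∀ v : zeroMeanSobolev a, ∫⁻ x in cell a, ‖value v x‖ₑ ^ k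
      ≤ ENNReal.ofReal (k.factorial * (C * Real.exp (D * ‖v‖ ^ 2))) := by
    intro v
    rw [ENNReal.ofReal_mul (by positivity)]
    refine le_trans ?_ (mul_le_mul_right (h v) _)
    rw [← lintegral_const_mul' _ _ ENNReal.ofReal_ne_top]
    refine lintegral_mono fun x => ?_
    rw [← ENNReal.ofReal_mul (by positivity), Real.enorm_eq_ofReal_abs,
      ← ENNReal.ofReal_pow (abs_nonneg _)]
    refine ENNReal.ofReal_le_ofReal ?_
    have := Real.pow_div_factorial_le_exp |value v x| (abs_nonneg _) k
    rwa [div_le_iff₀' (by positivity)] at this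
  rcases eq_or_ne w 0 with rfl | hw
  · rcases Nat.eq_zero_or_pos k with rfl | hk
    · have h0 := hexp 0
      rw [norm_zero] at h0 ⊢
      simp only [pow_zero] at h0 ⊢
      refine h0.trans (ENNReal.ofReal_le_ofReal ?_)
      rw [div_one, mul_one]
      gcongr
    · have h0 : ∀ᵐ x ∂(volume : Measure Plane).restrict (cell a),
          ‖value (0 : zeroMeanSobolev a) x‖ₑ ^ k = 0 := by
        filter_upwards [value_smul 0 (0 : zeroMeanSobolev a)] with x hx
        rw [zero_smul, zero_mul] at hx
        rw [hx, enorm_zero, zero_pow hk.ne']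
      rw [lintegral_congr_ae h0]
      simp
  · have hn : 0 < ‖w‖ := norm_pos_iff.2 hw
    set c := M / ‖w‖ with hc
    have hc0 : 0 < c := by positivity
    have hnorm : ‖c • w‖ = M := by
      rw [norm_smul, Real.norm_of_nonneg hc0.le, hc, div_mul_cancel₀ _ hn.ne']
    have h1 := hexp (c • w)
    rw [hnorm] at h1
    have h2 : ∫⁻ x in cell a, ‖value (c • w) x‖ₑ ^ k
        = ENNReal.ofReal (c ^ k) * ∫⁻ x in cell a, ‖value w x‖ₑ ^ k := by
      rw [← lintegral_const_mul' _ _ ENNReal.ofReal_ne_top]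
      refine lintegral_congr_ae ?_
      filter_upwards [value_smul c w] with x hx
      rw [hx, enorm_mul, mul_pow, Real.enorm_of_nonneg hc0.le, ENNReal.ofReal_pow hc0.le]
    rw [h2] at h1
    calc ∫⁻ x in cell a, ‖value w x‖ₑ ^ k
        = ENNReal.ofReal ((c ^ k)⁻¹) * (ENNReal.ofReal (c ^ k)
            * ∫⁻ x in cell a, ‖value w x‖ₑ ^ k) := by
          rw [← mul_assoc, ← ENNReal.ofReal_mul (by positivity), inv_mul_cancel₀ (by positivity),
            ENNReal.ofReal_one, one_mul]
      _ ≤ ENNReal.ofReal ((c ^ k)⁻¹) * ENNReal.ofReal (k.factorial * (C * Real.exp (D * M ^ 2))) := by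
          gcongr
      _ = _ := by
          rw [← ENNReal.ofReal_mul (by positivity), hc, div_pow, inv_div]
          congr 1
          ring

/-- Hölder with `k` equal exponents; the constants of the factors recombine to the same one. -/
theorem exists_lintegral_prod_value_le : ∃ C D : ℝ, 0 ≤ C ∧ 0 ≤ D ∧
    ∀ (k : ℕ) (h : Fin k → zeroMeanSobolev a) (M : ℝ), 0 < M →
      ∫⁻ x in cell a, ‖∏ i, value (h i) x‖ₑ
        ≤ ENNReal.ofReal (k.factorial * (C * Real.exp (D * M ^ 2)) / M ^ k * ∏ i, ‖h i‖) := by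
  obtain ⟨C, D, hC, hD, hb⟩ := exists_lintegral_value_pow_le_factorial (a := a)
  refine ⟨C, D, hC, hD, fun k h M hM => ?_⟩
  rcases Nat.eq_zero_or_pos k with rfl | hk
  · have := hb 0 0 M hM
    simpa using this
  have hk0 : (0 : ℝ) < k := by exact_mod_cast hk
  set J : ℝ := k.factorial * (C * Real.exp (D * M ^ 2)) / M ^ k with hJ
  have hJ0 : 0 ≤ J := by positivity
  have hroot : ∀ t : ENNReal, (t ^ k) ^ (1 / k : ℝ) = t := fun t => by
    rw [← ENNReal.rpow_natCast, ← ENNReal.rpow_mul, mul_one_div_cancel hk0.ne', ENNReal.rpow_one]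
  calc ∫⁻ x in cell a, ‖∏ i, value (h i) x‖ₑ
      = ∫⁻ x in cell a, ∏ i, (‖value (h i) x‖ₑ ^ k) ^ (1 / k : ℝ) := by
        refine lintegral_congr fun x => ?_
        simp only [hroot]
        rw [enorm_eq_nnnorm, nnnorm_prod]
        push_cast
        rfl
    _ ≤ ∏ i, (∫⁻ x in cell a, ‖value (h i) x‖ₑ ^ k) ^ (1 / k : ℝ) := by
        refine ENNReal.lintegral_prod_norm_pow_le _
          (fun i _ => ((measurable_value (h i)).enorm.pow_const k).aemeasurable) ?_
          fun i _ => by positivity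
        rw [Finset.sum_const, Finset.card_univ, Fintype.card_fin, nsmul_eq_mul,
          mul_one_div_cancel hk0.ne']
    _ ≤ ∏ i, (ENNReal.ofReal J ^ (1 / k : ℝ) * ENNReal.ofReal ‖h i‖) := by
        refine Finset.prod_le_prod' fun i _ => ?_
        refine (ENNReal.rpow_le_rpow (hb (h i) k M hM) (by positivity)).trans (le_of_eq ?_)
        rw [ENNReal.ofReal_mul hJ0, ENNReal.mul_rpow_of_nonneg _ _ (by positivity),
          ENNReal.ofReal_pow (norm_nonneg _), hroot]
    _ = ENNReal.ofReal (J * ∏ i, ‖h i‖) := by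
        rw [Finset.prod_mul_distrib, Finset.prod_const, Finset.card_univ, Fintype.card_fin,
          ← ENNReal.rpow_natCast, ← ENNReal.rpow_mul, one_div_mul_cancel hk0.ne', ENNReal.rpow_one,
          ENNReal.ofReal_mul hJ0, ENNReal.ofReal_prod_of_nonneg fun i _ => norm_nonneg _]

theorem integrable_prod_value {k : ℕ} (h : Fin k → zeroMeanSobolev a) :
    IntegrableOn (fun x => ∏ i, value (h i) x) (cell a) := by
  obtain ⟨C, D, -, -, hb⟩ := exists_lintegral_prod_value_le (a := a)
  refine ⟨(Finset.measurable_fun_prod _ fun i _ => measurable_value (h i)).aestronglyMeasurable, ?_⟩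
  exact (hb k h 1 one_pos).trans_lt ENNReal.ofReal_lt_top

/-- A weight on the period cell: an essentially bounded measurable function. -/
structure IsWeight (a : Module.Basis (Fin 2) ℝ Plane) (ρ : Plane → ℝ) (B : ℝ) : Prop where
  aestronglyMeasurable : AEStronglyMeasurable ρ ((volume : Measure Plane).restrict (cell a))
  bound : ∀ᵐ x ∂(volume : Measure Plane).restrict (cell a), ‖ρ x‖ ≤ B

variable {ρ : Plane → ℝ} {B : ℝ}

theorem IsWeight.integrable_mul (hρ : IsWeight a ρ B) {f : Plane → ℝ}
    (hf : IntegrableOn f (cell a)) : IntegrableOn (fun x => ρ x * f x) (cell a) :=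
  Integrable.bdd_mul hf hρ.aestronglyMeasurable hρ.bound

/-- The multilinear form `(h₁, …, h_k) ↦ ∫ ρ h₁ ⋯ h_k`. -/
def momentForm (hρ : IsWeight a ρ B) (k : ℕ) :
    MultilinearMap ℝ (fun _ : Fin k => zeroMeanSobolev a) ℝ where
  toFun h := ∫ x in cell a, ρ x * ∏ i, value (h i) x
  map_update_add' := by
    intro _ h i v w
    rw [← integral_add (hρ.integrable_mul (integrable_prod_value _))
      (hρ.integrable_mul (integrable_prod_value _))]
    refine integral_congr_ae ?_
    filter_upwards [value_add v w] with x hx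
    rw [← mul_add]
    congr 1
    have hu : ∀ y : zeroMeanSobolev a, ∏ j, value (Function.update h i y j) x
        = value y x * ∏ j ∈ Finset.univ.erase i, value (h j) x := by
      intro y
      rw [← Finset.mul_prod_erase _ _ (Finset.mem_univ i)]
      congr 1
      · simp
      · refine Finset.prod_congr rfl fun j hj => ?_
        rw [Function.update_of_ne (Finset.ne_of_mem_erase hj)]
    rw [hu, hu, hu, hx, add_mul]
  map_update_smul' := by
    intro _ h i c v
    rw [smul_eq_mul, ← integral_const_mul]
    refine integral_congr_ae ?_
    filter_upwards [value_smul c v] with x hx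
    have hu : ∀ y : zeroMeanSobolev a, ∏ j, value (Function.update h i y j) x
        = value y x * ∏ j ∈ Finset.univ.erase i, value (h j) x := by
      intro y
      rw [← Finset.mul_prod_erase _ _ (Finset.mem_univ i)]
      congr 1
      · simp
      · refine Finset.prod_congr rfl fun j hj => ?_
        rw [Function.update_of_ne (Finset.ne_of_mem_erase hj)]
    rw [hu, hu, hx]
    ring

/-- The functional `w ↦ ∫ ρ e^w` on `Ẇ^{1,2}(Ω)`. -/
def expFunctional (a : Module.Basis (Fin 2) ℝ Plane) (ρ : Plane → ℝ) (w : zeroMeanSobolev a) : ℝ :=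
  ∫ x in cell a, ρ x * Real.exp (value w x)

theorem integrable_exp_value (w : zeroMeanSobolev a) :
    IntegrableOn (fun x => Real.exp (value w x)) (cell a) := by
  obtain ⟨C, D, -, -, hb⟩ := exists_lintegral_exp_abs_le (a := a)
  refine ⟨(Real.measurable_exp.comp (measurable_value w)).aestronglyMeasurable, ?_⟩
  rw [hasFiniteIntegral_iff_ofReal (Filter.Eventually.of_forall fun x => (Real.exp_pos _).le)]
  refine lt_of_le_of_lt (lintegral_mono fun x => ?_) ((hb w).trans_lt ENNReal.ofReal_lt_top)
  exact ENNReal.ofReal_le_ofReal (Real.exp_le_exp.2 (le_abs_self _))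

theorem exists_integral_norm_momentForm_le (hB : 0 ≤ B) (hρ : IsWeight a ρ B) :
    ∃ C D : ℝ, 0 ≤ C ∧ 0 ≤ D ∧
      ∀ (k : ℕ) (h : Fin k → zeroMeanSobolev a) (M : ℝ), 0 < M →
        ∫ x in cell a, ‖ρ x * ∏ i, value (h i) x‖
          ≤ k.factorial * (C * Real.exp (D * M ^ 2)) / M ^ k * ∏ i, ‖h i‖ := by
  obtain ⟨C, D, hC, hD, hb⟩ := exists_lintegral_prod_value_le (a := a)
  refine ⟨B * C, D, by positivity, hD, fun k h M hM => ?_⟩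
  have hint := integrable_prod_value h
  have h1 : ∫ x in cell a, ‖∏ i, value (h i) x‖
      ≤ k.factorial * (C * Real.exp (D * M ^ 2)) / M ^ k * ∏ i, ‖h i‖ := by
    rw [integral_norm_eq_lintegral_enorm hint.1]
    exact ENNReal.toReal_le_of_le_ofReal
      (mul_nonneg (by positivity) (Finset.prod_nonneg fun _ _ => norm_nonneg _)) (hb k h M hM)
  calc ∫ x in cell a, ‖ρ x * ∏ i, value (h i) x‖
      ≤ ∫ x in cell a, B * ‖∏ i, value (h i) x‖ := by
        refine integral_mono_ae (hρ.integrable_mul hint).norm (hint.norm.const_mul B) ?_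
        filter_upwards [hρ.bound] with x hx
        rw [norm_mul]
        gcongr
    _ ≤ B * (k.factorial * (C * Real.exp (D * M ^ 2)) / M ^ k * ∏ i, ‖h i‖) := by
        rw [integral_const_mul]
        gcongr
    _ = _ := by ring

/-- The exponential functional is analytic. -/
theorem contDiff_expFunctional (hB : 0 ≤ B) (hρ : IsWeight a ρ B) :
    ContDiff ℝ ∞ (expFunctional a ρ) := by
  obtain ⟨C, D, hC, hD, hb⟩ := exists_integral_norm_momentForm_le hB hρ
  have hform : ∀ (k : ℕ) (M : ℝ), 0 < M → ∀ h : Fin k → zeroMeanSobolev a,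
      ‖momentForm hρ k h‖ ≤ k.factorial * (C * Real.exp (D * M ^ 2)) / M ^ k * ∏ i, ‖h i‖ :=
    fun k M hM h => (norm_integral_le_integral_norm _).trans (hb k h M hM)
  -- The Taylor series at `0`. Any `M` shows that its terms are continuous; `M = 1` is taken.
  set p : FormalMultilinearSeries ℝ (zeroMeanSobolev a) ℝ := fun k =>
    (k.factorial : ℝ)⁻¹ • (momentForm hρ k).mkContinuous _ (hform k 1 one_pos) with hp
  have hpn : ∀ (k : ℕ) (M : ℝ), 0 < M → ‖p k‖ * M ^ k ≤ C * Real.exp (D * M ^ 2) := by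
    intro k M hM
    have h1 : ‖p k‖ ≤ C * Real.exp (D * M ^ 2) / M ^ k := by
      refine ContinuousMultilinearMap.opNorm_le_bound (by positivity) fun h => ?_
      have hph : p k h = (k.factorial : ℝ)⁻¹ * momentForm hρ k h := rfl
      rw [hph, norm_mul, norm_inv, Real.norm_natCast]
      calc _ ≤ (k.factorial : ℝ)⁻¹
            * (k.factorial * (C * Real.exp (D * M ^ 2)) / M ^ k * ∏ i, ‖h i‖) := by
            gcongr
            exact hform k M hM h
        _ = _ := by field_simp
    rwa [le_div_iff₀ (by positivity)] at h1
  -- The bound on `‖p k‖ M^k` is independent of `k` for every `M > 0`; `M + 1` is used since the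
  -- given radius may be zero.
  have hrad : p.radius = ⊤ := by
    refine ENNReal.eq_top_of_forall_nnreal_le fun M => ?_
    refine p.le_radius_of_bound (C * Real.exp (D * ((M : ℝ) + 1) ^ 2)) fun k => ?_
    refine le_trans ?_ (hpn k ((M : ℝ) + 1) (by positivity))
    gcongr
    linarith
  have hps : HasFPowerSeriesOnBall (expFunctional a ρ) p 0 ⊤ := by
    refine ⟨hrad.ge, ENNReal.zero_lt_top, fun {y} _ => ?_⟩
    set F : ℕ → Plane → ℝ := fun k x => (k.factorial : ℝ)⁻¹ * (ρ x * ∏ _i : Fin k, value y x)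
    have hFi : ∀ k, Integrable (F k) ((volume : Measure Plane).restrict (cell a)) := fun k =>
      (hρ.integrable_mul (integrable_prod_value fun _ : Fin k => y)).const_mul _
    -- This makes the ratio `‖y‖ / M` less than one, so a geometric series justifies integrating
    -- termwise.
    set M : ℝ := 2 * ‖y‖ + 1 with hM
    have hM0 : 0 < M := by positivity
    have hsum : Summable fun k => ∫ x in cell a, ‖F k x‖ := by
      have hq : ‖y‖ / M < 1 := by
        rw [div_lt_one hM0, hM]; linarith [norm_nonneg y]
      refine Summable.of_nonneg_of_le (fun k => integral_nonneg fun x => norm_nonneg _)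
        (fun k => ?_) ((summable_geometric_of_lt_one (by positivity) hq).mul_left
          (C * Real.exp (D * M ^ 2)))
      have h1 := hb k (fun _ => y) M hM0
      rw [Finset.prod_const, Finset.card_univ, Fintype.card_fin] at h1
      simp only [F, norm_mul (k.factorial : ℝ)⁻¹, norm_inv, Real.norm_natCast]
      rw [integral_const_mul]
      calc _ ≤ (k.factorial : ℝ)⁻¹
            * (k.factorial * (C * Real.exp (D * M ^ 2)) / M ^ k * ‖y‖ ^ k) := by gcongr
        _ = _ := by rw [div_pow]; field_simp
    have hmain := hasSum_integral_of_summable_integral_norm hFi hsum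
    have hval : ∫ x in cell a, ∑' k, F k x = expFunctional a ρ (0 + y) := by
      rw [zero_add, expFunctional]
      refine integral_congr_ae (Filter.Eventually.of_forall fun x => ?_)
      have hs : HasSum (fun k : ℕ => (value y x) ^ k / (k.factorial : ℝ)) (Real.exp (value y x)) := by
        rw [Real.exp_eq_exp_ℝ]
        exact NormedSpace.expSeries_div_hasSum_exp (value y x)
      have hs' := hs.mul_left (ρ x)
      simp only
      rw [← hs'.tsum_eq]
      refine tsum_congr fun k => ?_
      simp only [F, Finset.prod_const, Finset.card_univ, Fintype.card_fin]
      ring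
    rw [hval] at hmain
    refine hmain.congr_fun fun k => ?_
    simp only [hp, F, integral_const_mul]
    rfl
  refine contDiff_iff_contDiffAt.2 fun w => ?_
  exact (hps.analyticAt_of_mem (by simp)).contDiffAt

end Analytic

/-! ### The coefficients of the constraint system -/

section Coefficients

variable {a : Module.Basis (Fin 2) ℝ Plane} {N : ℕ}

/-- `∫_Ω e^{u_j⁰ + w_j} e^{u_k⁰ + w_k}`. -/
def intExpMul (u₀ : Fin N → Plane → ℝ) (w : Space a N) (j k : Fin N) : ℝ :=
  ∫ x in cell a, Real.exp (u₀ j x + value (w j) x) * Real.exp (u₀ k x + value (w k) x)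

/-- The properties of the background functions used below: measurability and an upper bound. -/
structure IsBoundedAbove (a : Module.Basis (Fin 2) ℝ Plane) (u₀ : Fin N → Plane → ℝ)
    (C : Fin N → ℝ) : Prop where
  aestronglyMeasurable : ∀ j,
    AEStronglyMeasurable (u₀ j) ((volume : Measure Plane).restrict (cell a))
  le : ∀ j, ∀ᵐ x ∂(volume : Measure Plane).restrict (cell a), u₀ j x ≤ C j

variable {u₀ : Fin N → Plane → ℝ} {C : Fin N → ℝ}

namespace IsBoundedAbove

theorem isWeight (hu : IsBoundedAbove a u₀ C) (j : Fin N) :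
    IsWeight a (fun x => Real.exp (u₀ j x)) (Real.exp (C j)) := by
  refine ⟨Real.continuous_exp.comp_aestronglyMeasurable (hu.aestronglyMeasurable j), ?_⟩
  filter_upwards [hu.le j] with x hx
  rw [Real.norm_of_nonneg (Real.exp_pos _).le]
  exact Real.exp_le_exp.2 hx

theorem isWeight_mul (hu : IsBoundedAbove a u₀ C) (j k : Fin N) :
    IsWeight a (fun x => Real.exp (u₀ j x) * Real.exp (u₀ k x))
      (Real.exp (C j) * Real.exp (C k)) := by
  refine ⟨(hu.isWeight j).aestronglyMeasurable.mul (hu.isWeight k).aestronglyMeasurable, ?_⟩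
  filter_upwards [(hu.isWeight j).bound, (hu.isWeight k).bound] with x hx hx'
  rw [norm_mul]
  exact mul_le_mul hx hx' (norm_nonneg _) (Real.exp_pos _).le

end IsBoundedAbove

theorem intExp_eq (u₀ : Fin N → Plane → ℝ) (w : Space a N) (j : Fin N) :
    intExp u₀ w j = expFunctional a (fun x => Real.exp (u₀ j x)) (w j) := by
  simp only [intExp, expFunctional, Real.exp_add]

theorem exp_mul_exp_ae_eq (u₀ : Fin N → Plane → ℝ) (w : Space a N) (j k : Fin N) :
    ∀ᵐ x ∂(volume : Measure Plane).restrict (cell a),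
      Real.exp (u₀ j x + value (w j) x) * Real.exp (u₀ k x + value (w k) x)
        = Real.exp (u₀ j x) * Real.exp (u₀ k x) * Real.exp (value (w j + w k) x) := by
  filter_upwards [value_add (w j) (w k)] with x hx
  simp only [hx, Real.exp_add]
  ring

theorem intExpMul_eq (u₀ : Fin N → Plane → ℝ) (w : Space a N) (j k : Fin N) :
    intExpMul u₀ w j k
      = expFunctional a (fun x => Real.exp (u₀ j x) * Real.exp (u₀ k x)) (w j + w k) :=
  integral_congr_ae (exp_mul_exp_ae_eq u₀ w j k)

theorem intExpSq_eq (u₀ : Fin N → Plane → ℝ) (w : Space a N) (j : Fin N) :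
    intExpSq u₀ w j = intExpMul u₀ w j j := by
  simp only [intExpSq, intExpMul, two_mul, Real.exp_add]

theorem integral_exp_pos {f : Plane → ℝ} (hf : IntegrableOn f (cell a)) (hpos : ∀ x, 0 < f x) :
    0 < ∫ x in cell a, f x := by
  rw [integral_pos_iff_support_of_nonneg (fun x => (hpos x).le) hf,
    show Function.support f = univ from eq_univ_of_forall fun x => (hpos x).ne',
    Measure.restrict_apply_univ]
  exact pos_iff_ne_zero.2 (ZSpan.measure_fundamentalDomain_ne_zero a)

namespace IsBoundedAbove

theorem integrable_exp (hu : IsBoundedAbove a u₀ C) (w : Space a N) (j : Fin N) :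
    IntegrableOn (fun x => Real.exp (u₀ j x + value (w j) x)) (cell a) := by
  simp only [Real.exp_add]
  exact (hu.isWeight j).integrable_mul (integrable_exp_value (w j))

theorem integrable_exp_mul (hu : IsBoundedAbove a u₀ C) (w : Space a N) (j k : Fin N) :
    IntegrableOn (fun x => Real.exp (u₀ j x + value (w j) x)
      * Real.exp (u₀ k x + value (w k) x)) (cell a) :=
  Integrable.congr ((hu.isWeight_mul j k).integrable_mul (integrable_exp_value (w j + w k)))
    (Filter.EventuallyEq.symm (exp_mul_exp_ae_eq u₀ w j k))

theorem intExp_pos (hu : IsBoundedAbove a u₀ C) (w : Space a N) (j : Fin N) : 0 < intExp u₀ w j :=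
  integral_exp_pos (hu.integrable_exp w j) fun _ => Real.exp_pos _

theorem intExpMul_pos (hu : IsBoundedAbove a u₀ C) (w : Space a N) (j k : Fin N) :
    0 < intExpMul u₀ w j k :=
  integral_exp_pos (hu.integrable_exp_mul w j k) fun _ =>
    mul_pos (Real.exp_pos _) (Real.exp_pos _)

theorem intExpSq_pos (hu : IsBoundedAbove a u₀ C) (w : Space a N) (j : Fin N) :
    0 < intExpSq u₀ w j := by
  rw [intExpSq_eq]; exact hu.intExpMul_pos w j j

theorem intExpMul_le (hu : IsBoundedAbove a u₀ C) (w : Space a N) (j k : Fin N) :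
    intExpMul u₀ w j k ≤ √(intExpSq u₀ w j) * √(intExpSq u₀ w k) := by
  have hj := hu.intExpSq_pos w j
  have hk := hu.intExpSq_pos w k
  set α := √(intExpSq u₀ w j) with hα
  set β := √(intExpSq u₀ w k) with hβ
  have hα0 : 0 < α := Real.sqrt_pos.2 hj
  have hβ0 : 0 < β := Real.sqrt_pos.2 hk
  have hα2 : intExpMul u₀ w j j = α ^ 2 := by rw [← intExpSq_eq, hα, Real.sq_sqrt hj.le]
  have hβ2 : intExpMul u₀ w k k = β ^ 2 := by rw [← intExpSq_eq, hβ, Real.sq_sqrt hk.le]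
  have h : 2 * α * β * intExpMul u₀ w j k
      ≤ β ^ 2 * intExpMul u₀ w j j + α ^ 2 * intExpMul u₀ w k k := by
    unfold intExpMul
    rw [← integral_const_mul, ← integral_const_mul, ← integral_const_mul,
      ← integral_add ((hu.integrable_exp_mul w j j).const_mul _)
        ((hu.integrable_exp_mul w k k).const_mul _)]
    refine integral_mono ((hu.integrable_exp_mul w j k).const_mul _)
      (((hu.integrable_exp_mul w j j).const_mul _).add
        ((hu.integrable_exp_mul w k k).const_mul _)) fun x => ?_
    nlinarith [sq_nonneg (β * Real.exp (u₀ j x + value (w j) x)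
      - α * Real.exp (u₀ k x + value (w k) x))]
  rw [hα2, hβ2] at h
  have h2 : 2 * α * β * intExpMul u₀ w j k ≤ 2 * α * β * (α * β) := by nlinarith
  exact le_of_mul_le_mul_left h2 (by positivity)

end IsBoundedAbove

/-- The matrix `s r_k ∫ e^{u_j⁰ + w_j} e^{u_k⁰ + w_k}`, restricted to neighbouring indices. -/
def couplingMatrix (u₀ : Fin N → Plane → ℝ) (s : ℝ) (w : Space a N) (j k : Fin N) : ℝ :=
  if k ∈ nbrs j then s * r k * intExpMul u₀ w j k else 0

/-- The factors `1 / (4 r_j ∫ e^{2(u_j⁰ + w_j)})`. -/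
def prefactor (u₀ : Fin N → Plane → ℝ) (w : Space a N) (j : Fin N) : ℝ :=
  1 / (4 * r j * intExpSq u₀ w j)

/-- The constant terms `8 b_j λ⁻¹ ∫ e^{2(u_j⁰ + w_j)}` of the discriminants. -/
def threshold (n : Fin N → ℕ) (u₀ : Fin N → Plane → ℝ) (lam : ℝ) (w : Space a N) (j : Fin N) : ℝ :=
  8 * b n j / lam * intExpSq u₀ w j

/-- The signs `(-1)^{ε_j}`. -/
def branchSign (ε : Fin N → Fin 2) (j : Fin N) : ℝ := (-1) ^ (ε j : ℕ)

theorem sum_couplingMatrix (u₀ : Fin N → Plane → ℝ) (s : ℝ) (w : Space a N) (t : Fin N → ℝ)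
    (j : Fin N) :
    ∑ k, couplingMatrix u₀ s w j k * t k
      = ∑ k ∈ nbrs j, s * r k * intExpMul u₀ w j k * t k := by
  simp only [couplingMatrix, ite_mul, zero_mul]
  rw [Finset.sum_ite_mem, Finset.univ_inter]

theorem Qtilde_eq (hu : IsBoundedAbove a u₀ C) (s : ℝ) (w : Space a N) (t : Fin N → ℝ)
    (j : Fin N) :
    Qtilde u₀ s w t j = affineForm (intExp u₀ w) (couplingMatrix u₀ s w) t j := by
  have hint : ∀ k ∈ nbrs j, IntegrableOn (fun x => s * r k * t k
      * (Real.exp (u₀ j x + value (w j) x) * Real.exp (u₀ k x + value (w k) x))) (cell a) :=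
    fun k _ => (hu.integrable_exp_mul w j k).const_mul _
  rw [affineForm, sum_couplingMatrix, Qtilde, intExp]
  have h1 : ∀ x, Real.exp (u₀ j x + value (w j) x) *
      (1 + ∑ k : Fin N with k.val + 1 = j.val ∨ k.val = j.val + 1,
        s * r k * t k * Real.exp (u₀ k x + value (w k) x))
      = Real.exp (u₀ j x + value (w j) x) + ∑ k ∈ nbrs j, s * r k * t k
        * (Real.exp (u₀ j x + value (w j) x) * Real.exp (u₀ k x + value (w k) x)) := by
    intro x
    rw [mul_add, mul_one, Finset.mul_sum]
    congr 1
    exact Finset.sum_congr rfl fun k _ => by ring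
  simp only [h1]
  rw [integral_add (hu.integrable_exp w j) (integrable_finsetSum _ hint),
    integral_finsetSum _ hint]
  congr 1
  refine Finset.sum_congr rfl fun k _ => ?_
  rw [integral_const_mul, intExpMul]
  ring

theorem Phi_eq (hu : IsBoundedAbove a u₀ C) (n : Fin N → ℕ) (lam s : ℝ) (ε : Fin N → Fin 2)
    (w : Space a N) :
    Phi n u₀ lam s ε w = fun t => t - systemMap (prefactor u₀ w) (intExp u₀ w)
      (threshold n u₀ lam w) (branchSign ε) (couplingMatrix u₀ s w) t := by
  ext t j
  simp only [Phi, Qtilde_eq hu, Pi.sub_apply, systemMap, branch, prefactor, threshold, branchSign]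

/-- With `z` the reciprocal `L²` norms, Cauchy-Schwarz gives `M_{jk} z_k ≤ s r_k √A_j`, where `A_j =
intExpSq u₀ w j`. Summing over neighbours with `s ≤ 1` yields `√A_j (2 r_j - 1)`, and `2 c_j = 1 /
(2 r_j A_j)` leaves the factor `1 - 1 / (2 r_j) < 1`. -/
theorem isSolvable_of_mem_admissible (hu : IsBoundedAbove a u₀ C) {n : Fin N → ℕ}
    (hn : ∃ k, 0 < n k) {lam s : ℝ} (hlam : 0 < lam) (hs : s ∈ Icc (0 : ℝ) 1)
    (ε : Fin N → Fin 2) {w : Space a N} (hw : w ∈ admissible n u₀ lam) :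
    IsSolvable (prefactor u₀ w) (intExp u₀ w) (threshold n u₀ lam w) (branchSign ε)
      (couplingMatrix u₀ s w) (fun j => 1 / √(intExpSq u₀ w j)) where
  c_pos j := by
    have := r_pos j
    have := hu.intExpSq_pos w j
    unfold prefactor; positivity
  e_pos := hu.intExp_pos w
  γ_pos j := by
    have := b_pos hn j
    have := hu.intExpSq_pos w j
    unfold threshold; positivity
  γ_le j := by
    have := hw j
    rwa [mul_div_right_comm] at this
  σ_abs j := by simp [branchSign, abs_pow]
  M_nonneg j k := by
    unfold couplingMatrix
    split_ifs
    · exact mul_nonneg (mul_nonneg hs.1 (r_pos k).le) (hu.intExpMul_pos w j k).le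
    · exact le_rfl
  z_pos j := one_div_pos.2 (Real.sqrt_pos.2 (hu.intExpSq_pos w j))
  super j := by
    have hA := hu.intExpSq_pos w j
    have hr := r_pos j
    rw [sum_couplingMatrix, prefactor]
    set α := √(intExpSq u₀ w j) with hα
    have hα0 : 0 < α := Real.sqrt_pos.2 hA
    have hα2 : intExpSq u₀ w j = α ^ 2 := (Real.sq_sqrt hA.le).symm
    have hsum : ∑ k ∈ nbrs j, s * r k * intExpMul u₀ w j k * (1 / √(intExpSq u₀ w k))
        ≤ α * (2 * r j - 1) := by
      rw [← sum_nbrs_r, Finset.mul_sum]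
      refine Finset.sum_le_sum fun k _ => ?_
      have hβ : 0 < √(intExpSq u₀ w k) := Real.sqrt_pos.2 (hu.intExpSq_pos w k)
      have h1 := hu.intExpMul_le w j k
      have h2 : intExpMul u₀ w j k * (1 / √(intExpSq u₀ w k)) ≤ α := by
        rw [mul_one_div, div_le_iff₀ hβ]; exact h1
      have h3 : 0 ≤ intExpMul u₀ w j k * (1 / √(intExpSq u₀ w k)) :=
        mul_nonneg (hu.intExpMul_pos w j k).le (by positivity)
      calc s * r k * intExpMul u₀ w j k * (1 / √(intExpSq u₀ w k))
          = s * (r k * (intExpMul u₀ w j k * (1 / √(intExpSq u₀ w k)))) := by ring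
        _ ≤ 1 * (r k * (intExpMul u₀ w j k * (1 / √(intExpSq u₀ w k)))) :=
            mul_le_mul_of_nonneg_right hs.2 (mul_nonneg (r_pos k).le h3)
        _ ≤ 1 * (r k * α) := by
            have := (r_pos k).le
            gcongr
        _ = α * r k := by ring
    calc 2 * (1 / (4 * r j * intExpSq u₀ w j))
          * ∑ k ∈ nbrs j, s * r k * intExpMul u₀ w j k * (1 / √(intExpSq u₀ w k))
        ≤ 2 * (1 / (4 * r j * intExpSq u₀ w j)) * (α * (2 * r j - 1)) := by gcongr
      _ = 1 / α * ((2 * r j - 1) / (2 * r j)) := by rw [hα2]; field_simp; ring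
      _ < 1 / α * 1 := by
          gcongr
          rw [div_lt_one (by positivity)]; linarith
      _ = 1 / α := mul_one _

theorem contDiff_intExpMul (hu : IsBoundedAbove a u₀ C) (j k : Fin N) :
    ContDiff ℝ ∞ fun w : Space a N => intExpMul u₀ w j k := by
  simp only [intExpMul_eq]
  exact (contDiff_expFunctional (by positivity) (hu.isWeight_mul j k)).comp
    (f := fun w : Space a N => w j + w k) (by fun_prop)

theorem contDiff_intExp (hu : IsBoundedAbove a u₀ C) (j : Fin N) :
    ContDiff ℝ ∞ fun w : Space a N => intExp u₀ w j := by
  simp only [intExp_eq]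
  exact (contDiff_expFunctional (by positivity) (hu.isWeight j)).comp
    (f := fun w : Space a N => w j) (by fun_prop)

/-- All coefficients of the system, as a function of `w`. -/
def coefficients (n : Fin N → ℕ) (u₀ : Fin N → Plane → ℝ) (lam s : ℝ) (w : Space a N) :
    (Fin N → ℝ) × (Fin N → ℝ) × (Fin N → ℝ) × (Fin N → Fin N → ℝ) :=
  (prefactor u₀ w, intExp u₀ w, threshold n u₀ lam w, couplingMatrix u₀ s w)

theorem contDiff_coefficients (hu : IsBoundedAbove a u₀ C) (n : Fin N → ℕ) (lam s : ℝ) :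
    ContDiff ℝ ∞ (coefficients (a := a) n u₀ lam s) := by
  have hsq : ∀ j, ContDiff ℝ ∞ fun w : Space a N => intExpSq u₀ w j := fun j => by
    simp only [intExpSq_eq]; exact contDiff_intExpMul hu j j
  refine ContDiff.prodMk (contDiff_pi.2 fun j => ?_) (ContDiff.prodMk
    (contDiff_pi.2 fun j => contDiff_intExp hu j) (ContDiff.prodMk (contDiff_pi.2 fun j => ?_)
    (contDiff_pi.2 fun j => contDiff_pi.2 fun k => ?_)))
  · unfold prefactor
    exact contDiff_const.div (contDiff_const.mul (hsq j)) fun w =>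
      (mul_pos (mul_pos (by norm_num) (r_pos j)) (hu.intExpSq_pos w j)).ne'
  · exact contDiff_const.mul (hsq j)
  · unfold couplingMatrix
    split_ifs
    · exact contDiff_const.mul (contDiff_intExpMul hu j k)
    · exact contDiff_const

theorem IsSmoothNear.continuousWithinAt {E G : Type*} [NormedAddCommGroup E] [NormedSpace ℝ E]
    [NormedAddCommGroup G] [NormedSpace ℝ G] {T : E → G} {S : Set E} {w : E} (hw : w ∈ S)
    (h : IsSmoothNear T S w) : ContinuousWithinAt T S w := by
  obtain ⟨U, hU, hwU, T', hT', heq⟩ := h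
  have hc : ContinuousAt T' w := (hT'.continuousOn.continuousAt (hU.mem_nhds hwU))
  refine hc.continuousWithinAt.congr_of_eventuallyEq ?_ (heq ⟨hwU, hw⟩).symm
  filter_upwards [self_mem_nhdsWithin, mem_nhdsWithin_of_mem_nhds (hU.mem_nhds hwU)] with x hx hxU
  exact (heq ⟨hxU, hx⟩).symm

end Coefficients

end ChernSimons

end

theorem corollary2p1 {N : ℕ} (hN : 3 ≤ N)
    (a : Module.Basis (Fin 2) ℝ ChernSimons.Plane)
    (n : Fin N → ℕ) (hn : ∃ k, 0 < n k)
    (p : (j : Fin N) → Fin (n j) → ChernSimons.Plane)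
    (u₀ : Fin N → ChernSimons.Plane → ℝ)
    (hu₀ : ∀ j, ChernSimons.IsBackground a (p j) (u₀ j))
    (lam : ℝ) (hlam : 0 < lam)
    (ε : Fin N → Fin 2) (s : ℝ) (hs : s ∈ Set.Icc (0 : ℝ) 1) :
    ∃ T : ChernSimons.Space a N → (Fin N → ℝ),
      (∀ w ∈ ChernSimons.admissible n u₀ lam,
        (∀ j, 0 < T w j) ∧
        ChernSimons.Phi n u₀ lam s ε w (T w) = 0 ∧
        (∀ t : Fin N → ℝ, ChernSimons.Phi n u₀ lam s ε w t = 0 → t = T w) ∧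
        ChernSimons.IsNondegenerate (ChernSimons.Phi n u₀ lam s ε w) (T w)) ∧
      ContinuousOn T (ChernSimons.admissible n u₀ lam) ∧
      (∀ w ∈ ChernSimons.admissible n u₀ lam,
        (0 < s ∨ w ∈ ChernSimons.strictlyAdmissible n u₀ lam) →
          ChernSimons.IsSmoothNear T (ChernSimons.admissible n u₀ lam) w) := by
  open ChernSimons in
  choose C hC using fun j => (hu₀ j).exists_ae_le
  have hu : IsBoundedAbove a u₀ C := ⟨fun j => (hu₀ j).integrable.1, hC⟩
  have hsol : ∀ w ∈ admissible n u₀ lam, IsSolvable (prefactor u₀ w) (intExp u₀ w)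
      (threshold n u₀ lam w) (branchSign ε) (couplingMatrix u₀ s w)
      (fun j => 1 / √(intExpSq u₀ w j)) :=
    fun w hw => isSolvable_of_mem_admissible hu hn hlam hs ε hw
  -- Outside `𝒜` the value `0` is an arbitrary choice that makes the solution map total.
  have hex : ∀ w : Space a N, ∃ t : Fin N → ℝ, w ∈ admissible n u₀ lam →
      systemMap (prefactor u₀ w) (intExp u₀ w) (threshold n u₀ lam w) (branchSign ε)
        (couplingMatrix u₀ s w) t = t := by
    intro w
    by_cases hw : w ∈ admissible n u₀ lam
    · obtain ⟨t, ht⟩ := (hsol w hw).exists_eq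
      exact ⟨t, fun _ => ht⟩
    · exact ⟨0, fun h => absurd h hw⟩
  choose T hT using hex
  have hsmooth : ∀ w ∈ admissible n u₀ lam, (0 < s ∨ w ∈ strictlyAdmissible n u₀ lam) →
      IsSmoothNear T (admissible n u₀ lam) w := by
    intro w hw hcond
    -- For `s > 0` a positive entry in each row makes the discriminant positive even on the boundary
    -- of `𝒜`; for `s = 0` strict admissibility is what remains.
    have hdisc : ∀ j, 0 < affineForm (intExp u₀ w) (couplingMatrix u₀ s w) (T w) j ^ 2
        - threshold n u₀ lam w j := by
      intro j
      refine (hsol w hw).discr_pos ((hsol w hw).pos_of_eq (hT w hw)) ?_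
      rcases hcond with hs0 | hstrict
      · left
        obtain ⟨k, hk⟩ := nbrs_nonempty (by omega : 2 ≤ N) j
        refine ⟨k, ?_⟩
        rw [couplingMatrix, if_pos hk]
        exact mul_pos (mul_pos hs0 (r_pos k)) (hu.intExpMul_pos w j k)
      · right
        have := hstrict j
        rwa [mul_div_right_comm] at this
    obtain ⟨τ, hτ, hτeq⟩ := (hsol w hw).exists_contDiffAt_solution (hT w hw) hdisc
    obtain ⟨V, hV, hVo, hwV⟩ := eventually_nhds_iff.1 ((hτ.eventually (by simp)).and hτeq)
    have hΘ := contDiff_coefficients (a := a) hu n lam s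
    refine ⟨coefficients n u₀ lam s ⁻¹' V, hVo.preimage hΘ.continuous, hwV,
      τ ∘ coefficients n u₀ lam s, fun w' hw' => ?_, ?_⟩
    · exact (((hV _ hw').1.of_le le_top).comp w' hΘ.contDiffAt).contDiffWithinAt
    · rintro w' ⟨hw', hadm⟩
      -- The implicit function need not be the chosen branch a priori; global uniqueness identifies
      -- it with `T` on `𝒜`.
      exact (hsol w' hadm).eq_of_systemMap_eq (hV _ hw').2 (hT w' hadm)
  refine ⟨T, fun w hw => ⟨(hsol w hw).pos_of_eq (hT w hw), ?_, fun t ht => ?_, ?_⟩, ?_, hsmooth⟩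
  · rw [Phi_eq hu]
    exact sub_eq_zero.2 (hT w hw).symm
  · rw [Phi_eq hu] at ht
    exact (hsol w hw).eq_of_systemMap_eq (sub_eq_zero.1 ht).symm (hT w hw)
  · rw [Phi_eq hu]
    exact (hsol w hw).exists_hasFDerivAt_sub (hT w hw)
  · rcases hs.1.lt_or_eq with hs0 | hs0
    · exact fun w hw => (hsmooth w hw (Or.inl hs0)).continuousWithinAt hw
    -- For `s = 0` the system decouples into a closed formula, continuous even where a discriminant
    -- vanishes and the square root is not differentiable.
    · have hexpl : Set.EqOn T (fun w j => prefactor u₀ w j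
          * branch (branchSign ε j) (threshold n u₀ lam w j) (intExp u₀ w j))
          (admissible n u₀ lam) := by
        intro w hw
        rw [← hT w hw]
        ext j
        simp [systemMap, affineForm, couplingMatrix, ← hs0]
      refine ContinuousOn.congr (Continuous.continuousOn ?_) hexpl
      have hc : Continuous fun w : Space a N => coefficients n u₀ lam s w :=
        (contDiff_coefficients hu n lam s).continuous
      refine continuous_pi fun j => ?_
      have h1 : Continuous fun w : Space a N => prefactor u₀ w j :=
        (continuous_apply j).comp (continuous_fst.comp hc)
      have h2 : Continuous fun w : Space a N => intExp u₀ w j := (contDiff_intExp hu j).continuous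
      have h3 : Continuous fun w : Space a N => threshold n u₀ lam w j :=
        (continuous_apply j).comp
          (continuous_fst.comp (continuous_snd.comp (continuous_snd.comp hc)))
      unfold branch
      fun_prop
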